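/- A \emph{search problem} is a relation $R\subseteq\{0,1\}^*\times\{0,1\}^*$; $x$ is a \emph{valid input} if $(x,y)\in R$ for some $y$, and such a $y$ is a \emph{valid output} on $x$. Write $n=|x|$. A \emph{randomized log-space algorithm} is a probabilistic Turing transducer (two-way read-only input tape, work tapes, one-way write-only output tape, fresh fair coin tosses that are accessed one-way) which, on every input of length $m$ and for all coin tosses, halts in $\mathrm{poly}(m)$ steps and uses $O(\log m)$ work cells. An event depending on a valid input $x$ and on coin tosses holds \emph{with high probability} if for some function $\varepsilon$ with $\varepsilon(n)\to0$ as $n\to\infty$ it has probability at least $1-\varepsilon(n)$ for every valid input $x$ of length $n$. $R$ has \emph{log-space reproducible solutions} if there are randomized log-space algorithms $A$ and $B$ such that for all valid inputs $x$, with high probability, $A(x)$ outputs a string $t_x$ of length $O(\log n)$ with the following property: there exists some $y$ with $(x,y)\in R$ such that $B$ on input $(x,t_x)$ outputs $y$ with high probability (over the coin tosses of $B$, with an error bound $\varepsilon(n)\to0$ that does not depend on $t_x$). \textbf{Lemma.} For every search problem $R$ the following are equivalent: \begin{enumerate} \item $R$ has log-space reproducible solutions; \item $R$ satisfies the same definition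 with "$B$ on input $(x,t_x)$ outputs $y$ with high probability" replaced by "$B$ on input $(x,t_x)$ outputs $y$ with probability at least $2/3$"; \item there is a randomized log-space algorithm $C$ such that for all valid inputs $x$, with high probability, $C(x)$ outputs two identical copies of a valid output, that is, a pair $(y,y)$ with $(x,y)\in R$. \end{enumerate} -/

import Mathlib

open MeasureTheory Filter Topology

namespace RandLogSpace

/-- Head movements. -/
inductive Move where
  | left
  | stay
  | right

/-- What the input head can see: an end marker or an input symbol. -/
inductive InSym (I : Type) where
  | leftEnd
  | symbol (a : I)
  | rightEnd

/-- The symbol at position `p` of the read-only input tape: the left end marker is at position `0`,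
the word `x` occupies the positions `1, …, |x|`, and then comes the right end marker. -/
def inputSymbol {I : Type} (x : List I) : ℕ → InSym I
  | 0 => InSym.leftEnd
  | p + 1 =>
    match x[p]? with
    | some a => InSym.symbol a
    | none => InSym.rightEnd

/-- The input head never leaves the positions `0, …, n + 1`, where `n` is the input length. -/
def moveInput (n : ℕ) (p : ℕ) : Move → ℕ
  | Move.left => p - 1
  | Move.stay => p
  | Move.right => min (p + 1) (n + 1)

/-- Work tapes are infinite to the right; moving left from cell `0` leaves the head there. -/
def moveWork (p : ℕ) : Move → ℕ
  | Move.left => p - 1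
  | Move.stay => p
  | Move.right => p + 1

/-- The effect of one transition. -/
structure Action (Q Γ O : Type) (k : ℕ) where
  /-- the next state -/
  next : Q
  /-- the symbols written on the work tapes -/
  write : Fin k → Γ
  /-- the movements of the work heads -/
  moveW : Fin k → Move
  /-- the movement of the input head -/
  moveI : Move
  /-- the symbol appended to the output tape, if any -/
  emit : Option O

/-- A probabilistic Turing transducer with input alphabet `I` and output alphabet `O`: a two-way
read-only input tape, finitely many work tapes, a one-way write-only output tape, and a fresh
coin toss (with one-way access) at each step. -/
structure Transducer (I O : Type) where
  /-- the states -/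
  State : Type
  /-- the work alphabet -/
  Sym : Type
  finiteState : Finite State
  finiteSym : Finite Sym
  /-- the number of work tapes -/
  tapes : ℕ
  /-- the blank symbol of the work tapes -/
  blank : Sym
  /-- the initial state -/
  start : State
  /-- the halting states -/
  halt : State → Prop
  /-- the transition: state, input symbol, work symbols and coin toss determine the action -/
  δ : State → InSym I → (Fin tapes → Sym) → Bool → Action State Sym O tapes

namespace Transducer

variable {I O : Type}

/-- Configurations (together with the output written so far). -/
structure Config (M : Transducer I O) where
  state : M.State
  inputHead : ℕ
  head : Fin M.tapes → ℕ
  tape : Fin M.tapes → ℕ → M.Sym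
  output : List O

/-- The initial configuration. -/
def init (M : Transducer I O) : M.Config where
  state := M.start
  inputHead := 0
  head := fun _ => 0
  tape := fun _ _ => M.blank
  output := []

open Classical in
/-- One step on input `x` with coin toss `b`; a halting configuration does not change. -/
noncomputable def step (M : Transducer I O) (x : List I) (b : Bool) (c : M.Config) : M.Config :=
  if M.halt c.state then c
  else
    let a := M.δ c.state (inputSymbol x c.inputHead) (fun i => c.tape i (c.head i)) b
    { state := a.next
      inputHead := moveInput x.length c.inputHead a.moveI
      head := fun i => moveWork (c.head i) (a.moveW i)
      tape := fun i => Function.update (c.tape i) (c.head i) (a.write i)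
      output := c.output ++ a.emit.toList }

/-- The configuration after `t` steps on input `x` when the coin tosses are `r 0, r 1, …`. -/
noncomputable def run (M : Transducer I O) (x : List I) (r : ℕ → Bool) : ℕ → M.Config
  | 0 => M.init
  | t + 1 => M.step x (r t) (M.run x r t)

/-- On input `x` with coin tosses `r`, the machine halts with the word `w` on its output tape. -/
def Outputs (M : Transducer I O) (x : List I) (r : ℕ → Bool) (w : List O) : Prop :=
  ∃ t, M.halt (M.run x r t).state ∧ (M.run x r t).output = w

/-- The machine is a randomized log-space algorithm: on all inputs of length `n` and for all coin
tosses it halts within a polynomial number of steps and visits only `O(log n)` work cells. -/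
def IsLogSpace (M : Transducer I O) : Prop :=
  (∃ p : Polynomial ℕ, ∀ x r, M.halt (M.run x r (p.eval x.length)).state) ∧
  (∃ c : ℕ, ∀ x r t i, (M.run x r t).head i < c * (Nat.log 2 x.length + 1))

end Transducer

/-- The law of a sequence of independent fair coin tosses. -/
noncomputable def coins : Measure (ℕ → Bool) :=
  Measure.infinitePi fun _ : ℕ => (PMF.uniformOfFintype Bool).toMeasure

/-- The probability of an event that depends on the coin tosses. -/
noncomputable def prob (E : (ℕ → Bool) → Prop) : ℝ :=
  coins.real {r | E r}

/-- A search problem: `R x y` says that `y` is a valid output on `x`. -/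
abbrev SearchProblem := List Bool → List Bool → Prop

/-- The set of valid inputs of a search problem. -/
def SearchProblem.validInputs (R : SearchProblem) : Set (List Bool) := {x | ∃ y, R x y}

/-- The pair `(u, v)` as a word over `{0, 1, comma}`; `none` is the comma. -/
def encodePair (u v : List Bool) : List (Option Bool) :=
  u.map some ++ none :: v.map some

/-- `B` on input `(x, t)` outputs one particular valid output `y` on `x` except with probability
at most `η`. -/
def Reproduces (R : SearchProblem) (B : Transducer (Option Bool) Bool) (η : ℝ)
    (x t : List Bool) : Prop :=
  ∃ y, R x y ∧ 1 - η ≤ prob fun r => B.Outputs (encodePair x t) r y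

/-- There are randomized log-space algorithms `A` and `B` such that, on each valid input `x` of
length `n`, except with probability at most `ε n`, the algorithm `A` outputs a string `t` of
length `O(log n)` with which `B` reproduces a fixed valid output except with probability at most
`η n`. -/
def ReproducibleWithin (R : SearchProblem) (ε η : ℕ → ℝ) : Prop :=
  ∃ (A : Transducer Bool Bool) (B : Transducer (Option Bool) Bool),
    A.IsLogSpace ∧ B.IsLogSpace ∧
    ∃ c : ℕ, ∀ x ∈ R.validInputs,
      1 - ε x.length ≤ prob fun r =>
        ∃ t, A.Outputs x r t ∧ t.length ≤ c * (Nat.log 2 x.length + 1) ∧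
          Reproduces R B (η x.length) x t

/-- Log-space reproducible solutions, with high probability meaning `1 - o(1)` throughout. -/
def LogSpaceReproducible (R : SearchProblem) : Prop :=
  ∃ ε : ℕ → ℝ, Tendsto ε atTop (𝓝 0) ∧ ReproducibleWithin R ε ε

/-- The same notion where `B` need only succeed with probability `2 / 3`. -/
def LogSpaceReproducibleTwoThirds (R : SearchProblem) : Prop :=
  ∃ ε : ℕ → ℝ, Tendsto ε atTop (𝓝 0) ∧ ReproducibleWithin R ε fun _ => 1 / 3

/-- Some randomized log-space algorithm outputs, with high probability, two identical copies
`(y, y)` of a valid output `y`, on all valid inputs. -/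
def HasTwoCopies (R : SearchProblem) : Prop :=
  ∃ C : Transducer Bool (Option Bool), C.IsLogSpace ∧
    ∃ ε : ℕ → ℝ, Tendsto ε atTop (𝓝 0) ∧
      ∀ x ∈ R.validInputs,
        1 - ε x.length ≤ prob fun r => ∃ y, R x y ∧ C.Outputs x r (encodePair y y)

end RandLogSpace

/-! The three properties are linked in a cycle.

From (1) to (2) (`twoThirds_of_logSpaceReproducible`): an error tending to zero exceeds 1/3 for
finitely many lengths only, and for these the outer error may be set to 1.

From (2) to (3) (`hasTwoCopies_of_twoThirds`): the hint has O(log n) bits and can be kept in memory,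
while the output `y` of `B` cannot. But each bit of `y` can be recomputed: `B` is run n times on
`(x, t)`, and bit `i` is decided by majority. If neither bit value gets more than half of the n
votes, then `y` is taken to have ended. A vote goes wrong with probability at most (17/18)^n
(`ev_trials`, `ev_voteBit`). As `y` has polynomial length, printing it twice costs a vanishing error
(`ev_twoCopies`).

From (3) to (1) (`logSpaceReproducible_of_hasTwoCopies`): `C` is stopped when it prints the comma.
Its configuration at that moment takes O(log n) bits and serves as the hint; `B` resumes `C` from
there and prints what follows. The first copy `w` is fixed at that moment. The probability that `C`
succeeds is the mean, over the configurations at the comma, of the conditional success probability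
(`HaltsWithin.ev_stopped`). So by Markov's inequality (`ev_ind_ge`) this conditional probability is
close to one for most hints, and success after the comma means that `w` is valid and is printed
again (`Halfway.exists_copy`).

Most of the work is to turn these descriptions into Turing machines. Algorithms are written as
structured programs (`Prog`) whose registers are capped by a polynomial in n and whose meaning is a
finite tree of coin tosses. Every such program is realized by a randomized log-space transducer
(`Prog.exists_transducer`): it is compiled to a counter machine, and each counter is kept in binary
on a tape, a polynomially bounded number having O(log n) digits. Conversely a program simulates a
log-space transducer (`Access.ev_loop`): a tape of O(log n) cells is a number in a fixed base, and
the head position is a power of that base. `prob_iter` translates probabilities over infinite coin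
sequences into averages over finite trees. -/

namespace RandLogSpace

/-! ### Coin trees -/

/-- A finite computation that tosses fair coins. -/
inductive Tree (α : Type) where
  | leaf (a : α)
  | node (f : Bool → Tree α)

namespace Tree

variable {α β γ : Type}

def bind : Tree α → (α → Tree β) → Tree β
  | leaf a, k => k a
  | node f, k => node fun b => (f b).bind k

def map (g : α → β) (T : Tree α) : Tree β := T.bind fun a => leaf (g a)

/-- The expectation of a function of the result. -/
noncomputable def ev : Tree α → (α → ℝ) → ℝ
  | leaf a, φ => φ a
  | node f, φ => ((f true).ev φ + (f false).ev φ) / 2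

/-- All possible results satisfy `p`. -/
def All (p : α → Prop) : Tree α → Prop
  | leaf a => p a
  | node f => ∀ b, (f b).All p

@[simp] theorem leaf_bind (a : α) (k : α → Tree β) : (leaf a).bind k = k a := rfl
@[simp] theorem node_bind (f : Bool → Tree α) (k : α → Tree β) :
    (node f).bind k = node fun b => (f b).bind k := rfl
@[simp] theorem map_leaf (g : α → β) (a : α) : (leaf a).map g = leaf (g a) := rfl
@[simp] theorem ev_leaf (a : α) (φ : α → ℝ) : (leaf a).ev φ = φ a := rfl
@[simp] theorem ev_node (f : Bool → Tree α) (φ : α → ℝ) :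
    (node f).ev φ = ((f true).ev φ + (f false).ev φ) / 2 := rfl

theorem bind_assoc (T : Tree α) (k : α → Tree β) (l : β → Tree γ) :
    (T.bind k).bind l = T.bind fun a => (k a).bind l := by
  induction T with
  | leaf a => rfl
  | node f ih => simp only [node_bind, ih]

theorem map_bind (T : Tree α) (g : α → β) (l : β → Tree γ) :
    (T.map g).bind l = T.bind fun a => l (g a) := by
  simp only [map, bind_assoc, leaf_bind]

theorem bind_map (T : Tree α) (k : α → Tree β) (g : β → γ) :
    (T.bind k).map g = T.bind fun a => (k a).map g := by
  simp only [map, bind_assoc]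

theorem map_map (T : Tree α) (g : α → β) (h : β → γ) :
    (T.map g).map h = T.map fun a => h (g a) := by
  simp only [map, bind_assoc, leaf_bind]

theorem ev_bind (T : Tree α) (k : α → Tree β) (φ : β → ℝ) :
    (T.bind k).ev φ = T.ev fun a => (k a).ev φ := by
  induction T with
  | leaf a => rfl
  | node f ih => simp only [node_bind, ev_node, ih]

theorem ev_map (T : Tree α) (g : α → β) (φ : β → ℝ) :
    (T.map g).ev φ = T.ev fun a => φ (g a) := by
  simp only [map, ev_bind, ev_leaf]

theorem All.bind {T : Tree α} {k : α → Tree β} {p : α → Prop} {q : β → Prop}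
    (hT : T.All p) (hk : ∀ a, p a → (k a).All q) : (T.bind k).All q := by
  induction T with
  | leaf a => exact hk a hT
  | node f ih => exact fun b => ih b (hT b)

theorem All.map {T : Tree α} {g : α → β} {p : α → Prop} {q : β → Prop}
    (hT : T.All p) (hk : ∀ a, p a → q (g a)) : (T.map g).All q :=
  hT.bind hk

theorem All.mono {T : Tree α} {p q : α → Prop} (hT : T.All p) (h : ∀ a, p a → q a) :
    T.All q := by
  induction T with
  | leaf a => exact h a hT
  | node f ih => exact fun b => ih b (hT b)

theorem ev_mono_of_all {T : Tree α} {p : α → Prop} (hT : T.All p) {φ ψ : α → ℝ}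
    (h : ∀ a, p a → φ a ≤ ψ a) : T.ev φ ≤ T.ev ψ := by
  induction T with
  | leaf a => exact h a hT
  | node f ih =>
    have h1 := ih true (hT true)
    have h2 := ih false (hT false)
    simp only [ev_node]
    linarith

theorem all_true (T : Tree α) : T.All fun _ => True := by
  induction T with
  | leaf a => trivial
  | node f ih => exact ih

theorem ev_mono (T : Tree α) {φ ψ : α → ℝ} (h : ∀ a, φ a ≤ ψ a) : T.ev φ ≤ T.ev ψ :=
  ev_mono_of_all T.all_true fun a _ => h a

theorem ev_add (T : Tree α) (φ ψ : α → ℝ) :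
    (T.ev fun a => φ a + ψ a) = T.ev φ + T.ev ψ := by
  induction T with
  | leaf a => rfl
  | node f ih => simp only [ev_node, ih]; ring

theorem ev_const_mul (T : Tree α) (c : ℝ) (φ : α → ℝ) :
    (T.ev fun a => c * φ a) = c * T.ev φ := by
  induction T with
  | leaf a => rfl
  | node f ih => simp only [ev_node, ih]; ring

@[simp] theorem ev_const (T : Tree α) (c : ℝ) : (T.ev fun _ => c) = c := by
  induction T with
  | leaf a => rfl
  | node f ih => simp only [ev_node, ih]; ring

end Tree

open Classical in
/-- The indicator of a proposition. -/
noncomputable def ind (p : Prop) : ℝ := if p then 1 else 0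

theorem ind_true {p : Prop} (h : p) : ind p = 1 := if_pos h
theorem ind_false {p : Prop} (h : ¬p) : ind p = 0 := if_neg h
theorem ind_nonneg (p : Prop) : 0 ≤ ind p := by unfold ind; split_ifs <;> norm_num
theorem ind_le_one (p : Prop) : ind p ≤ 1 := by unfold ind; split_ifs <;> norm_num
theorem ind_mono {p q : Prop} (h : p → q) : ind p ≤ ind q := by
  by_cases hp : p
  · rw [ind_true hp, ind_true (h hp)]
  · rw [ind_false hp]; exact ind_nonneg q

/-! ### Iterating a probabilistic step -/

section Iterate

variable {C : Type}

/-- `t` steps, with the coin tosses `r 0, r 1, …`. -/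
def iter (step : C → Bool → C) (r : ℕ → Bool) : ℕ → C → C
  | 0, c => c
  | t + 1, c => step (iter step r t c) (r t)

/-- The tree of all computations of `t` steps. -/
def iterTree (step : C → Bool → C) : ℕ → C → Tree C
  | 0, c => Tree.leaf c
  | t + 1, c => Tree.node fun b => iterTree step t (step c b)

/-- `iter` splits off the last toss and `iterTree` the first one; this shift reconciles the two
recursions. -/
theorem iter_succ (step : C → Bool → C) (r : ℕ → Bool) (t : ℕ) (c : C) :
    iter step r (t + 1) c = iter step (fun i => r (i + 1)) t (step c (r 0)) := by
  induction t with
  | zero => rfl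
  | succ t ih => rw [iter, ih]; rfl

theorem iter_congr (step : C → Bool → C) {r r' : ℕ → Bool} {t : ℕ} (c : C)
    (h : ∀ i < t, r i = r' i) : iter step r t c = iter step r' t c := by
  induction t with
  | zero => rfl
  | succ t ih =>
    rw [iter, iter, ih fun i hi => h i (by omega), h t (by omega)]

theorem iterTree_all (step : C → Bool → C) (p : C → Prop) (t : ℕ) (c : C)
    (h : ∀ r, p (iter step r t c)) : (iterTree step t c).All p := by
  induction t generalizing c with
  | zero => exact h fun _ => true
  | succ t ih =>
    intro b
    refine ih _ fun r => ?_
    have := h fun i => Nat.casesOn i b r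
    rwa [iter_succ] at this

/-- Prepend a coin toss. -/
def consCoin (b : Bool) (r : ℕ → Bool) : ℕ → Bool
  | 0 => b
  | i + 1 => r i

theorem measurable_consCoin (b : Bool) : Measurable (consCoin b) := by
  refine measurable_pi_lambda _ fun i => ?_
  cases i with
  | zero => exact measurable_const
  | succ i => exact measurable_pi_apply i

instance : IsProbabilityMeasure coins := by unfold coins; infer_instance

theorem preimage_consCoin_pi (b : Bool) (N : ℕ) (t : ℕ → Set Bool) :
    consCoin b ⁻¹' Set.pi (Finset.range (N + 1) : Set ℕ) t =
      {_r | b ∈ t 0} ∩ Set.pi (Finset.range N : Set ℕ) fun i => t (i + 1) := by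
  ext r
  simp only [Set.mem_preimage, Set.mem_pi, Finset.coe_range, Set.mem_Iio, Set.mem_inter_iff,
    Set.mem_ofPred_eq]
  constructor
  · exact fun h => ⟨h 0 (by omega), fun i hi => h (i + 1) (by omega)⟩
  · rintro ⟨h0, h⟩ i hi
    cases i with
    | zero => exact h0
    | succ i => exact h i (by omega)

open Classical in
theorem map_consCoin_pi (b : Bool) (N : ℕ) (t : ℕ → Set Bool) :
    coins.map (consCoin b) (Set.pi (Finset.range (N + 1) : Set ℕ) t) =
      (if b ∈ t 0 then 1 else 0) *
        ∏ i ∈ Finset.range N, (PMF.uniformOfFintype Bool).toMeasure (t (i + 1)) := by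
  rw [Measure.map_apply (measurable_consCoin b)
    (MeasurableSet.pi (Finset.countable_toSet _) fun i _ => MeasurableSet.of_discrete),
    preimage_consCoin_pi]
  by_cases hb : b ∈ t 0
  · simp only [hb, Set.ofPred_true, Set.univ_inter, if_true, one_mul]
    unfold coins
    exact Measure.infinitePi_pi (fun _ : ℕ => (PMF.uniformOfFintype Bool).toMeasure)
      fun i _ => MeasurableSet.of_discrete
  · simp [hb]

open Classical in
theorem uniform_bool_apply (t : Set Bool) :
    (PMF.uniformOfFintype Bool).toMeasure t =
      2⁻¹ * ((if true ∈ t then 1 else 0) + (if false ∈ t then 1 else 0)) := by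
  rw [PMF.toMeasure_apply_fintype]
  simp [Set.indicator, mul_add]

/-- The first toss is fair and independent of the other ones. -/
theorem coins_eq :
    coins = (2⁻¹ : ENNReal) • (coins.map (consCoin true) + coins.map (consCoin false)) := by
  classical
  symm
  refine Measure.eq_infinitePi (fun _ : ℕ => (PMF.uniformOfFintype Bool).toMeasure) ?_
  intro s t _
  obtain ⟨N, hN⟩ : ∃ N, s ⊆ Finset.range (N + 1) :=
    ⟨s.sup id, fun i hi => Finset.mem_range.2 (Nat.lt_succ_of_le (Finset.le_sup (f := id) hi))⟩
  -- Padding with `Set.univ` turns an arbitrary finite set of coordinates into an initial segment,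
  -- from which coordinate 0 can be split off.
  set u : ℕ → Set Bool := fun i => if i ∈ s then t i else Set.univ with hu
  have hpi : Set.pi (s : Set ℕ) t = Set.pi (Finset.range (N + 1) : Set ℕ) u := by
    ext r
    simp only [Set.mem_pi, Finset.mem_coe, hu]
    constructor
    · intro h i _
      split_ifs with his
      · exact h i his
      · trivial
    · intro h i hi
      have := h i (hN hi)
      rwa [if_pos hi] at this
  have hprod : ∏ i ∈ s, (PMF.uniformOfFintype Bool).toMeasure (t i) =
      ∏ i ∈ Finset.range (N + 1), (PMF.uniformOfFintype Bool).toMeasure (u i) := by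
    rw [← Finset.prod_subset hN]
    · refine Finset.prod_congr rfl fun i hi => ?_
      simp only [hu, if_pos hi]
    · intro i _ hi
      simp only [hu, if_neg hi]
      exact measure_univ
  rw [hprod, hpi, Measure.smul_apply, Measure.add_apply, map_consCoin_pi, map_consCoin_pi,
    Finset.prod_range_succ', uniform_bool_apply (u 0), ← add_mul, smul_eq_mul]
  ring

/-- Conditioning on the first toss. -/
theorem prob_eq_average {E : (ℕ → Bool) → Prop} (hE : MeasurableSet {r | E r}) :
    prob E = (prob (fun r => E (consCoin true r)) + prob fun r => E (consCoin false r)) / 2 := by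
  have h : ∀ b, coins.map (consCoin b) {r | E r} = coins {r | E (consCoin b r)} := fun b =>
    Measure.map_apply (measurable_consCoin b) hE
  unfold prob Measure.real
  conv_lhs => rw [coins_eq]
  rw [Measure.smul_apply, Measure.add_apply, h, h, smul_eq_mul, ENNReal.toReal_mul,
    ENNReal.toReal_add (measure_ne_top _ _) (measure_ne_top _ _)]
  simp
  ring

/-- Such an event is the preimage of a subset of the finite discrete space `Fin t → Bool` under a
restriction map. -/
theorem measurableSet_of_finite_dependence {E : (ℕ → Bool) → Prop} (t : ℕ)
    (h : ∀ r r', (∀ i < t, r i = r' i) → (E r ↔ E r')) : MeasurableSet {r | E r} := by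
  have : {r | E r} = (fun (r : ℕ → Bool) (i : Fin t) => r i) ⁻¹'
      {a | E fun i => if hi : i < t then a ⟨i, hi⟩ else false} := by
    ext r
    refine h _ _ fun i hi => ?_
    simp [hi]
  rw [this]
  exact (measurable_pi_lambda _ fun i => measurable_pi_apply _) MeasurableSet.of_discrete

theorem prob_const (p : Prop) : prob (fun _ => p) = ind p := by
  unfold prob
  by_cases hp : p
  · simp [hp, ind_true]
  · simp [hp, ind_false]

/-- The passage from measures to finite averages; the analysis of programs takes place entirely on
the side of trees. -/
theorem prob_iter (step : C → Bool → C) (p : C → Prop) (t : ℕ) (c : C) :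
    prob (fun r => p (iter step r t c)) = (iterTree step t c).ev fun c' => ind (p c') := by
  induction t generalizing c with
  | zero => exact prob_const (p c)
  | succ t ih =>
    rw [prob_eq_average]
    · simp only [iter_succ, iterTree, Tree.ev_node, ← ih]
      rfl
    · refine measurableSet_of_finite_dependence (t + 1) fun r r' h => ?_
      rw [iter_congr step c h]

end Iterate

/-! ### Output probabilities of transducers as tree averages -/

namespace Transducer

variable {I O : Type} (M : Transducer I O)

theorem run_eq_iter (x : List I) (r : ℕ → Bool) (t : ℕ) :
    M.run x r t = iter (fun c b => M.step x b c) r t M.init := by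
  induction t with
  | zero => rfl
  | succ t ih => rw [run, iter, ih]

theorem step_of_halt (x : List I) (b : Bool) (c : M.Config) (h : M.halt c.state) :
    M.step x b c = c := by
  rw [step, if_pos h]

theorem run_eq_of_halt (x : List I) (r : ℕ → Bool) {t t' : ℕ} (htt : t ≤ t')
    (h : M.halt (M.run x r t).state) : M.run x r t' = M.run x r t := by
  induction t', htt using Nat.le_induction with
  | base => rfl
  | succ t' _ ih => rw [run, ih, M.step_of_halt x _ _ h]

/-- A halted configuration is frozen, so any two halting times show the same output. -/
theorem outputs_iff (x : List I) (r : ℕ → Bool) {T : ℕ} (hT : M.halt (M.run x r T).state)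
    (w : List O) : M.Outputs x r w ↔ (M.run x r T).output = w := by
  constructor
  · rintro ⟨t, ht, rfl⟩
    rcases le_total t T with h | h
    · rw [M.run_eq_of_halt x r h ht]
    · rw [M.run_eq_of_halt x r h hT]
  · exact fun h => ⟨T, hT, h⟩

theorem prob_outputs (x : List I) {T : ℕ} (hT : ∀ r, M.halt (M.run x r T).state)
    (P : List O → Prop) :
    prob (fun r => ∃ w, M.Outputs x r w ∧ P w) =
      (iterTree (fun c b => M.step x b c) T M.init).ev fun c => ind (P c.output) := by
  rw [← prob_iter _ (fun c : M.Config => P c.output)]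
  congr 1
  funext r
  rw [← run_eq_iter]
  simp only [M.outputs_iff x r (hT r), exists_eq_left']

end Transducer


/-! ### Runs of a probabilistic step function up to a stopping time -/

/-- `Reaches step P c t T`: from `c`, within `t` steps, the iteration of `step` arrives at the
configurations at the leaves of `T`, with one coin toss for each node of `T` on the way; all
configurations before satisfy `P`. -/
inductive Reaches {C : Type} (step : C → Bool → C) (P : C → Prop) : C → ℕ → Tree C → Prop
  | done (c : C) (t : ℕ) : Reaches step P c t (Tree.leaf c)
  | det {c : C} {t : ℕ} {T : Tree C} : P c → (∀ b, Reaches step P (step c b) t T) →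
      Reaches step P c (t + 1) T
  | toss {c : C} {t : ℕ} {T : Bool → Tree C} : P c →
      (∀ b, Reaches step P (step c b) t (T b)) → Reaches step P c (t + 1) (Tree.node T)

namespace Reaches

variable {C : Type} {step : C → Bool → C} {P : C → Prop}

theorem mono {c : C} {t t' : ℕ} {T : Tree C} (h : Reaches step P c t T) (htt : t ≤ t') :
    Reaches step P c t' T := by
  induction h generalizing t' with
  | done c t => exact done c t'
  | det hP _ ih =>
    obtain ⟨t', rfl⟩ : ∃ u, t' = u + 1 := ⟨t' - 1, by omega⟩
    exact det hP fun b => ih b (by omega)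
  | toss hP _ ih =>
    obtain ⟨t', rfl⟩ : ∃ u, t' = u + 1 := ⟨t' - 1, by omega⟩
    exact toss hP fun b => ih b (by omega)

theorem bind {c : C} {t t' : ℕ} {T : Tree C} {k : C → Tree C} (h : Reaches step P c t T)
    (hk : T.All fun c' => Reaches step P c' t' (k c')) :
    Reaches step P c (t + t') (T.bind k) := by
  induction h with
  | done c t => exact (show Reaches step P c t' (k c) from hk).mono (by omega)
  | det hP _ ih =>
    rw [Nat.add_right_comm]
    exact det hP fun b => ih b hk
  | toss hP _ ih =>
    rw [Nat.add_right_comm]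
    exact toss hP fun b => ih b (hk b)

theorem trans {c c' : C} {t t' : ℕ} {T : Tree C} (h : Reaches step P c t (Tree.leaf c'))
    (h' : Reaches step P c' t' T) : Reaches step P c (t + t') T :=
  h.bind (k := fun _ => T) h'

theorem lift {D : Type} {stepD : D → Bool → D} {PD : D → Prop} (g : C → D)
    (hP : ∀ c, P c → PD (g c)) (hstep : ∀ c b, P c → stepD (g c) b = g (step c b))
    {c : C} {t : ℕ} {T : Tree C} (h : Reaches step P c t T) :
    Reaches stepD PD (g c) t (T.map g) := by
  induction h with
  | done c t => exact done _ _
  | det hPc _ ih =>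
    exact det (hP _ hPc) fun b => by rw [hstep _ _ hPc]; exact ih b
  | toss hPc _ ih =>
    exact toss (hP _ hPc) fun b => by rw [hstep _ _ hPc]; exact ih b

/-- The leaves are fixed points, so using up the remaining time changes nothing. Tosses that are
ignored in a `det` step average out. -/
theorem ev_iterTree {c : C} {t : ℕ} {T : Tree C} (h : Reaches step P c t T)
    (hT : T.All fun c => ∀ b, step c b = c) (φ : C → ℝ) :
    (iterTree step t c).ev φ = T.ev φ := by
  induction h with
  | done c t =>
    induction t with
    | zero => rfl
    | succ t ih => simp only [iterTree, Tree.ev_node, hT _, ih]; simp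
  | det _ _ ih => simp only [iterTree, Tree.ev_node, ih _ hT]; ring
  | toss _ _ ih => simp only [iterTree, Tree.ev_node, ih _ (hT _)]

theorem iter_of_all {c : C} {t : ℕ} {T : Tree C} (h : Reaches step P c t T) {p : C → Prop}
    (hT : T.All fun c => p c ∧ ∀ b, step c b = c) (r : ℕ → Bool) {t' : ℕ} (htt : t ≤ t') :
    p (iter step r t' c) := by
  induction h generalizing r t' with
  | done c t =>
    have : iter step r t' c = c := by
      clear htt
      induction t' with
      | zero => rfl
      | succ t' ih => rw [iter, ih, hT.2]
    rw [this]
    exact hT.1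
  | det _ _ ih =>
    obtain ⟨t', rfl⟩ : ∃ u, t' = u + 1 := ⟨t' - 1, by omega⟩
    rw [iter_succ]
    exact ih _ hT _ (by omega)
  | toss _ _ ih =>
    obtain ⟨t', rfl⟩ : ∃ u, t' = u + 1 := ⟨t' - 1, by omega⟩
    rw [iter_succ]
    exact ih _ (hT _) _ (by omega)

/-- This yields space bounds: the property holds on the way by definition of `Reaches`, and
afterwards because the run stays at a leaf. -/
theorem invariant {c : C} {t : ℕ} {T : Tree C} (h : Reaches step P c t T)
    (hT : T.All fun c => P c ∧ ∀ b, step c b = c) (r : ℕ → Bool) (t' : ℕ) :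
    P (iter step r t' c) := by
  induction h generalizing r t' with
  | done c t => exact (done (P := P) (step := step) c 0).iter_of_all hT r (Nat.zero_le _)
  | det hP _ ih =>
    cases t' with
    | zero => exact hP
    | succ t' => rw [iter_succ]; exact ih _ hT _ _
  | toss hP _ ih =>
    cases t' with
    | zero => exact hP
    | succ t' => rw [iter_succ]; exact ih _ (hT _) _ _

end Reaches

/-! ### Counter machines -/

/-- Registers holding natural numbers, the position of the input head, and the output. -/
@[ext]
structure Store (ι O : Type) where
  reg : ι → ℕ
  pos : ℕ
  out : List O

/-- The effect of one step of a counter machine: `op = some (i, true)` increments register `i`,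
and `op = some (i, false)` decrements it. -/
structure CounterAction (Q ι O : Type) where
  next : Q
  op : Option (ι × Bool)
  moveI : Move
  emit : Option O

def CounterAction.mapNext {Q Q' ι O : Type} (g : Q → Q') (a : CounterAction Q ι O) :
    CounterAction Q' ι O :=
  ⟨g a.next, a.op, a.moveI, a.emit⟩

/-- A program fragment of a counter machine. The transition depends on the input symbol, on which
registers are zero, and on a coin toss; the next state `none` is the exit. -/
structure Frag (ι I O : Type) where
  St : Type
  finiteSt : Finite St
  entry : St
  δ : St → InSym I → (ι → Bool) → Bool → CounterAction (Option St) ι O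

section Store

variable {ι I O : Type} [DecidableEq ι]

def applyOp (r : ι → ℕ) : Option (ι × Bool) → ι → ℕ
  | none => r
  | some (i, true) => Function.update r i (r i + 1)
  | some (i, false) => Function.update r i (r i - 1)

def Store.apply (x : List I) {Q : Type} (s : Store ι O) (a : CounterAction Q ι O) : Store ι O :=
  ⟨applyOp s.reg a.op, moveInput x.length s.pos a.moveI, s.out ++ a.emit.toList⟩

def Store.zeros (s : Store ι O) (i : ι) : Bool := s.reg i == 0

def Store.set (s : Store ι O) (i : ι) (v : ℕ) : Store ι O :=
  ⟨Function.update s.reg i v, s.pos, s.out⟩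

end Store

namespace Frag

variable {ι I O : Type} [DecidableEq ι]

def step (F : Frag ι I O) (x : List I) : Option F.St × Store ι O → Bool →
    Option F.St × Store ι O
  | (none, s), _ => (none, s)
  | (some q, s), b =>
    let a := F.δ q (inputSymbol x s.pos) s.zeros b
    (a.next, s.apply x a)

/-- Started on the store `s`, the fragment exits within `t` steps, with the stores in `T`. -/
def Runs (F : Frag ι I O) (x : List I) (s : Store ι O) (t : ℕ) (T : Tree (Store ι O)) : Prop :=
  Reaches (F.step x) (fun c => c.1 ≠ none) (some F.entry, s) t (T.map fun s' => (none, s'))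

theorem Runs.mono {F : Frag ι I O} {x : List I} {s : Store ι O} {t t' : ℕ}
    {T : Tree (Store ι O)} (h : F.Runs x s t T) (htt : t ≤ t') : F.Runs x s t' T :=
  Reaches.mono h htt

/-- Embedding a fragment into another one. -/
theorem reaches_embed {F G : Frag ι I O} (x : List I) (g : Option F.St → Option G.St)
    (hg : ∀ q, ∃ q', g (some q) = some q' ∧
      ∀ i z b, G.δ q' i z b = (F.δ q i z b).mapNext g)
    {c : Option F.St × Store ι O} {t : ℕ} {T : Tree (Option F.St × Store ι O)}
    (h : Reaches (F.step x) (fun c => c.1 ≠ none) c t T) :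
    Reaches (G.step x) (fun c => c.1 ≠ none) (g c.1, c.2) t
      (T.map fun c => (g c.1, c.2)) := by
  refine h.lift (fun c => (g c.1, c.2)) ?_ ?_
  · rintro ⟨_ | q, s⟩ hc
    · exact absurd rfl hc
    · obtain ⟨q', hq, _⟩ := hg q
      simp [hq]
  · rintro ⟨_ | q, s⟩ b hc
    · exact absurd rfl hc
    · obtain ⟨q', hq, hδ⟩ := hg q
      simp only [hq, step, hδ]
      rfl

/-- A single step. -/
def atom (op : Option (ι × Bool)) (m : Move) (o : Option O) : Frag ι I O where
  St := Unit
  finiteSt := inferInstance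
  entry := ()
  δ _ _ _ _ := ⟨none, op, m, o⟩

theorem runs_atom (x : List I) (op : Option (ι × Bool)) (m : Move) (o : Option O)
    (s : Store ι O) :
    (atom op m o : Frag ι I O).Runs x s 1
      (Tree.leaf ⟨applyOp s.reg op, moveInput x.length s.pos m, s.out ++ o.toList⟩) :=
  Reaches.det (by simp) fun _ => Reaches.done _ _

/-- One fragment after the other. -/
def seq (F G : Frag ι I O) : Frag ι I O where
  St := F.St ⊕ G.St
  finiteSt := by have := F.finiteSt; have := G.finiteSt; infer_instance
  entry := Sum.inl F.entry
  δ q i z b :=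
    match q with
    | Sum.inl q => (F.δ q i z b).mapNext fun q' =>
        match q' with
        | some q' => some (Sum.inl q')
        | none => some (Sum.inr G.entry)
    | Sum.inr q => (G.δ q i z b).mapNext (Option.map Sum.inr)

theorem runs_seq {F G : Frag ι I O} {x : List I} {s : Store ι O} {t t' : ℕ}
    {T : Tree (Store ι O)} {k : Store ι O → Tree (Store ι O)} (hF : F.Runs x s t T)
    (hG : T.All fun s' => G.Runs x s' t' (k s')) :
    (F.seq G).Runs x s (t + t') (T.bind k) := by
  have h1 := reaches_embed (G := F.seq G) x
    (fun q' => match q' with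
        | some q' => some (Sum.inl q')
        | none => some (Sum.inr G.entry)) (fun q => ⟨Sum.inl q, rfl, fun i z b => rfl⟩) hF
  unfold Runs
  rw [Tree.map_map] at h1
  have h2 := h1.bind (t' := t')
    (k := fun c => (k c.2).map fun s' => ((none : Option (F.seq G).St), s')) ?_
  · rw [Tree.map_bind] at h2
    rw [Tree.bind_map]
    exact h2
  · refine hG.map fun s' hs' => ?_
    have h3 := reaches_embed (G := F.seq G) x (Option.map Sum.inr)
      (fun q => ⟨Sum.inr q, rfl, fun i z b => rfl⟩) hs'
    rw [Tree.map_map] at h3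
    exact h3

/-- Select a fragment according to what is seen. -/
def branch {α : Type} [Finite α] (sel : InSym I → (ι → Bool) → Bool → α)
    (F : α → Frag ι I O) : Frag ι I O where
  St := Option (Σ a, (F a).St)
  finiteSt := by have := fun a => (F a).finiteSt; infer_instance
  entry := none
  δ q i z b :=
    match q with
    | none => ⟨some (some ⟨sel i z b, (F (sel i z b)).entry⟩), none, Move.stay, none⟩
    | some ⟨a, q⟩ => ((F a).δ q i z b).mapNext (Option.map fun q' => some ⟨a, q'⟩)

theorem reaches_branch {α : Type} [Finite α] (sel : InSym I → (ι → Bool) → Bool → α)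
    (F : α → Frag ι I O) {x : List I} {s : Store ι O} {t : ℕ} {T : Tree (Store ι O)} {a : α}
    (h : (F a).Runs x s t T) :
    Reaches ((branch sel F).step x) (fun c => c.1 ≠ none) (some (some ⟨a, (F a).entry⟩), s) t
      (T.map fun s' => (none, s')) := by
  have h3 := reaches_embed (G := branch sel F) x (Option.map fun q' => some ⟨a, q'⟩)
    (fun q => ⟨some ⟨a, q⟩, rfl, fun i z b => rfl⟩) h
  rw [Tree.map_map] at h3
  exact h3

theorem step_branch {α : Type} [Finite α] (sel : InSym I → (ι → Bool) → Bool → α)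
    (F : α → Frag ι I O) (x : List I) (s : Store ι O) (b : Bool) :
    (branch sel F).step x (some (branch sel F).entry, s) b =
      (some (some ⟨sel (inputSymbol x s.pos) s.zeros b,
        (F (sel (inputSymbol x s.pos) s.zeros b)).entry⟩), s) := by
  simp only [step, branch, Store.apply, applyOp, moveInput, Option.toList, List.append_nil]

theorem runs_branch {α : Type} [Finite α] {sel : InSym I → (ι → Bool) → Bool → α}
    {F : α → Frag ι I O} {x : List I} {s : Store ι O} {t : ℕ} {T : Tree (Store ι O)} {a : α}
    (ha : ∀ b, sel (inputSymbol x s.pos) s.zeros b = a) (h : (F a).Runs x s t T) :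
    (branch sel F).Runs x s (t + 1) T :=
  Reaches.det (by simp) fun b => by
    rw [step_branch, ha]
    exact reaches_branch sel F h

/-- A selector that looks at the toss is the only source of randomness among the constructions of
fragments: `atom` and the test of `loopWhile` ignore it. -/
theorem runs_branch_toss {α : Type} [Finite α] {sel : InSym I → (ι → Bool) → Bool → α}
    {F : α → Frag ι I O} {x : List I} {s : Store ι O} {t : ℕ} {T : Bool → Tree (Store ι O)}
    (h : ∀ b, (F (sel (inputSymbol x s.pos) s.zeros b)).Runs x s t (T b)) :
    (branch sel F).Runs x s (t + 1) (Tree.node T) :=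
  Reaches.toss (by simp) fun b => by
    rw [step_branch]
    exact reaches_branch sel F (h b)

/-- Repeat while a test succeeds. -/
def loopWhile (test : InSym I → (ι → Bool) → Bool) (F : Frag ι I O) : Frag ι I O where
  St := Option F.St
  finiteSt := by have := F.finiteSt; infer_instance
  entry := none
  δ q i z b :=
    match q with
    | none => ⟨if test i z then some (some F.entry) else none, none, Move.stay, none⟩
    | some q => (F.δ q i z b).mapNext some

theorem step_loopWhile (test : InSym I → (ι → Bool) → Bool) (F : Frag ι I O) (x : List I)
    (s : Store ι O) (b : Bool) :
    (loopWhile test F).step x (some (loopWhile test F).entry, s) b =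
      (if test (inputSymbol x s.pos) s.zeros then some (some F.entry) else none, s) := by
  simp only [step, loopWhile, Store.apply, applyOp, moveInput, Option.toList, List.append_nil]

theorem runs_loopWhile_false {test : InSym I → (ι → Bool) → Bool} {F : Frag ι I O} {x : List I}
    {s : Store ι O} (h : test (inputSymbol x s.pos) s.zeros = false) :
    (loopWhile test F).Runs x s 1 (Tree.leaf s) :=
  Reaches.det (by simp) fun b => by
    rw [step_loopWhile, h]
    exact Reaches.done _ _

theorem runs_loopWhile_true {test : InSym I → (ι → Bool) → Bool} {F : Frag ι I O} {x : List I}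
    {s : Store ι O} {t t' : ℕ} {T : Tree (Store ι O)} {k : Store ι O → Tree (Store ι O)}
    (h : test (inputSymbol x s.pos) s.zeros = true) (hF : F.Runs x s t T)
    (hk : T.All fun s' => (loopWhile test F).Runs x s' t' (k s')) :
    (loopWhile test F).Runs x s (t + t' + 1) (T.bind k) := by
  refine Reaches.det (by simp) fun b => ?_
  rw [step_loopWhile, h, if_pos rfl]
  have h1 := reaches_embed (G := loopWhile test F) x some
    (fun q => ⟨some q, rfl, fun i z b => rfl⟩) hF
  rw [Tree.map_map] at h1
  have h2 := h1.bind (t' := t')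
    (k := fun c => (k c.2).map fun s' => ((none : Option (loopWhile test F).St), s')) ?_
  · rw [Tree.map_bind] at h2
    rw [Tree.bind_map]
    exact h2
  · exact hk.map fun s' hs' => hs'

end Frag

/-! ### Polynomial bounds -/

/-- All polynomial bounds are normalized to powers of `n + 2`. The base is at least 2 even for `n =
0`, so constants are absorbed through `a ≤ 2 ^ a ≤ (n + 2) ^ a`. -/
theorem exists_eval_le_pow (p : Polynomial ℕ) : ∃ d, ∀ n, p.eval n ≤ (n + 2) ^ d := by
  induction p using Polynomial.induction_on' with
  | add p q hp hq =>
    obtain ⟨d, hd⟩ := hp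
    obtain ⟨e, he⟩ := hq
    refine ⟨max d e + 1, fun n => ?_⟩
    rw [Polynomial.eval_add, pow_succ]
    have h1 : (n + 2) ^ d ≤ (n + 2) ^ max d e := Nat.pow_le_pow_right (by omega) (le_max_left _ _)
    have h2 : (n + 2) ^ e ≤ (n + 2) ^ max d e := Nat.pow_le_pow_right (by omega) (le_max_right _ _)
    nlinarith [hd n, he n, Nat.zero_le (n * (n + 2) ^ max d e)]
  | monomial k a =>
    refine ⟨a + k, fun n => ?_⟩
    rw [Polynomial.eval_monomial, pow_add]
    gcongr
    · exact Nat.lt_two_pow_self.le.trans (Nat.pow_le_pow_left (by omega) a)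
    · omega

theorem pow_le_two_pow_log (n d : ℕ) : (n + 2) ^ d ≤ 2 ^ (d * (Nat.log 2 n + 2)) := by
  have h : n + 2 ≤ 2 ^ (Nat.log 2 n + 2) := by
    have := Nat.lt_pow_succ_log_self (b := 2) (by norm_num) n
    have h2 : 1 ≤ 2 ^ Nat.log 2 n := Nat.one_le_two_pow
    rw [Nat.succ_eq_add_one, pow_succ] at this
    rw [pow_add]
    omega
  rw [mul_comm, pow_mul]
  exact Nat.pow_le_pow_left h d

/-- The reason why polynomially bounded counters need only logarithmic space. -/
theorem size_le_of_le_pow {m n d : ℕ} (h : m ≤ (n + 2) ^ d) :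
    m.size < (2 * d + 2) * (Nat.log 2 n + 1) := by
  have : m.size ≤ d * (Nat.log 2 n + 2) + 1 := by
    rw [Nat.size_le, pow_succ]
    have := pow_le_two_pow_log n d
    have h2 : 1 ≤ 2 ^ (d * (Nat.log 2 n + 2)) := Nat.one_le_two_pow
    omega
  refine this.trans_lt ?_
  ring_nf
  omega

/-! ### Simulating counter machines by transducers -/

namespace BinaryCounter

/-- What the head is doing on the tape of a counter: looking for the end of the carry, looking
for the end of the borrow, checking whether the leading digit has to be erased, writing that
digit, and returning to cell `0`. -/
inductive Phase where
  | carry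
  | borrow
  | peek
  | fix (erase : Bool)
  | ret

inductive State (Q ι : Type) where
  | boot
  | rest (q : Option Q)
  | work (q : Option Q) (i : ι) (ph : Phase)

def State.after {Q ι : Type} (q : Option Q) (i : ι) : Option Phase → State Q ι
  | none => State.rest q
  | some ph => State.work q i ph

instance : Finite Phase := by
  refine Finite.of_surjective (α := Option (Option (Option (Option Bool))))
    (fun u => match u with
      | none => Phase.carry
      | some none => Phase.borrow
      | some (some none) => Phase.peek
      | some (some (some none)) => Phase.ret
      | some (some (some (some b))) => Phase.fix b) ?_
  rintro (_ | _ | _ | b | _)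
  exacts [⟨none, rfl⟩, ⟨some none, rfl⟩, ⟨some (some none), rfl⟩,
    ⟨some (some (some (some b))), rfl⟩, ⟨some (some (some none)), rfl⟩]

instance {Q ι : Type} [Finite Q] [Finite ι] : Finite (State Q ι) := by
  refine Finite.of_surjective (α := Option (Option Q ⊕ Option Q × ι × Phase))
    (fun u => match u with
      | none => State.boot
      | some (Sum.inl q) => State.rest q
      | some (Sum.inr (q, i, ph)) => State.work q i ph) ?_
  rintro (_ | q | ⟨q, i, ph⟩)
  exacts [⟨none, rfl⟩, ⟨some (Sum.inl q), rfl⟩, ⟨some (Sum.inr (q, i, ph)), rfl⟩]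

/-- The next phase (`none` at the end), the digit to write and the movement. -/
def phaseStep (mark : Bool) (d : Option Bool) : Phase → Option Phase × Option Bool × Move
  | Phase.carry =>
    if d = some true then (some Phase.carry, some false, Move.right)
    else (some Phase.ret, some true, Move.stay)
  | Phase.borrow =>
    match d with
    | some true => (some Phase.peek, some true, Move.right)
    | some false => (some Phase.borrow, some true, Move.right)
    | none => (some Phase.ret, none, Move.stay)
  | Phase.peek => (some (Phase.fix d.isNone), d, Move.left)
  | Phase.fix erase => (some Phase.ret, if erase then none else some false, Move.stay)
  | Phase.ret => if mark then (none, d, Move.stay) else (some Phase.ret, d, Move.left)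

/-- The tape that holds the digits `L`; cell `0` is marked. -/
def listTape (L : List Bool) (j : ℕ) : Bool × Option Bool := (j == 0, L[j]?)

theorem update_listTape_append (P l : List Bool) (a b : Bool) :
    Function.update (listTape (P ++ a :: l)) P.length (P.length == 0, some b) =
      listTape (P ++ b :: l) := by
  funext j
  by_cases hj : j = P.length
  · subst hj
    simp [listTape]
  · rw [Function.update_of_ne hj]
    simp only [listTape, Prod.mk.injEq, true_and]
    rcases lt_or_gt_of_ne hj with h | h
    · rw [List.getElem?_append_left h, List.getElem?_append_left h]
    · rw [List.getElem?_append_right h.le, List.getElem?_append_right h.le]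
      obtain ⟨u, hu⟩ : ∃ u, j - P.length = u + 1 := ⟨j - P.length - 1, by omega⟩
      simp [hu]

theorem update_listTape_end (P : List Bool) (b : Bool) :
    Function.update (listTape P) P.length (P.length == 0, some b) = listTape (P ++ [b]) := by
  funext j
  by_cases hj : j = P.length
  · subst hj
    simp [listTape]
  · rw [Function.update_of_ne hj]
    simp only [listTape, Prod.mk.injEq, true_and]
    rcases lt_or_gt_of_ne hj with h | h
    · rw [List.getElem?_append_left h]
    · rw [List.getElem?_eq_none (by omega), List.getElem?_eq_none (by simp; omega)]

theorem update_listTape_erase (P : List Bool) (a : Bool) :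
    Function.update (listTape (P ++ [a])) P.length (P.length == 0, none) = listTape P := by
  rw [← update_listTape_end, Function.update_idem]
  funext j
  by_cases hj : j = P.length
  · subst hj
    simp [listTape]
  · rw [Function.update_of_ne hj]

theorem update_listTape_self (L : List Bool) (j : ℕ) :
    Function.update (listTape L) j (j == 0, L[j]?) = listTape L :=
  Function.update_eq_self j (listTape L)

/-- Adding one to a binary number with the least significant digit first. -/
def incList : List Bool → List Bool
  | [] => [true]
  | false :: l => true :: l
  | true :: l => false :: incList l

/-- Subtracting one. -/
def decList : List Bool → List Bool
  | [] => []
  | [true] => []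
  | true :: a :: l => false :: a :: l
  | false :: l => true :: decList l

theorem bits_succ (n : ℕ) : (n + 1).bits = incList n.bits := by
  induction n using Nat.binaryRec' with
  | zero => simp [incList]
  | bit b n h ih =>
    cases b with
    | false =>
      have hn : n ≠ 0 := fun h0 => by simpa using h h0
      rw [Nat.bit_false_apply, Nat.bit0_bits n hn, Nat.bit1_bits]
      rfl
    | true =>
      have : Nat.bit true n + 1 = 2 * (n + 1) := by simp [Nat.bit]; ring
      rw [this, Nat.bit0_bits _ (by omega), ih, Nat.bit_true_apply, Nat.bit1_bits]
      rfl

/-- Subtraction inverts addition on canonical digit lists only: `[false]` would come back as `[]`.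
Canonical lists make zero the empty tape, so that a zero test inspects a single cell. -/
theorem decList_incList_bits (n : ℕ) : decList (incList n.bits) = n.bits := by
  induction n using Nat.binaryRec' with
  | zero => simp [incList, decList]
  | bit b n h ih =>
    cases b with
    | false =>
      have hn : n ≠ 0 := fun h0 => by simpa using h h0
      rw [Nat.bit_false_apply, Nat.bit0_bits n hn]
      have : n.bits ≠ [] := fun h => hn (by rw [← Nat.size_eq_zero, ← Nat.size_eq_bits_len, h]; rfl)
      obtain ⟨a, l, hal⟩ := List.exists_cons_of_ne_nil this
      simp [incList, hal, decList]
    | true =>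
      rw [Nat.bit_true_apply, Nat.bit1_bits]
      simp [incList, decList, ih]

theorem bits_pred (n : ℕ) : (n - 1).bits = decList n.bits := by
  cases n with
  | zero => simp [decList]
  | succ n => rw [bits_succ, decList_incList_bits]; rfl

end BinaryCounter

namespace Frag

open BinaryCounter

variable {ι I O : Type} [DecidableEq ι] [Fintype ι]

/-- The transducer that simulates a counter machine, keeping each register on a tape of its own. -/
noncomputable def toTransducer (F : Frag ι I O) : Transducer I O where
  State := BinaryCounter.State F.St ι
  Sym := Bool × Option Bool
  finiteState := by have := F.finiteSt; infer_instance
  finiteSym := inferInstance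
  tapes := Fintype.card ι
  blank := (false, none)
  start := State.boot
  halt q := q = State.rest none
  δ q i syms b :=
    match q with
    | State.boot =>
      ⟨State.rest (some F.entry), fun _ => (true, none), fun _ => Move.stay, Move.stay, none⟩
    | State.rest none => ⟨State.rest none, syms, fun _ => Move.stay, Move.stay, none⟩
    | State.rest (some q) =>
      let a := F.δ q i (fun v => (syms (Fintype.equivFin ι v)).2.isNone) b
      ⟨match a.op with
        | none => State.rest a.next
        | some (v, true) => State.work a.next v Phase.carry
        | some (v, false) =>
          if (syms (Fintype.equivFin ι v)).2.isNone then State.rest a.next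
          else State.work a.next v Phase.borrow,
        syms, fun _ => Move.stay, a.moveI, a.emit⟩
    | State.work q v ph =>
      let r := phaseStep (syms (Fintype.equivFin ι v)).1 (syms (Fintype.equivFin ι v)).2 ph
      ⟨State.after q v r.1,
        Function.update syms (Fintype.equivFin ι v) ((syms (Fintype.equivFin ι v)).1, r.2.1),
        Function.update (fun _ => Move.stay) (Fintype.equivFin ι v) r.2.2, Move.stay, none⟩

/-- The configuration with the digits `tp v` on tape `v` and with head positions `hd v`. -/
noncomputable def tmConfig (F : Frag ι I O) (q : BinaryCounter.State F.St ι) (pos : ℕ)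
    (out : List O) (tp : ι → List Bool) (hd : ι → ℕ) : F.toTransducer.Config where
  state := q
  inputHead := pos
  head j := hd ((Fintype.equivFin ι).symm j)
  tape j := listTape (tp ((Fintype.equivFin ι).symm j))
  output := out

noncomputable def encode (F : Frag ι I O) (c : Option F.St × Store ι O) :
    F.toTransducer.Config :=
  F.tmConfig (State.rest c.1) c.2.pos c.2.out (fun v => (c.2.reg v).bits) fun _ => 0

theorem step_tmConfig_work (F : Frag ι I O) (x : List I) (b : Bool) (q : Option F.St) (v : ι)
    (ph : Phase) (pos : ℕ) (out : List O) (tp : ι → List Bool) (hd : ι → ℕ)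
    (ph' : Option Phase) (w : Option Bool) (m : Move) (L' : List Bool)
    (hw : phaseStep (hd v == 0) (tp v)[hd v]? ph = (ph', w, m))
    (hL : Function.update (listTape (tp v)) (hd v) (hd v == 0, w) = listTape L') :
    F.toTransducer.step x b (F.tmConfig (State.work q v ph) pos out tp hd) =
      F.tmConfig (State.after q v ph') pos out (Function.update tp v L')
          (Function.update hd v (moveWork (hd v) m)) := by
  have hsym : ∀ j, (F.tmConfig (State.work q v ph) pos out tp hd).tape j
      ((F.tmConfig (State.work q v ph) pos out tp hd).head j) =
      (hd ((Fintype.equivFin ι).symm j) == 0,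
        (tp ((Fintype.equivFin ι).symm j))[hd ((Fintype.equivFin ι).symm j)]?) := fun j => rfl
  rw [Transducer.step, if_neg (by simp [toTransducer, tmConfig])]
  simp only [hsym]
  simp only [toTransducer, tmConfig, Equiv.symm_apply_apply, hw, moveInput,
    Option.toList, List.append_nil]
  congr 1
  · funext j
    by_cases hj : j = Fintype.equivFin ι v
    · subst hj; simp
    · have : (Fintype.equivFin ι).symm j ≠ v := fun h => hj (by rw [← h]; simp)
      simp [Function.update_of_ne hj, Function.update_of_ne this, moveWork]
  · funext j
    by_cases hj : j = Fintype.equivFin ι v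
    · subst hj; simpa using hL
    · have : (Fintype.equivFin ι).symm j ≠ v := fun h => hj (by rw [← h]; simp)
      simp only [Function.update_of_ne hj, Function.update_of_ne this]
      exact update_listTape_self _ _

/-- A counter at work: the tape of `v` holds the digits `L`, its head is at `h`, and all other
heads are at `0`. -/
noncomputable def workConfig (F : Frag ι I O) (q : Option F.St) (s : Store ι O) (v : ι)
    (ph : Phase) (L : List Bool) (h : ℕ) : F.toTransducer.Config :=
  F.tmConfig (State.work q v ph) s.pos s.out
    (Function.update (fun u => (s.reg u).bits) v L) (Function.update (fun _ => 0) v h)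

theorem step_workConfig (F : Frag ι I O) (x : List I) (b : Bool) (q : Option F.St)
    (s : Store ι O) (v : ι) {ph : Phase} {L : List Bool} {h : ℕ}
    (ph' : Phase) (w : Option Bool) (m : Move) (L' : List Bool)
    (hw : phaseStep (h == 0) L[h]? ph = (some ph', w, m))
    (hL : Function.update (listTape L) h (h == 0, w) = listTape L') :
    F.toTransducer.step x b (F.workConfig q s v ph L h) =
      F.workConfig q s v ph' L' (moveWork h m) := by
  unfold workConfig
  rw [step_tmConfig_work F x b q v ph s.pos s.out _ _ (some ph') w m L' (by simpa using hw)
    (by simpa using hL)]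
  simp [State.after]

def HeadsLE (F : Frag ι I O) (H : ℕ) (c : F.toTransducer.Config) : Prop :=
  ∀ j, c.head j ≤ H

theorem headsLE_workConfig (F : Frag ι I O) (q : Option F.St) (s : Store ι O) (v : ι)
    (ph : Phase) (L : List Bool) {h H : ℕ} (hH : h ≤ H) :
    F.HeadsLE H (F.workConfig q s v ph L h) := by
  intro j
  simp only [workConfig, tmConfig, Function.update_apply]
  split_ifs <;> omega

omit [DecidableEq ι] in
theorem headsLE_encode (F : Frag ι I O) (c : Option F.St × Store ι O) (H : ℕ) :
    F.HeadsLE H (F.encode c) := fun _ => Nat.zero_le _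

variable (F : Frag ι I O) (x : List I) (q : Option F.St) (s : Store ι O) (v : ι)

theorem reaches_ret {n : ℕ} {L : List Bool} (hL : L = n.bits) {h H : ℕ} (hH : h ≤ H) :
    Reaches (fun c b => F.toTransducer.step x b c) (F.HeadsLE H)
      (F.workConfig q s v Phase.ret L h) (h + 1) (Tree.leaf (F.encode (q, s.set v n))) := by
  induction h with
  | zero =>
    refine Reaches.det (headsLE_workConfig F q s v _ _ hH) fun b => ?_
    have : F.toTransducer.step x b (F.workConfig q s v Phase.ret L 0) =
        F.encode (q, s.set v n) := by
      unfold workConfig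
      rw [step_tmConfig_work F x b q v Phase.ret s.pos s.out _ _ none L[0]? Move.stay L
        (by simp [phaseStep]) (by simpa using update_listTape_self L 0)]
      simp only [Function.update_idem, encode, Store.set, moveWork, Function.update_self,
        Function.update_eq_self]
      congr 1
      funext u
      by_cases hu : u = v
      · subst hu; simp [hL]
      · simp [Function.update_of_ne hu]
    rw [this]
    exact Reaches.done _ _
  | succ h ih =>
    refine Reaches.det (headsLE_workConfig F q s v _ _ hH) fun b => ?_
    rw [step_workConfig F x b q s v Phase.ret L[h + 1]? Move.left L (by simp [phaseStep])
      (update_listTape_self L (h + 1))]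
    exact ih (by omega)

/-- `P` is the part of the number that the head has already passed; in the induction each carried
digit moves from `l` to `P`. -/
theorem reaches_carry (l P : List Bool) {H : ℕ} (hH : P.length + l.length ≤ H) :
    ∃ h ≤ H, Reaches (fun c b => F.toTransducer.step x b c) (F.HeadsLE H)
      (F.workConfig q s v Phase.carry (P ++ l) P.length) (l.length + 1)
      (Tree.leaf (F.workConfig q s v Phase.ret (P ++ incList l) h)) := by
  induction l generalizing P with
  | nil =>
    refine ⟨P.length, by omega, Reaches.det (headsLE_workConfig F q s v _ _ (by omega))
      fun b => ?_⟩
    rw [step_workConfig F x b q s v Phase.ret (some true) Move.stay (P ++ [true])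
      (by simp [phaseStep]) (by rw [List.append_nil, update_listTape_end])]
    exact Reaches.done _ _
  | cons a l ih =>
    cases a with
    | false =>
      refine ⟨P.length, by omega, Reaches.det (headsLE_workConfig F q s v _ _ (by omega))
        fun b => ?_⟩
      rw [step_workConfig F x b q s v Phase.ret (some true) Move.stay (P ++ true :: l)
        (by simp [phaseStep]) (update_listTape_append P l false true)]
      exact Reaches.done _ _
    | true =>
      obtain ⟨h, hh, hr⟩ := ih (P ++ [false]) (by simp at hH ⊢; omega)
      refine ⟨h, hh, Reaches.det (headsLE_workConfig F q s v _ _ (by omega)) fun b => ?_⟩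
      rw [step_workConfig F x b q s v Phase.carry (some false) Move.right (P ++ false :: l)
        (by simp [phaseStep]) (update_listTape_append P l true false)]
      simpa [incList, moveWork] using hr

/-- Since the leading digit is one, the borrow stops before the blank. The head then looks one cell
further to find out whether the digit that it stopped at was the leading one, which must be erased
rather than set to zero; hence two extra steps after the borrow. -/
theorem reaches_borrow (l P : List Bool) (hl : l.getLast? = some true) {H : ℕ}
    (hH : P.length + l.length ≤ H) :
    ∃ h ≤ H, Reaches (fun c b => F.toTransducer.step x b c) (F.HeadsLE H)
      (F.workConfig q s v Phase.borrow (P ++ l) P.length) (l.length + 3)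
      (Tree.leaf (F.workConfig q s v Phase.ret (P ++ decList l) h)) := by
  induction l generalizing P with
  | nil => simp at hl
  | cons a l ih =>
    cases a with
    | false =>
      cases l with
      | nil => simp at hl
      | cons a l =>
        obtain ⟨h, hh, hr⟩ := ih (P ++ [true]) (by simpa using hl) (by simp at hH ⊢; omega)
        refine ⟨h, hh, Reaches.det (headsLE_workConfig F q s v _ _ (by omega)) fun b => ?_⟩
        rw [step_workConfig F x b q s v Phase.borrow (some true) Move.right
          (P ++ true :: a :: l) (by simp [phaseStep]) (update_listTape_append P _ false true)]
        simpa [decList, moveWork] using hr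
    | true =>
      refine ⟨P.length, by omega, Reaches.det (headsLE_workConfig F q s v _ _ (by omega))
        fun b => ?_⟩
      rw [step_workConfig F x b q s v Phase.peek (some true) Move.right (P ++ true :: l)
        (by simp [phaseStep]) (update_listTape_append P l true true)]
      have hlen : P.length + 1 ≤ H := by simp at hH; omega
      refine (Reaches.det (headsLE_workConfig F q s v _ _ hlen) fun b => ?_ :
        Reaches _ _ _ (l.length + 1 + 1 + 1) _)
      rw [step_workConfig F x b q s v _ _ _ (P ++ true :: l)
        rfl (update_listTape_self _ _)]
      refine Reaches.det (headsLE_workConfig F q s v _ _ (by simp [moveWork]; omega))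
        fun b => ?_
      cases l with
      | nil =>
        rw [step_workConfig F x b q s v Phase.ret none Move.stay P
          (by simp [phaseStep]) (by simpa [moveWork] using update_listTape_erase P true)]
        simpa [decList, moveWork] using Reaches.done _ _
      | cons a l =>
        rw [step_workConfig F x b q s v Phase.ret (some false) Move.stay (P ++ false :: a :: l)
          (by simp [phaseStep]) (by simpa [moveWork] using update_listTape_append P _ true false)]
        simpa [decList, moveWork] using Reaches.done _ _

omit q s v [DecidableEq ι] in
theorem _root_.RandLogSpace.bits_getLast {n : ℕ} (hn : n ≠ 0) : n.bits.getLast? = some true := by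
  induction n using Nat.binaryRec' with
  | zero => exact absurd rfl hn
  | bit b n h ih =>
    by_cases h0 : n = 0
    · subst h0
      rw [h rfl]
      simp
    · have : n.bits ≠ [] := fun h => h0 (by rw [← Nat.size_eq_zero, ← Nat.size_eq_bits_len, h]; rfl)
      obtain ⟨a, l, hal⟩ := List.exists_cons_of_ne_nil this
      have h2 := ih h0
      cases b with
      | false =>
        rw [Nat.bit_false_apply, Nat.bit0_bits n h0]
        rw [hal] at h2 ⊢
        simpa using h2
      | true =>
        rw [Nat.bit_true_apply, Nat.bit1_bits]
        rw [hal] at h2 ⊢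
        simpa using h2

/-- The control step, which consumes the toss `b`, is already performed in the statement. What
remains is one sweep of a single counter, at most `H + 3` steps, and the return of its head, at most
`H + 1` steps; both ignore their tosses. -/
theorem reaches_encode_step (c : Option F.St × Store ι O) (hc : c.1 ≠ none) {H : ℕ}
    (hH : ∀ u, (c.2.reg u).size ≤ H) (b : Bool) :
    Reaches (fun c b => F.toTransducer.step x b c) (F.HeadsLE H)
      (F.toTransducer.step x b (F.encode c)) (2 * H + 4)
      (Tree.leaf (F.encode (F.step x c b))) := by
  obtain ⟨_ | q, s⟩ := c
  · exact absurd rfl hc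
  have hz : ∀ n : ℕ, (n.bits)[0]?.isNone = (n == 0) := by
    intro n
    by_cases hn : n = 0
    · simp [hn]
    · have : n.bits ≠ [] := fun h => hn (by rw [← Nat.size_eq_zero, ← Nat.size_eq_bits_len, h]; rfl)
      obtain ⟨a, l, hal⟩ := List.exists_cons_of_ne_nil this
      simp [hal, hn]
  have hsym : ∀ j, (F.encode (some q, s)).tape j ((F.encode (some q, s)).head j) =
      (true, (s.reg ((Fintype.equivFin ι).symm j)).bits[0]?) := fun j => rfl
  have hzeros : (fun v => decide (s.reg v = 0)) = s.zeros := rfl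
  have htape : ∀ L : List Bool, Function.update (listTape L) 0 (true, L[0]?) = listTape L :=
    fun L => update_listTape_self L 0
  have hstep : F.toTransducer.step x b (F.encode (some q, s)) =
      F.tmConfig (match (F.δ q (inputSymbol x s.pos) s.zeros b).op with
        | none => State.rest (F.δ q (inputSymbol x s.pos) s.zeros b).next
        | some (v, true) => State.work (F.δ q (inputSymbol x s.pos) s.zeros b).next v Phase.carry
        | some (v, false) =>
          if s.reg v = 0 then State.rest (F.δ q (inputSymbol x s.pos) s.zeros b).next
          else State.work (F.δ q (inputSymbol x s.pos) s.zeros b).next v Phase.borrow)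
        (moveInput x.length s.pos (F.δ q (inputSymbol x s.pos) s.zeros b).moveI)
        (s.out ++ (F.δ q (inputSymbol x s.pos) s.zeros b).emit.toList)
        (fun v => (s.reg v).bits) fun _ => 0 := by
    rw [Transducer.step, if_neg (by simp [toTransducer, tmConfig, encode])]
    simp only [hsym]
    simp only [toTransducer, encode, tmConfig, Equiv.symm_apply_apply, hz, beq_iff_eq]
    simp only [htape, moveWork]
    rfl
  rw [hstep]
  simp only [step, Store.apply]
  generalize F.δ q (inputSymbol x s.pos) s.zeros b = a
  obtain ⟨next, op, m, o⟩ := a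
  have hwork : ∀ (v : ι) (ph : Phase), F.tmConfig (State.work next v ph)
      (moveInput x.length s.pos m) (s.out ++ o.toList) (fun v => (s.reg v).bits) (fun _ => 0) =
      F.workConfig next ⟨s.reg, moveInput x.length s.pos m, s.out ++ o.toList⟩ v ph
        (s.reg v).bits 0 := by
    intro v ph
    unfold workConfig
    simp
  rcases op with _ | ⟨v, _ | _⟩
  · exact Reaches.done _ _
  · by_cases hv : s.reg v = 0
    · simp only [hv, if_true, applyOp]
      have : Function.update s.reg v (0 - 1) = s.reg := by
        rw [Nat.zero_sub, ← hv, Function.update_eq_self]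
      rw [this]
      exact Reaches.done _ _
    · simp only [hv, if_false, hwork, applyOp]
      obtain ⟨h, hh, hr⟩ := reaches_borrow F x next
        ⟨s.reg, moveInput x.length s.pos m, s.out ++ o.toList⟩ v (s.reg v).bits []
        (bits_getLast hv) (H := H) (by simpa [Nat.size_eq_bits_len] using hH v)
      have h2 := reaches_ret F x next ⟨s.reg, moveInput x.length s.pos m, s.out ++ o.toList⟩ v
        (bits_pred (s.reg v)).symm hh
      have h3 := hH v
      simp only at h3
      exact (hr.trans h2).mono (by rw [Nat.size_eq_bits_len]; omega)
  · simp only [hwork, applyOp]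
    obtain ⟨h, hh, hr⟩ := reaches_carry F x next
      ⟨s.reg, moveInput x.length s.pos m, s.out ++ o.toList⟩ v (s.reg v).bits []
      (H := H) (by simpa [Nat.size_eq_bits_len] using hH v)
    have h2 := reaches_ret F x next ⟨s.reg, moveInput x.length s.pos m, s.out ++ o.toList⟩ v
      (bits_succ (s.reg v)).symm hh
    have h3 := hH v
    simp only at h3
    exact (hr.trans h2).mono (by rw [Nat.size_eq_bits_len]; omega)

omit [Fintype ι] in
theorem applyOp_le {r : ι → ℕ} {N : ℕ} (h : ∀ u, r u ≤ N) (op : Option (ι × Bool)) (u : ι) :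
    applyOp r op u ≤ N + 1 := by
  have := h u
  rcases op with _ | ⟨v, _ | _⟩
  · simp only [applyOp]; omega
  · simp only [applyOp, Function.update_apply]
    split_ifs with hu
    · subst hu; omega
    · omega
  · simp only [applyOp, Function.update_apply]
    split_ifs with hu
    · subst hu; omega
    · omega

omit [Fintype ι] in
theorem step_reg_le {c : Option F.St × Store ι O} {N : ℕ} (h : ∀ u, c.2.reg u ≤ N) (b : Bool)
    (u : ι) : (F.step x c b).2.reg u ≤ N + 1 := by
  obtain ⟨_ | q, s⟩ := c
  · exact (h u).trans (Nat.le_succ N)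
  · exact applyOp_le h _ u

/-- A step raises a register by at most one, so `reg u + t ≤ N` is preserved when `t` counts the
remaining steps, and every number met on the way has at most `N.size` digits. The factor `2 * N.size
+ 5` is the control step plus the work on a counter. -/
theorem reaches_encode {c : Option F.St × Store ι O} {t N : ℕ}
    {T : Tree (Option F.St × Store ι O)}
    (h : Reaches (F.step x) (fun c => c.1 ≠ none) c t T) (hN : ∀ u, c.2.reg u + t ≤ N) :
    Reaches (fun c b => F.toTransducer.step x b c) (F.HeadsLE N.size)
      (F.encode c) (t * (2 * N.size + 5)) (T.map F.encode) := by
  have key : ∀ {c : Option F.St × Store ι O} {t : ℕ}, (∀ u, c.2.reg u + (t + 1) ≤ N) →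
      ∀ b u, (F.step x c b).2.reg u + t ≤ N := by
    intro c t hN b u
    have := step_reg_le (c := c) (N := N - (t + 1)) F x (fun u => by have := hN u; omega) b u
    have := hN u
    omega
  induction h with
  | done c t => exact Reaches.done _ _
  | @det c t T hP hs ih =>
    refine (Reaches.det (headsLE_encode F _ _) fun b => (reaches_encode_step F x _ hP
      (fun u => Nat.size_le_size (by have := hN u; omega)) b).trans
        (ih b (key hN b))).mono ?_
    have : (t + 1) * (2 * N.size + 5) = t * (2 * N.size + 5) + (2 * N.size + 5) := by ring
    omega
  | @toss c t T hP hs ih =>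
    refine (Reaches.toss (T := fun b => (T b).map F.encode) (headsLE_encode F _ _)
      fun b => (reaches_encode_step F x _ hP
      (fun u => Nat.size_le_size (by have := hN u; omega)) b).trans
        (ih b (key hN b))).mono ?_
    have : (t + 1) * (2 * N.size + 5) = t * (2 * N.size + 5) + (2 * N.size + 5) := by ring
    omega

omit q s v x in
/-- The initial store. -/
def _root_.RandLogSpace.Store.init (ι O : Type) : Store ι O := ⟨fun _ => 0, 0, []⟩

/-- The first step only marks cell `0` of every tape. This turns blank tapes into representations of
zero, and later the mark tells a returning head where to stop. -/
theorem reaches_boot {t : ℕ} {T : Tree (Store ι O)} (h : F.Runs x (Store.init ι O) t T) :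
    Reaches (fun c b => F.toTransducer.step x b c) (F.HeadsLE t.size)
      F.toTransducer.init (t * (2 * t.size + 5) + 1)
      (T.map fun s => F.encode (none, s)) := by
  refine Reaches.det (fun _ => Nat.zero_le _) fun b => ?_
  have : F.toTransducer.step x b F.toTransducer.init =
      F.encode (some F.entry, Store.init ι O) := by
    rw [Transducer.step, if_neg (by simp [toTransducer, Transducer.init])]
    simp only [toTransducer, Transducer.init, encode, tmConfig, Store.init, moveWork, moveInput]
    congr 1
    funext j u
    cases u with
    | zero => simp [listTape]
    | succ u => simp [listTape]
  rw [this]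
  have h2 := reaches_encode F x h (N := t) (fun u => by simp [Store.init])
  rwa [Tree.map_map] at h2

omit q s v x in
/-- A counter machine that runs in polynomial time is a randomized log-space algorithm. -/
theorem isLogSpace_toTransducer {p : Polynomial ℕ} {T : List I → Tree (Store ι O)}
    (h : ∀ x, F.Runs x (Store.init ι O) (p.eval x.length) (T x)) :
    F.toTransducer.IsLogSpace ∧ ∀ x (P : List O → Prop),
      prob (fun r => ∃ w, F.toTransducer.Outputs x r w ∧ P w) =
        (T x).ev fun s => ind (P s.out) := by
  have hall : ∀ x H, ((T x).map fun s => F.encode (none, s)).All fun c =>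
      (F.HeadsLE H c ∧ F.toTransducer.halt c.state) ∧ ∀ b, F.toTransducer.step x b c = c := by
    intro x H
    refine (T x).all_true.map fun s _ => ?_
    have hh : F.toTransducer.halt (F.encode (none, s)).state := rfl
    exact ⟨⟨headsLE_encode F _ _, hh⟩, fun b => Transducer.step_of_halt _ _ _ _ hh⟩
  -- For the time bound the number of digits is estimated by the number itself, which keeps the
  -- bound polynomial; the logarithmic estimate is needed for space only.
  set tp : Polynomial ℕ := p * (2 * p + 5) + 1 with htp
  have hle : ∀ n, p.eval n * (2 * (p.eval n).size + 5) + 1 ≤ tp.eval n := by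
    intro n
    have : (p.eval n).size ≤ p.eval n := Nat.size_le.2 Nat.lt_two_pow_self
    simp only [htp, Polynomial.eval_add, Polynomial.eval_mul, Polynomial.eval_one,
      Polynomial.eval_ofNat]
    gcongr
  have hR := fun x => reaches_boot F x (h x)
  have hhalt : ∀ x r, F.toTransducer.halt (F.toTransducer.run x r (tp.eval x.length)).state := by
    intro x r
    rw [Transducer.run_eq_iter]
    exact (hR x).iter_of_all (p := fun c => F.toTransducer.halt c.state)
      ((hall x 0).mono fun c hc => ⟨hc.1.2, hc.2⟩) r (hle _)
  refine ⟨⟨⟨tp, hhalt⟩, ?_⟩, ?_⟩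
  · obtain ⟨d, hd⟩ := exists_eval_le_pow p
    refine ⟨2 * d + 2, fun x r t i => ?_⟩
    rw [Transducer.run_eq_iter]
    exact ((hR x).invariant ((hall x _).mono fun c hc => ⟨hc.1.1, hc.2⟩) r t i).trans_lt
      (size_le_of_le_pow (hd _))
  · intro x P
    rw [F.toTransducer.prob_outputs x (hhalt x) P,
      ((hR x).mono (hle _)).ev_iterTree ((hall x 0).mono fun c hc => hc.2), Tree.ev_map]
    rfl

end Frag

/-! ### Arithmetic on counter machines -/

section Store

variable {ι O : Type} [DecidableEq ι]

theorem Store.set_self (s : Store ι O) (i : ι) : s.set i (s.reg i) = s := by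
  simp [Store.set]

@[simp] theorem Store.reg_set (s : Store ι O) (i : ι) (v : ℕ) (j : ι) :
    (s.set i v).reg j = if j = i then v else s.reg j := by
  simp [Store.set, Function.update_apply]

@[simp] theorem Store.pos_set (s : Store ι O) (i : ι) (v : ℕ) : (s.set i v).pos = s.pos := rfl
@[simp] theorem Store.out_set (s : Store ι O) (i : ι) (v : ℕ) : (s.set i v).out = s.out := rfl

omit [DecidableEq ι] in
theorem Store.ext_reg {s s' : Store ι O} (h : ∀ i, s.reg i = s'.reg i) (hp : s.pos = s'.pos)
    (ho : s.out = s'.out) : s = s' :=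
  Store.ext (funext h) hp ho

end Store

namespace Frag

variable {ι I O : Type} [DecidableEq ι]

/-- A run without coin tosses. -/
def Det (F : Frag ι I O) (x : List I) (s : Store ι O) (t : ℕ) (s' : Store ι O) : Prop :=
  F.Runs x s t (Tree.leaf s')

theorem Det.mono {F : Frag ι I O} {x : List I} {s s' : Store ι O} {t t' : ℕ}
    (h : F.Det x s t s') (htt : t ≤ t') : F.Det x s t' s' :=
  Runs.mono h htt

theorem Det.runs_seq {F G : Frag ι I O} {x : List I} {s s' : Store ι O} {t t' : ℕ}
    {T : Tree (Store ι O)} (hF : F.Det x s t s') (hG : G.Runs x s' t' T) :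
    (F.seq G).Runs x s (t + t') T :=
  Frag.runs_seq (k := fun _ => T) hF hG

theorem Det.seq {F G : Frag ι I O} {x : List I} {s s' s'' : Store ι O} {t t' : ℕ}
    (hF : F.Det x s t s') (hG : G.Det x s' t' s'') : (F.seq G).Det x s (t + t') s'' :=
  hF.runs_seq hG

theorem Det.of_eq {F : Frag ι I O} {x : List I} {s s' s'' : Store ι O} {t : ℕ}
    (h : F.Det x s t s') (e : s' = s'') : F.Det x s t s'' :=
  e ▸ h

def inc (i : ι) : Frag ι I O := atom (some (i, true)) Move.stay none
def dec (i : ι) : Frag ι I O := atom (some (i, false)) Move.stay none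
def skip : Frag ι I O := atom none Move.stay none
def whileNZ (i : ι) (F : Frag ι I O) : Frag ι I O := loopWhile (fun _ z => !z i) F
def ifZ (i : ι) (F G : Frag ι I O) : Frag ι I O :=
  branch (fun _ z _ => z i) fun b => match b with
    | true => F
    | false => G

variable {x : List I} {s s' : Store ι O}

theorem det_inc (i : ι) : (inc i : Frag ι I O).Det x s 1 (s.set i (s.reg i + 1)) := by
  simpa [moveInput, applyOp, Det, Store.set, inc, dec, skip] using runs_atom x (some (i, true)) Move.stay none s

theorem det_dec (i : ι) : (dec i : Frag ι I O).Det x s 1 (s.set i (s.reg i - 1)) := by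
  simpa [moveInput, applyOp, Det, Store.set, inc, dec, skip] using runs_atom x (some (i, false)) Move.stay none s

theorem det_skip : (skip : Frag ι I O).Det x s 1 s := by
  simpa [moveInput, applyOp, Det, Store.set, inc, dec, skip] using runs_atom x none Move.stay none s

theorem runs_ifZ_pos {F G : Frag ι I O} {i : ι} {t : ℕ} {T : Tree (Store ι O)}
    (h : s.reg i = 0) (hF : F.Runs x s t T) : (ifZ i F G).Runs x s (t + 1) T :=
  runs_branch (a := true) (fun _ => by simp [Store.zeros, h]) hF

theorem runs_ifZ_neg {F G : Frag ι I O} {i : ι} {t : ℕ} {T : Tree (Store ι O)}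
    (h : s.reg i ≠ 0) (hG : G.Runs x s t T) : (ifZ i F G).Runs x s (t + 1) T :=
  runs_branch (a := false) (fun _ => by simp [Store.zeros, h]) hG

/-- `σ j` is the store after `j` rounds, so that a loop is verified by writing down this sequence;
one extra step per round and one at the end pay for the test. -/
theorem det_loopWhile {test : InSym I → (ι → Bool) → Bool} {F : Frag ι I O} {tb : ℕ}
    (σ : ℕ → Store ι O) (m : ℕ)
    (htest : ∀ j < m, test (inputSymbol x (σ j).pos) (σ j).zeros = true)
    (hF : ∀ j < m, F.Det x (σ j) tb (σ (j + 1)))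
    (hend : test (inputSymbol x (σ m).pos) (σ m).zeros = false) :
    (loopWhile test F).Det x (σ 0) (m * (tb + 1) + 1) (σ m) := by
  induction m generalizing σ with
  | zero => exact (runs_loopWhile_false hend).mono (by omega)
  | succ m ih =>
    have h1 := ih (fun j => σ (j + 1)) (fun j hj => htest (j + 1) (by omega))
      (fun j hj => hF (j + 1) (by omega)) hend
    refine (runs_loopWhile_true (htest 0 (by omega)) (hF 0 (by omega)) (t' := m * (tb + 1) + 1)
      (k := fun _ => Tree.leaf (σ (m + 1))) h1).mono ?_
    rw [Nat.succ_mul]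
    omega

theorem det_whileNZ {i : ι} {F : Frag ι I O} {tb : ℕ} (σ : ℕ → Store ι O) (m : ℕ)
    (hs : σ 0 = s) (hs' : σ m = s') (htest : ∀ j < m, (σ j).reg i ≠ 0)
    (hF : ∀ j < m, F.Det x (σ j) tb (σ (j + 1))) (hend : (σ m).reg i = 0) :
    (whileNZ i F).Det x s (m * (tb + 1) + 1) s' := by
  subst hs hs'
  exact det_loopWhile σ m (fun j hj => by simp [Store.zeros, htest j hj]) hF
    (by simp [Store.zeros, hend])

def clear (a : ι) : Frag ι I O := whileNZ a (dec a)

theorem det_clear (a : ι) : (clear a : Frag ι I O).Det x s (s.reg a * 2 + 1) (s.set a 0) := by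
  refine det_whileNZ (fun j => s.set a (s.reg a - j)) (s.reg a) (by simp [Store.set_self])
    (by simp) (fun j hj => by simp; omega) (fun j hj => ?_) (by simp)
  convert det_dec a using 1
  refine Store.ext_reg (fun i => ?_) rfl rfl
  simp only [Store.reg_set]
  split_ifs <;> omega

/-- `b += a; a := 0` -/
def addTo (a b : ι) : Frag ι I O := whileNZ a ((dec a).seq (inc b))

theorem det_addTo {a b : ι} (hab : a ≠ b) : (addTo a b : Frag ι I O).Det x s (s.reg a * 3 + 1)
    ((s.set b (s.reg b + s.reg a)).set a 0) := by
  refine det_whileNZ (fun j => (s.set b (s.reg b + j)).set a (s.reg a - j)) (s.reg a)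
    (Store.ext_reg (fun i => ?_) rfl rfl) (by simp) (fun j hj => by simp; omega)
    (fun j hj => ?_) (by simp)
  · simp only [Store.reg_set]
    split_ifs <;> simp_all
  · convert (det_dec a).seq (det_inc b) using 1
    refine Store.ext_reg (fun i => ?_) rfl rfl
    simp only [Store.reg_set, hab, hab.symm, if_false]
    split_ifs <;> simp_all <;> omega

/-- `b -= a; a := 0` -/
def subFrom (a b : ι) : Frag ι I O := whileNZ a ((dec a).seq (dec b))

theorem det_subFrom {a b : ι} (hab : a ≠ b) :
    (subFrom a b : Frag ι I O).Det x s (s.reg a * 3 + 1)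
      ((s.set b (s.reg b - s.reg a)).set a 0) := by
  refine det_whileNZ (fun j => (s.set b (s.reg b - j)).set a (s.reg a - j)) (s.reg a)
    (Store.ext_reg (fun i => ?_) rfl rfl) (by simp) (fun j hj => by simp; omega)
    (fun j hj => ?_) (by simp)
  · simp only [Store.reg_set]
    split_ifs <;> simp_all
  · convert (det_dec a).seq (det_dec b) using 1
    refine Store.ext_reg (fun i => ?_) rfl rfl
    simp only [Store.reg_set, hab, hab.symm, if_false]
    split_ifs <;> simp_all <;> omega

/-- `b += a`, with an auxiliary register `c` that is zero before and after. -/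
def copyTo (a b c : ι) : Frag ι I O :=
  (whileNZ a ((dec a).seq ((inc b).seq (inc c)))).seq (addTo c a)

theorem det_copyTo {a b c : ι} (hab : a ≠ b) (hac : a ≠ c) (hbc : b ≠ c) (hc : s.reg c = 0) :
    (copyTo a b c : Frag ι I O).Det x s (s.reg a * 7 + 2) (s.set b (s.reg b + s.reg a)) := by
  have h1 : (whileNZ a ((dec a).seq ((inc b).seq (inc c))) : Frag ι I O).Det x s
      (s.reg a * (3 + 1) + 1)
      (((s.set b (s.reg b + s.reg a)).set c (s.reg a)).set a 0) := by
    refine det_whileNZ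
      (fun j => ((s.set b (s.reg b + j)).set c j).set a (s.reg a - j)) (s.reg a)
      (Store.ext_reg (fun i => ?_) rfl rfl) (by simp) (fun j hj => by simp; omega)
      (fun j hj => ?_) (by simp)
    · simp only [Store.reg_set]
      split_ifs <;> simp_all
    · convert (det_dec a).seq ((det_inc b).seq (det_inc c)) using 1
      refine Store.ext_reg (fun i => ?_) rfl rfl
      simp only [Store.reg_set, hab, hab.symm, hac, hac.symm, hbc, hbc.symm, if_false, if_true]
      split_ifs <;> simp_all <;> omega
  refine ((h1.seq (det_addTo hac.symm)).mono (t' := s.reg a * 7 + 2)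
    (by simp [hac.symm]; omega)).of_eq (Store.ext_reg (fun i => ?_) rfl rfl)
  simp only [Store.reg_set, hab, hac, hac.symm, hbc.symm, if_false, if_true]
  split_ifs <;> simp_all

/-- `c += a * b; a := 0` -/
def mulTo (a b c d : ι) : Frag ι I O := whileNZ a ((dec a).seq (copyTo b c d))

theorem det_mulTo {a b c d : ι} (hab : a ≠ b) (hac : a ≠ c) (had : a ≠ d) (hbc : b ≠ c)
    (hbd : b ≠ d) (hcd : c ≠ d) (hd : s.reg d = 0) :
    (mulTo a b c d : Frag ι I O).Det x s (s.reg a * (s.reg b * 7 + 4) + 1)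
      ((s.set c (s.reg c + s.reg a * s.reg b)).set a 0) := by
  have h : (mulTo a b c d : Frag ι I O).Det x s (s.reg a * (1 + (s.reg b * 7 + 2) + 1) + 1)
      ((s.set c (s.reg c + s.reg a * s.reg b)).set a 0) := by
    refine det_whileNZ
      (fun j => (s.set c (s.reg c + j * s.reg b)).set a (s.reg a - j)) (s.reg a)
      (Store.ext_reg (fun i => ?_) rfl rfl) (by simp) (fun j hj => by simp; omega)
      (fun j hj => ?_) (by simp)
    · simp only [Store.reg_set]
      split_ifs <;> simp_all
    · have h2 := (det_dec a (I := I) (x := x) (s := (s.set c (s.reg c + j * s.reg b)).set a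
        (s.reg a - j))).seq (det_copyTo hbc hbd hcd (by simp [hcd.symm, had.symm, hd]))
      simp only [Store.reg_set, hab.symm, hbc, if_false] at h2
      refine h2.of_eq (Store.ext_reg (fun i => ?_) rfl rfl)
      simp only [Store.reg_set, hac, hac.symm, if_false, if_true]
      split_ifs
      · simp_all
      · rw [Nat.succ_mul]; omega
      · omega
      · rfl
  exact h.mono (le_of_eq (by ring))

/-- `q := a / b; a := 0`, with auxiliary registers `c` and `d`. -/
def divTo (a b c q d : ι) : Frag ι I O :=
  ifZ b (clear a)
    ((copyTo b c d).seq ((whileNZ a ((dec a).seq ((dec c).seq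
      (ifZ c ((inc q).seq (copyTo b c d)) skip)))).seq (clear c)))

/-- After `j` rounds of `divTo` the register `c` holds `b - j % b`, the distance to the next
multiple of `b`. It drops to zero exactly when the quotient has to be increased. -/
theorem succ_div_mod_of_eq {j b : ℕ} (hb : b ≠ 0) (h : b - j % b - 1 = 0) :
    (j + 1) / b = j / b + 1 ∧ (j + 1) % b = 0 := by
  have h1 := Nat.mod_lt j (Nat.pos_of_ne_zero hb)
  have h2 : j + 1 = (j / b + 1) * b := by
    have := Nat.div_add_mod j b
    rw [add_mul, mul_comm]
    omega
  rw [h2]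
  exact ⟨Nat.mul_div_cancel _ (Nat.pos_of_ne_zero hb), Nat.mul_mod_left _ _⟩

theorem succ_div_mod_of_ne {j b : ℕ} (hb : b ≠ 0) (h : b - j % b - 1 ≠ 0) :
    (j + 1) / b = j / b ∧ (j + 1) % b = j % b + 1 := by
  have h1 := Nat.mod_lt j (Nat.pos_of_ne_zero hb)
  have h2 : j + 1 = (j % b + 1) + b * (j / b) := by
    have := Nat.div_add_mod j b
    omega
  have h3 : j % b + 1 < b := by omega
  rw [h2]
  constructor
  · rw [Nat.add_mul_div_left _ _ (Nat.pos_of_ne_zero hb), Nat.div_eq_of_lt h3, zero_add]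
  · rw [Nat.add_mul_mod_self_left, Nat.mod_eq_of_lt h3]

theorem det_divTo {a b c q d : ι} (hab : a ≠ b) (hac : a ≠ c) (haq : a ≠ q) (had : a ≠ d)
    (hbc : b ≠ c) (hbq : b ≠ q) (hbd : b ≠ d) (hcq : c ≠ q) (hcd : c ≠ d) (hqd : q ≠ d)
    (hc : s.reg c = 0) (hq : s.reg q = 0) (hd : s.reg d = 0) :
    (divTo a b c q d : Frag ι I O).Det x s
      (s.reg a * (s.reg b * 7 + 8) + s.reg b * 9 + 8)
      ((s.set q (s.reg a / s.reg b)).set a 0) := by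
  by_cases hb : s.reg b = 0
  -- For a zero divisor the quotient register keeps its value zero, in agreement with `a / 0 = 0`.
  · refine Det.mono (runs_ifZ_pos hb ?_) (t := s.reg a * 2 + 1 + 1) (by
      have := Nat.zero_le (s.reg a * (s.reg b * 7)); nlinarith)
    refine (det_clear a).of_eq (Store.ext_reg (fun i => ?_) rfl rfl)
    simp only [Store.reg_set]
    split_ifs <;> simp_all
  · set σ : ℕ → Store ι O := fun j => ((s.set q (j / s.reg b)).set c
      (s.reg b - j % s.reg b)).set a (s.reg a - j) with hσ
    have h0 : (copyTo b c d : Frag ι I O).Det x s (s.reg b * 7 + 2) (σ 0) := by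
      convert det_copyTo (x := x) (s := s) hbc hbd hcd hd using 1
      refine Store.ext_reg (fun i => ?_) rfl rfl
      simp only [hσ, Store.reg_set]
      split_ifs <;> simp_all
    have hloop : (whileNZ a ((dec a).seq ((dec c).seq
        (ifZ c ((inc q).seq (copyTo b c d)) skip))) : Frag ι I O).Det x (σ 0)
        (s.reg a * (1 + (1 + (1 + (s.reg b * 7 + 2) + 1)) + 1) + 1) (σ (s.reg a)) := by
      refine det_whileNZ σ _ rfl rfl (fun j hj => by simp [hσ]; omega) (fun j hj => ?_)
        (by simp [hσ])
      refine Det.seq (det_dec a) (Det.seq (det_dec c) ?_)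
      by_cases hz : s.reg b - j % s.reg b - 1 = 0
      · refine runs_ifZ_pos (by simp [hσ, hac.symm, hz]) ?_
        have h2 := (det_inc (I := I) (x := x) (s := ((σ j).set a ((σ j).reg a - 1)).set c
          (((σ j).set a ((σ j).reg a - 1)).reg c - 1)) q).seq
          (det_copyTo hbc hbd hcd (by simp [hσ, hqd.symm, hcd.symm, had.symm, hd]))
        obtain ⟨e1, e2⟩ := succ_div_mod_of_eq hb hz
        have hbb : ((((σ j).set a ((σ j).reg a - 1)).set c
          (((σ j).set a ((σ j).reg a - 1)).reg c - 1)).set q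
          ((((σ j).set a ((σ j).reg a - 1)).set c
          (((σ j).set a ((σ j).reg a - 1)).reg c - 1)).reg q + 1)).reg b = s.reg b := by
          simp [hσ, hbq, hbc, hab.symm]
        rw [hbb] at h2
        refine h2.of_eq (Store.ext_reg (fun i => ?_) rfl rfl)
        simp only [hσ, Store.reg_set, e1, e2]
        by_cases h1 : i = a
        · subst h1; simp [hac, haq]; omega
        by_cases h2 : i = c
        · subst h2; simp [hac.symm, hcq, hz]
        by_cases h3 : i = q
        · subst h3; simp [haq.symm, hcq.symm]
        simp [h1, h2, h3]
      · refine runs_ifZ_neg (by simp [hσ, hac.symm, hz]) ?_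
        obtain ⟨e1, e2⟩ := succ_div_mod_of_ne hb hz
        refine Det.mono (t := 1) ((det_skip (I := I)).of_eq (Store.ext_reg (fun i => ?_) rfl rfl))
          (by omega)
        simp only [hσ, Store.reg_set, e1, e2]
        by_cases h1 : i = a
        · subst h1; simp [hac]; omega
        by_cases h2 : i = c
        · subst h2; simp [hac.symm]; omega
        simp [h1, h2]
    have h1 := h0.seq (hloop.seq (det_clear c))
    refine Det.of_eq (Runs.mono (runs_ifZ_neg (F := clear a) hb h1) ?_)
      (Store.ext_reg (fun i => ?_) rfl rfl)
    · have : (σ (s.reg a)).reg c ≤ s.reg b := by simp [hσ, hac.symm]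
      nlinarith
    · simp only [hσ, Store.reg_set]
      split_ifs <;> simp_all

end Frag

/-! ### Arithmetic expressions -/

/-- Expressions in the registers, the length of the input, and the value of the cap. -/
inductive Expr (V : Type) where
  | var (v : V)
  | const (c : ℕ)
  | len
  | cap
  | add (e f : Expr V)
  | sub (e f : Expr V)
  | mul (e f : Expr V)
  | div (e f : Expr V)

namespace Expr

variable {V : Type}

def eval (r : V → ℕ) (n Q : ℕ) : Expr V → ℕ
  | var v => r v
  | const c => c
  | len => n
  | cap => Q
  | add e f => e.eval r n Q + f.eval r n Q
  | sub e f => e.eval r n Q - f.eval r n Q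
  | mul e f => e.eval r n Q * f.eval r n Q
  | div e f => e.eval r n Q / f.eval r n Q

/-- The number of temporary registers needed for the evaluation. -/
def height : Expr V → ℕ
  | var _ => 5
  | const _ => 5
  | len => 5
  | cap => 5
  | add e f => e.height + f.height + 5
  | sub e f => e.height + f.height + 5
  | mul e f => e.height + f.height + 5
  | div e f => e.height + f.height + 5

end Expr

/-- The temporary register number `d`. -/
abbrev tmp {V : Type} {w : ℕ} (d : ℕ) : V ⊕ Fin (w + 1) := Sum.inr (Fin.ofNat (w + 1) d)

/-- `tmp` reduces its index modulo `w + 1`, so distinct indices give distinct registers only within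
the range; correctness statements therefore demand enough registers above `d`. -/
theorem tmp_ne {V : Type} {w a b : ℕ} (ha : a ≤ w) (hb : b ≤ w) (h : a ≠ b) :
    (tmp a : V ⊕ Fin (w + 1)) ≠ tmp b := by
  intro he
  have := congrArg Fin.val (Sum.inr.inj he)
  simp only [Fin.val_ofNat] at this
  rw [Nat.mod_eq_of_lt (by omega), Nat.mod_eq_of_lt (by omega)] at this
  exact h this

namespace Expr

open Frag

variable {V I O : Type} {w : ℕ}

/-- Add the value of an expression to the temporary register `d`, which is zero initially, as are
all temporary registers after it. -/
def code : Expr V → ℕ → Frag (V ⊕ Fin (w + 1)) I O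
  | var v, d => copyTo (Sum.inl v) (tmp d) (tmp (d + 1))
  | const c, d => (List.replicate c (inc (tmp d))).foldr Frag.seq skip
  | len, d => copyTo (tmp 0) (tmp d) (tmp (d + 1))
  | cap, d => copyTo (tmp 1) (tmp d) (tmp (d + 1))
  | add e f, d => (e.code d).seq ((f.code (d + 1)).seq (addTo (tmp (d + 1)) (tmp d)))
  | sub e f, d => (e.code d).seq ((f.code (d + 1)).seq (subFrom (tmp (d + 1)) (tmp d)))
  | mul e f, d => (e.code d).seq ((f.code (d + 1)).seq
      ((mulTo (tmp d) (tmp (d + 1)) (tmp (d + 2)) (tmp (d + 3))).seq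
        ((Frag.clear (tmp (d + 1))).seq (addTo (tmp (d + 2)) (tmp d)))))
  | div e f, d => (e.code d).seq ((f.code (d + 1)).seq
      ((divTo (tmp d) (tmp (d + 1)) (tmp (d + 2)) (tmp (d + 3)) (tmp (d + 4))).seq
        ((Frag.clear (tmp (d + 1))).seq (addTo (tmp (d + 3)) (tmp d)))))

variable [DecidableEq V]

theorem det_replicate_inc (x : List I) (s : Store (V ⊕ Fin (w + 1)) O) (i : V ⊕ Fin (w + 1))
    (c : ℕ) : ((List.replicate c (inc i)).foldr Frag.seq skip).Det x s (c + 1)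
      (s.set i (s.reg i + c)) := by
  induction c generalizing s with
  | zero => exact det_skip.of_eq (by simp [Store.set_self])
  | succ c ih =>
    refine Det.mono (Det.of_eq (Det.seq (det_inc i) (ih _)) ?_) (t := 1 + (c + 1)) (by omega)
    refine Store.ext_reg (fun j => ?_) rfl rfl
    by_cases h : j = i
    · subst h
      simp only [Store.reg_set, if_true]
      omega
    · simp [h]

/-- The registers from which an expression is computed. -/
structure Ready (s : Store (V ⊕ Fin (w + 1)) O) (d n Q : ℕ) : Prop where
  le : 2 ≤ d
  len : s.reg (tmp 0) = n
  cap : s.reg (tmp 1) = Q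
  zero : ∀ k, d ≤ k → k ≤ w → s.reg (tmp k) = 0

omit [DecidableEq V] in
theorem Ready.succ_set [DecidableEq V] {s : Store (V ⊕ Fin (w + 1)) O} {d n Q : ℕ}
    (h : Ready s d n Q) (hd : d ≤ w) (v : ℕ) : Ready (s.set (tmp d) v) (d + 1) n Q where
  le := by have := h.le; omega
  len := by
    rw [Store.reg_set, if_neg (tmp_ne (by omega) hd (by have := h.le; omega)), h.len]
  cap := by
    have := h.le
    rw [Store.reg_set, if_neg (tmp_ne (by omega) hd (by omega)), h.cap]
  zero k hk hkw := by
    rw [Store.reg_set, if_neg (tmp_ne hkw hd (by omega)), h.zero k (by omega) hkw]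

/-- What it means that the code of an expression is correct and runs in time `T`. -/
def Correct (e : Expr V) (I O : Type) (p : Polynomial ℕ) : Prop :=
  ∀ (w d n Q N : ℕ) (x : List I) (s : Store (V ⊕ Fin (w + 1)) O), Ready s d n Q →
    d + e.height ≤ w → (∀ v, s.reg (Sum.inl v) ≤ N) → n ≤ N → Q ≤ N →
    e.eval (fun v => s.reg (Sum.inl v)) n Q ≤ p.eval N ∧
    (e.code d).Det x s (p.eval N)
      (s.set (tmp d) (e.eval (fun v => s.reg (Sum.inl v)) n Q))

theorem correct_copy {w d n Q N : ℕ} (x : List I) (s : Store (V ⊕ Fin (w + 1)) O)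
    (hs : Ready s d n Q) (hw : d + 5 ≤ w) {i : V ⊕ Fin (w + 1)} (hN : s.reg i ≤ N)
    (hi : i ≠ tmp d) (hi' : i ≠ tmp (d + 1)) :
    s.reg i ≤ (7 * Polynomial.X + 2 : Polynomial ℕ).eval N ∧
    (copyTo i (tmp d) (tmp (d + 1))).Det x s ((7 * Polynomial.X + 2 : Polynomial ℕ).eval N)
      (s.set (tmp d) (s.reg i)) := by
  simp only [Polynomial.eval_add, Polynomial.eval_mul, Polynomial.eval_ofNat, Polynomial.eval_X]
  refine ⟨by omega, Det.mono (Det.of_eq (det_copyTo hi hi' (tmp_ne (by omega) (by omega)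
    (by omega)) (hs.zero _ (by omega) (by omega))) ?_) (by omega)⟩
  rw [hs.zero d le_rfl (by omega), zero_add]

theorem correct_binary {e f : Expr V} {p q : Polynomial ℕ} (he : e.Correct I O p)
    (hf : f.Correct I O q) {w d n Q N : ℕ} {x : List I} {s : Store (V ⊕ Fin (w + 1)) O}
    (hs : Ready s d n Q) (hw : d + (e.height + f.height + 5) ≤ w)
    (hv : ∀ v, s.reg (Sum.inl v) ≤ N) (hn : n ≤ N) (hQ : Q ≤ N)
    {G : Frag (V ⊕ Fin (w + 1)) I O} {t : ℕ} {s' : Store (V ⊕ Fin (w + 1)) O}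
    (hG : G.Det x ((s.set (tmp d) (e.eval (fun v => s.reg (Sum.inl v)) n Q)).set (tmp (d + 1))
      (f.eval (fun v => s.reg (Sum.inl v)) n Q)) t s') :
    ((e.code d).seq ((f.code (d + 1)).seq G)).Det x s (p.eval N + q.eval N + t) s' := by
  have h1 := he w d n Q N x s hs (by omega) hv hn hQ
  have h2 := hf w (d + 1) n Q N x (s.set (tmp d) (e.eval (fun v => s.reg (Sum.inl v)) n Q))
    (hs.succ_set (by omega) _) (by omega) (fun v => by simpa using hv v) hn hQ
  simp only [Store.reg_set, reduceCtorEq, if_false] at h2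
  exact (h1.2.seq (h2.2.seq hG)).mono (by omega)

/-- A bound on the value is part of the induction because the arithmetic is unary: its running time
is polynomial in the values of the subexpressions, not in their lengths. -/
theorem exists_correct (e : Expr V) (I O : Type) : ∃ p, e.Correct I O p := by
  induction e with
  | var v =>
    refine ⟨7 * Polynomial.X + 2, fun w d n Q N x s hs hw hv hn hQ => ?_⟩
    exact correct_copy x s hs hw (hv v) (by simp) (by simp)
  | const c =>
    refine ⟨Polynomial.C (c + 1), fun w d n Q N x s hs hw hv hn hQ => ?_⟩
    rw [Polynomial.eval_C]
    refine ⟨Nat.le_succ c, (det_replicate_inc x s _ c).of_eq ?_⟩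
    rw [hs.zero d le_rfl (by omega), zero_add]
    rfl
  | len =>
    refine ⟨7 * Polynomial.X + 2, fun w d n Q N x s hs hw hv hn hQ => ?_⟩
    have hw : d + 5 ≤ w := hw
    have h2 := hs.le
    have := correct_copy x s hs hw (i := tmp 0) (hs.len.trans_le hn)
      (tmp_ne (by omega) (by omega) (by omega)) (tmp_ne (by omega) (by omega) (by omega))
    rwa [hs.len] at this
  | cap =>
    refine ⟨7 * Polynomial.X + 2, fun w d n Q N x s hs hw hv hn hQ => ?_⟩
    have hw : d + 5 ≤ w := hw
    have h2 := hs.le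
    have := correct_copy x s hs hw (i := tmp 1) (hs.cap.trans_le hQ)
      (tmp_ne (by omega) (by omega) (by omega)) (tmp_ne (by omega) (by omega) (by omega))
    rwa [hs.cap] at this
  | add e f he hf =>
    obtain ⟨p, hp⟩ := he
    obtain ⟨q, hq⟩ := hf
    refine ⟨p + q + (3 * q + 1), fun w d n Q N x s hs hw hv hn hQ => ?_⟩
    have hw : d + (e.height + f.height + 5) ≤ w := hw
    have ve := (hp w d n Q N x s hs (by omega) hv hn hQ).1
    have vf := (hq w d n Q N x s hs (by omega) hv hn hQ).1
    have n1 : (tmp d : V ⊕ Fin (w + 1)) ≠ tmp (d + 1) := tmp_ne (by omega) (by omega) (by omega)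
    simp only [Polynomial.eval_add, Polynomial.eval_mul, Polynomial.eval_ofNat,
      Polynomial.eval_one, eval]
    refine ⟨by omega, correct_binary hp hq hs hw hv hn hQ ?_⟩
    refine Det.mono (Det.of_eq (det_addTo n1.symm) ?_) (by simp; omega)
    have z1 := hs.zero (d + 1) (by omega) (by omega)
    refine Store.ext_reg (fun j => ?_) rfl rfl
    simp only [Store.reg_set, n1, if_false, if_true]
    split_ifs <;> simp_all
  | sub e f he hf =>
    obtain ⟨p, hp⟩ := he
    obtain ⟨q, hq⟩ := hf
    refine ⟨p + q + (3 * q + 1), fun w d n Q N x s hs hw hv hn hQ => ?_⟩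
    have hw : d + (e.height + f.height + 5) ≤ w := hw
    have ve := (hp w d n Q N x s hs (by omega) hv hn hQ).1
    have vf := (hq w d n Q N x s hs (by omega) hv hn hQ).1
    have n1 : (tmp d : V ⊕ Fin (w + 1)) ≠ tmp (d + 1) := tmp_ne (by omega) (by omega) (by omega)
    simp only [Polynomial.eval_add, Polynomial.eval_mul, Polynomial.eval_ofNat,
      Polynomial.eval_one, eval]
    refine ⟨by omega, correct_binary hp hq hs hw hv hn hQ ?_⟩
    refine Det.mono (Det.of_eq (det_subFrom n1.symm) ?_) (by simp; omega)
    have z1 := hs.zero (d + 1) (by omega) (by omega)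
    refine Store.ext_reg (fun j => ?_) rfl rfl
    simp only [Store.reg_set, n1, if_false, if_true]
    split_ifs <;> simp_all
  | mul e f he hf =>
    obtain ⟨p, hp⟩ := he
    obtain ⟨q, hq⟩ := hf
    -- The terms pay for the two operands, for `mulTo`, for clearing the second operand, and for
    -- moving the product back to register `d`.
    refine ⟨p + q + (p * (7 * q + 4) + 1 + (2 * q + 1 + (3 * (p * q) + 1))),
      fun w d n Q N x s hs hw hv hn hQ => ?_⟩
    have hw : d + (e.height + f.height + 5) ≤ w := hw
    have ve := (hp w d n Q N x s hs (by omega) hv hn hQ).1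
    have vf := (hq w d n Q N x s hs (by omega) hv hn hQ).1
    have ne : ∀ i j, i ≤ 4 → j ≤ 4 → i ≠ j → (tmp (d + i) : V ⊕ Fin (w + 1)) ≠ tmp (d + j) :=
      fun i j hi hj hij => tmp_ne (by omega) (by omega) (by omega)
    have n01 := ne 0 1 (by omega) (by omega) (by omega)
    have n02 := ne 0 2 (by omega) (by omega) (by omega)
    have n03 := ne 0 3 (by omega) (by omega) (by omega)
    have n12 := ne 1 2 (by omega) (by omega) (by omega)
    have n13 := ne 1 3 (by omega) (by omega) (by omega)
    have n23 := ne 2 3 (by omega) (by omega) (by omega)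
    have z1 := hs.zero (d + 1) (by omega) (by omega)
    have z2 := hs.zero (d + 2) (by omega) (by omega)
    have z3 := hs.zero (d + 3) (by omega) (by omega)
    simp only [Nat.add_zero] at n01 n02 n03
    simp only [Polynomial.eval_add, Polynomial.eval_mul, Polynomial.eval_ofNat,
      Polynomial.eval_one, eval]
    have hmul := Nat.mul_le_mul ve vf
    refine ⟨by omega, correct_binary hp hq hs hw hv hn hQ ?_⟩
    refine Det.seq (Det.mono (det_mulTo n01 n02 n03 n12 n13 n23 ?_) ?_)
      (Det.seq (Det.mono (det_clear _) ?_)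
        (Det.mono (Det.of_eq (det_addTo n02.symm) ?_) ?_))
    · simp [n13.symm, n03.symm, z3]
    · simp only [Store.reg_set, n01, if_false, if_true]
      exact Nat.add_le_add_right (Nat.mul_le_mul ve (by omega)) 1
    · simp only [Store.reg_set, n01.symm, n12, if_false, if_true]
      omega
    · refine Store.ext_reg (fun j => ?_) rfl rfl
      simp only [Store.reg_set, n01, n02, n02.symm, n12.symm, if_false, if_true]
      split_ifs <;> simp_all
    · simp only [Store.reg_set, n01, n02.symm, n12.symm, if_false, if_true, z2, zero_add]
      omega
  | div e f he hf =>
    obtain ⟨p, hp⟩ := he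
    obtain ⟨q, hq⟩ := hf
    -- As for products, with `divTo` in place of `mulTo`; the quotient that is moved back is at most
    -- the dividend, hence `3 * p + 1`.
    refine ⟨p + q + (p * (7 * q + 8) + 9 * q + 8 + (2 * q + 1 + (3 * p + 1))),
      fun w d n Q N x s hs hw hv hn hQ => ?_⟩
    have hw : d + (e.height + f.height + 5) ≤ w := hw
    have ve := (hp w d n Q N x s hs (by omega) hv hn hQ).1
    have vf := (hq w d n Q N x s hs (by omega) hv hn hQ).1
    have ne : ∀ i j, i ≤ 4 → j ≤ 4 → i ≠ j → (tmp (d + i) : V ⊕ Fin (w + 1)) ≠ tmp (d + j) :=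
      fun i j hi hj hij => tmp_ne (by omega) (by omega) (by omega)
    have n01 := ne 0 1 (by omega) (by omega) (by omega)
    have n02 := ne 0 2 (by omega) (by omega) (by omega)
    have n03 := ne 0 3 (by omega) (by omega) (by omega)
    have n04 := ne 0 4 (by omega) (by omega) (by omega)
    have n12 := ne 1 2 (by omega) (by omega) (by omega)
    have n13 := ne 1 3 (by omega) (by omega) (by omega)
    have n14 := ne 1 4 (by omega) (by omega) (by omega)
    have n23 := ne 2 3 (by omega) (by omega) (by omega)
    have n24 := ne 2 4 (by omega) (by omega) (by omega)
    have n34 := ne 3 4 (by omega) (by omega) (by omega)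
    have z1 := hs.zero (d + 1) (by omega) (by omega)
    have z2 := hs.zero (d + 2) (by omega) (by omega)
    have z3 := hs.zero (d + 3) (by omega) (by omega)
    have z4 := hs.zero (d + 4) (by omega) (by omega)
    simp only [Nat.add_zero] at n01 n02 n03 n04
    simp only [Polynomial.eval_add, Polynomial.eval_mul, Polynomial.eval_ofNat,
      Polynomial.eval_one, eval]
    have hdiv := (Nat.div_le_self (e.eval (fun v => s.reg (Sum.inl v)) n Q)
      (f.eval (fun v => s.reg (Sum.inl v)) n Q)).trans ve
    refine ⟨by omega, correct_binary hp hq hs hw hv hn hQ ?_⟩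
    refine Det.seq (Det.mono (det_divTo n01 n02 n03 n04 n12 n13 n14 n23 n24 n34 ?_ ?_ ?_) ?_)
      (Det.seq (Det.mono (det_clear _) ?_)
        (Det.mono (Det.of_eq (det_addTo n03.symm) ?_) ?_))
    · simp [n12.symm, n02.symm, z2]
    · simp [n13.symm, n03.symm, z3]
    · simp [n14.symm, n04.symm, z4]
    · simp only [Store.reg_set, n01, if_false, if_true]
      have := Nat.mul_le_mul ve (Nat.add_le_add_right (Nat.mul_le_mul_right 7 vf) 8)
      rw [mul_comm (q.eval N) 7] at this
      omega
    · simp [n01.symm, n13]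
      omega
    · refine Store.ext_reg (fun j => ?_) rfl rfl
      simp only [Store.reg_set, n01, n03, n03.symm, n13.symm, if_false, if_true]
      split_ifs <;> simp_all
    · simp only [Store.reg_set, n01, n03.symm, n13.symm, if_false, if_true]
      omega

end Expr

/-! ### Structured programs -/

/-- Randomized programs over registers. An assignment is capped, and the number of iterations of
a loop is evaluated before the loop. -/
inductive Prog (V I O : Type) where
  | skip
  | assign (v : V) (e : Expr V)
  | emit (o : O)
  | move (m : Move)
  | seq (c c' : Prog V I O)
  | ite (e : Expr V) (c c' : Prog V I O)
  | sym (f : InSym I → Prog V I O)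
  | flip (f : Bool → Prog V I O)
  | loop (e : Expr V) (c : Prog V I O)

/-- Repeat a randomized operation. -/
def Tree.iterate {α : Type} (k : α → Tree α) : ℕ → α → Tree α
  | 0, a => Tree.leaf a
  | m + 1, a => (k a).bind (Tree.iterate k m)

theorem Tree.All.iterate {α : Type} {k : α → Tree α} {p : α → Prop}
    (h : ∀ a, p a → (k a).All p) (m : ℕ) (a : α) (ha : p a) : (Tree.iterate k m a).All p := by
  induction m generalizing a with
  | zero => exact ha
  | succ m ih => exact (h a ha).bind ih

namespace Prog

variable {V I O : Type} [DecidableEq V]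

/-- The results of running a program on input `x` with cap `Q`. -/
def sem (x : List I) (Q : ℕ) : Prog V I O → Store V O → Tree (Store V O)
  | skip, s => Tree.leaf s
  | assign v e, s => Tree.leaf (s.set v (min (e.eval s.reg x.length Q) Q))
  | emit o, s => Tree.leaf ⟨s.reg, s.pos, s.out ++ [o]⟩
  | move m, s => Tree.leaf ⟨s.reg, moveInput x.length s.pos m, s.out⟩
  | seq c c', s => (c.sem x Q s).bind (c'.sem x Q)
  | ite e c c', s => if e.eval s.reg x.length Q = 0 then c'.sem x Q s else c.sem x Q s
  | sym f, s => (f (inputSymbol x s.pos)).sem x Q s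
  | flip f, s => Tree.node fun b => (f b).sem x Q s
  | loop e c, s => Tree.iterate (c.sem x Q) (e.eval s.reg x.length Q) s

def Bounded (Q : ℕ) (s : Store V O) : Prop := ∀ v, s.reg v ≤ Q

/-- This is what the cap is for: with all registers at most `Q`, the numbers of iterations of loops,
and hence the running time of any program, are polynomial in `Q`. -/
theorem sem_bounded (x : List I) (Q : ℕ) (c : Prog V I O) (s : Store V O) (h : Bounded Q s) :
    (c.sem x Q s).All (Bounded Q) := by
  induction c generalizing s with
  | skip => exact h
  | assign v e =>
    intro u
    rw [Store.reg_set]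
    split_ifs
    · exact min_le_right _ _
    · exact h u
  | emit o => exact h
  | move m => exact h
  | seq c c' ih ih' => exact (ih s h).bind ih'
  | ite e c c' ih ih' =>
    rw [sem]
    split_ifs
    · exact ih' s h
    · exact ih s h
  | sym f ih => exact ih _ s h
  | flip f ih => exact fun b => ih b s h
  | loop e c ih => exact Tree.All.iterate ih _ s h

variable [Finite I] {w : ℕ}

instance : Finite (InSym I) := by
  refine Finite.of_surjective (α := Option (Option I))
    (fun u => match u with
      | none => InSym.leftEnd
      | some none => InSym.rightEnd
      | some (some a) => InSym.symbol a) ?_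
  rintro (_ | a | _)
  exacts [⟨none, rfl⟩, ⟨some (some a), rfl⟩, ⟨some none, rfl⟩]

/-- The code of a program, with temporary registers from number `d` on. -/
def code : Prog V I O → ℕ → Frag (V ⊕ Fin (w + 1)) I O
  | skip, _ => Frag.skip
  | assign v e, d => ((Expr.sub e (Expr.sub e Expr.cap)).code d).seq
      ((Frag.clear (Sum.inl v)).seq (Frag.addTo (tmp d) (Sum.inl v)))
  | emit o, _ => Frag.atom none Move.stay (some o)
  | move m, _ => Frag.atom none m none
  | seq c c', d => (c.code d).seq (c'.code d)
  | ite e c c', d => (e.code d).seq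
      (Frag.ifZ (tmp d) (c'.code d) ((Frag.clear (tmp d)).seq (c.code d)))
  | sym f, d => Frag.branch (fun i _ _ => i) fun i => (f i).code d
  | flip f, d => Frag.branch (fun _ _ b => b) fun b => (f b).code d
  | loop e c, d => (e.code d).seq
      (Frag.whileNZ (tmp d) ((Frag.dec (tmp d)).seq (c.code (d + 1))))

/-- A store of the machine: program registers together with temporary registers. -/
def mix (s : Store V O) (τ : Fin (w + 1) → ℕ) : Store (V ⊕ Fin (w + 1)) O :=
  ⟨Sum.elim s.reg τ, s.pos, s.out⟩

omit [DecidableEq V] [Finite I] in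
theorem ready_mix {s : Store V O} {τ : Fin (w + 1) → ℕ} {d n Q : ℕ}
    (h : Expr.Ready (mix s τ) d n Q) (s' : Store V O) : Expr.Ready (mix s' τ) d n Q :=
  ⟨h.le, h.len, h.cap, h.zero⟩

omit [Finite I] in
theorem mix_set_tmp (s : Store V O) (τ : Fin (w + 1) → ℕ) (d v : ℕ) :
    (mix s τ).set (tmp d) v = mix s (Function.update τ (Fin.ofNat (w + 1) d) v) := by
  refine Store.ext_reg (fun j => ?_) rfl rfl
  rcases j with j | j
  · simp only [Store.reg_set, reduceCtorEq, if_false, mix, Sum.elim_inl]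
  · simp only [Store.reg_set, mix, Sum.elim_inr, Function.update_apply, Sum.inr.injEq]

omit [DecidableEq V] [Finite I] in
theorem update_ready {s : Store V O} {τ : Fin (w + 1) → ℕ} {d n Q : ℕ}
    (h : Expr.Ready (mix s τ) d n Q) (hd : d ≤ w) :
    Function.update τ (Fin.ofNat (w + 1) d) 0 = τ := by
  have h1 : τ (Fin.ofNat (w + 1) d) = 0 := h.zero d le_rfl hd
  have h2 := Function.update_eq_self (Fin.ofNat (w + 1) d) τ
  rwa [h1] at h2

/-- What it means that the code of a program is correct, with `h` temporary registers and
running time `p`. -/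
def Correct (c : Prog V I O) (h : ℕ) (p : Polynomial ℕ) : Prop :=
  ∀ (w d Q : ℕ) (x : List I) (s : Store V O) (τ : Fin (w + 1) → ℕ),
    Expr.Ready (mix s τ) d x.length Q → d + h ≤ w → x.length ≤ Q → Bounded Q s →
    (c.code d).Runs x (mix s τ) (p.eval Q) ((c.sem x Q s).map fun s' => mix s' τ)

omit [DecidableEq V] [Finite I] in
theorem exists_polynomial_ge {α : Type} [Finite α] (p : α → Polynomial ℕ) :
    ∃ q : Polynomial ℕ, ∀ a n, (p a).eval n ≤ q.eval n := by
  have := Fintype.ofFinite α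
  refine ⟨∑ a, p a, fun a n => ?_⟩
  rw [Polynomial.eval_finsetSum]
  exact Finset.single_le_sum (f := fun a => (p a).eval n) (fun _ _ => Nat.zero_le _)
    (Finset.mem_univ a)

omit [DecidableEq V] [Finite I] in
theorem exists_nat_ge {α : Type} [Finite α] (h : α → ℕ) : ∃ k, ∀ a, h a ≤ k := by
  obtain ⟨k, hk⟩ := (Set.finite_range h).bddAbove
  exact ⟨k, fun a => hk ⟨a, rfl⟩⟩

/-- The number of remaining rounds is kept in `tmp d`. The body is compiled for the temporary
registers from `d + 1` on, so it neither needs `tmp d` to be zero nor changes it. -/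
theorem runs_loop {c : Prog V I O} {h : ℕ} {p : Polynomial ℕ} (hc : c.Correct h p)
    {w d Q : ℕ} {x : List I} {s : Store V O} {τ : Fin (w + 1) → ℕ}
    (hs : Expr.Ready (mix s τ) d x.length Q) (hw : d + 1 + h ≤ w) (hn : x.length ≤ Q)
    (hQ : Bounded Q s) (m : ℕ) :
    (Frag.whileNZ (tmp d) ((Frag.dec (tmp d)).seq (c.code (d + 1)))).Runs x
      (mix s (Function.update τ (Fin.ofNat (w + 1) d) m)) (m * (p.eval Q + 2) + 1)
      ((Tree.iterate (c.sem x Q) m s).map fun s' => mix s' τ) := by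
  induction m generalizing s with
  | zero =>
    rw [update_ready hs (by omega)]
    exact (Frag.runs_loopWhile_false (by
      simpa [Store.zeros] using hs.zero d le_rfl (by omega))).mono (by omega)
  | succ m ih =>
    have hdec := Frag.det_dec (I := I) (x := x)
      (s := mix s (Function.update τ (Fin.ofNat (w + 1) d) (m + 1))) (tmp d)
    have hreg : (mix s (Function.update τ (Fin.ofNat (w + 1) d) (m + 1))).reg (tmp d) = m + 1 := by
      simp only [mix, Sum.elim_inr, Function.update_self]
    rw [hreg, mix_set_tmp, Function.update_idem, Nat.add_sub_cancel] at hdec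
    have hr : Expr.Ready (mix s (Function.update τ (Fin.ofNat (w + 1) d) m)) (d + 1)
        x.length Q := by
      rw [← mix_set_tmp]
      exact hs.succ_set (by omega) m
    have h1 := hdec.runs_seq (hc w (d + 1) Q x s _ hr (by omega) hn hQ)
    have h2 : (Frag.whileNZ (tmp d) ((Frag.dec (tmp d)).seq (c.code (d + 1)))).Runs x _ _ _ :=
      Frag.runs_loopWhile_true
      (test := fun _ z => !z (tmp d)) (by simp only [Store.zeros, hreg]; rfl) h1
      (t' := m * (p.eval Q + 2) + 1)
      (k := fun s' => ((Tree.iterate (c.sem x Q) m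
        ⟨fun v => s'.reg (Sum.inl v), s'.pos, s'.out⟩).map fun s' => mix s' τ)) (by
          refine (sem_bounded x Q c s hQ).map fun s' hs' => ?_
          exact ih (ready_mix hs s') hs')
    rw [Tree.map_bind] at h2
    rw [Tree.iterate, Tree.bind_map]
    refine h2.mono ?_
    rw [Nat.succ_mul]
    omega

/-- The temporary registers `τ` are restored by every construct, which makes the statements for
subprograms composable; a construct with several branches takes common bounds over its finitely many
branches. -/
theorem exists_correct (c : Prog V I O) : ∃ h p, c.Correct h p := by
  induction c with
  | skip =>
    refine ⟨0, 1, fun w d Q x s τ hs hw hn hQ => ?_⟩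
    exact Frag.det_skip.mono (by simp)
  | assign v e =>
    obtain ⟨p, hp⟩ := (Expr.sub e (Expr.sub e Expr.cap)).exists_correct I O
    refine ⟨(Expr.sub e (Expr.sub e Expr.cap)).height, p + (2 * Polynomial.X + 1 + (3 * p + 1)),
      fun w d Q x s τ hs hw hn hQ => ?_⟩
    obtain ⟨h1, h2⟩ := hp w d x.length Q Q x (mix s τ) hs hw hQ hn le_rfl
    have hd : d ≤ w := by omega
    simp only [Polynomial.eval_add, Polynomial.eval_mul, Polynomial.eval_ofNat,
      Polynomial.eval_one, Polynomial.eval_X]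
    -- With truncated subtraction, `e - (e - Q)` is the minimum of `e` and `Q`.
    have hval : (Expr.sub e (Expr.sub e Expr.cap)).eval (fun v => (mix s τ).reg (Sum.inl v))
        x.length Q = min (e.eval s.reg x.length Q) Q := by
      simp only [Expr.eval]
      rw [Nat.sub_sub_eq_min]
      rfl
    rw [hval] at h1 h2
    refine (h2.runs_seq (Frag.Det.seq (Frag.Det.mono (Frag.det_clear _) ?_)
      (Frag.Det.mono (Frag.Det.of_eq (Frag.det_addTo (by simp)) ?_) ?_)))
    · simp only [Store.reg_set, reduceCtorEq, if_false]
      have := hQ v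
      simp only [mix, Sum.elim_inl]
      omega
    · refine Store.ext_reg (fun j => ?_) rfl rfl
      have hz := hs.zero d le_rfl hd
      rcases j with j | j
      · simp only [Store.reg_set, mix, Sum.elim_inl, Sum.inl.injEq, reduceCtorEq, if_false,
          if_true, zero_add]
        split_ifs <;> rfl
      · by_cases hj : (Sum.inr j : V ⊕ Fin (w + 1)) = tmp d
        · rw [hj]
          simp only [Store.reg_set, if_true]
          exact hz.symm
        · simp only [Store.reg_set, hj, reduceCtorEq, if_false]
          rfl
    · simp only [Store.reg_set, reduceCtorEq, if_false, if_true]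
      omega
  | emit o =>
    refine ⟨0, 1, fun w d Q x s τ hs hw hn hQ => ?_⟩
    exact (Frag.runs_atom x none Move.stay (some o) (mix s τ)).mono (by simp)
  | move m =>
    refine ⟨0, 1, fun w d Q x s τ hs hw hn hQ => ?_⟩
    have := (Frag.runs_atom x none m none (mix s τ)).mono (t' := (1 : Polynomial ℕ).eval Q) (by simp)
    simpa [sem, code, applyOp, mix] using this
  | seq c c' ih ih' =>
    obtain ⟨h, p, hp⟩ := ih
    obtain ⟨h', p', hp'⟩ := ih'
    refine ⟨h + h', p + p', fun w d Q x s τ hs hw hn hQ => ?_⟩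
    have := Frag.runs_seq (hp w d Q x s τ hs (by omega) hn hQ) (t' := p'.eval Q)
      (G := c'.code d)
      -- The continuation must be defined on all machine stores, so it first restricts them to the
      -- program registers.
      (k := fun s' => ((c'.sem x Q ⟨fun v => s'.reg (Sum.inl v), s'.pos, s'.out⟩).map
        fun s' => mix s' τ)) (by
          refine (sem_bounded x Q c s hQ).map fun s' hs' => ?_
          exact hp' w d Q x s' τ (ready_mix hs s') (by omega) hn hs')
    rw [Tree.map_bind] at this
    rw [sem, Tree.bind_map, Polynomial.eval_add]
    exact this
  | ite e c c' ih ih' =>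
    obtain ⟨h, p, hp⟩ := ih
    obtain ⟨h', p', hp'⟩ := ih'
    obtain ⟨q, hq⟩ := e.exists_correct I O
    refine ⟨h + h' + e.height, q + (2 * q + 1 + p + p' + 1), fun w d Q x s τ hs hw hn hQ => ?_⟩
    obtain ⟨h1, h2⟩ := hq w d x.length Q Q x (mix s τ) hs (by omega) hQ hn le_rfl
    have hd : d ≤ w := by omega
    simp only [Polynomial.eval_add, Polynomial.eval_mul, Polynomial.eval_ofNat,
      Polynomial.eval_one]
    refine h2.runs_seq ?_
    change e.eval s.reg x.length Q ≤ _ at h1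
    change Frag.Runs _ x ((mix s τ).set _ (e.eval s.reg x.length Q)) _ _
    have hset : ((mix s τ).set (tmp d) (e.eval s.reg x.length Q)).set (tmp d) 0 = mix s τ := by
      rw [mix_set_tmp, mix_set_tmp, Function.update_idem, update_ready hs hd]
    by_cases hz : e.eval s.reg x.length Q = 0
    · rw [sem, if_pos hz, hz, mix_set_tmp, update_ready hs hd]
      refine (Frag.runs_ifZ_pos (hs.zero d le_rfl hd)
        (hp' w d Q x s τ hs (by omega) hn hQ)).mono (by omega)
    · rw [sem, if_neg hz]
      have h3 := Frag.det_clear (I := I) (x := x)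
        (s := (mix s τ).set (tmp d) (e.eval s.reg x.length Q)) (tmp d)
      rw [hset] at h3
      refine (Frag.runs_ifZ_neg (by simpa using hz)
        (h3.runs_seq (hp w d Q x s τ hs (by omega) hn hQ))).mono ?_
      simp only [Store.reg_set, if_true]
      omega
  | sym f ih =>
    choose h p hp using ih
    obtain ⟨k, hk⟩ := exists_nat_ge h
    obtain ⟨q, hq⟩ := exists_polynomial_ge p
    refine ⟨k, q + 1, fun w d Q x s τ hs hw hn hQ => ?_⟩
    rw [Polynomial.eval_add, Polynomial.eval_one]
    have := hk (inputSymbol x s.pos)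
    exact Frag.runs_branch (a := inputSymbol x s.pos) (fun _ => rfl)
      ((hp (inputSymbol x s.pos) w d Q x s τ hs (by omega) hn hQ).mono (hq _ _))
  | flip f ih =>
    choose h p hp using ih
    obtain ⟨k, hk⟩ := exists_nat_ge h
    obtain ⟨q, hq⟩ := exists_polynomial_ge p
    refine ⟨k, q + 1, fun w d Q x s τ hs hw hn hQ => ?_⟩
    rw [Polynomial.eval_add, Polynomial.eval_one]
    refine Frag.runs_branch_toss fun b => ?_
    have := hk b
    exact (hp b w d Q x s τ hs (by omega) hn hQ).mono (hq _ _)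
  | loop e c ih =>
    obtain ⟨h, p, hp⟩ := ih
    obtain ⟨q, hq⟩ := e.exists_correct I O
    refine ⟨h + e.height + 1, q + (q * (p + 2) + 1), fun w d Q x s τ hs hw hn hQ => ?_⟩
    obtain ⟨h1, h2⟩ := hq w d x.length Q Q x (mix s τ) hs (by omega) hQ hn le_rfl
    simp only [Polynomial.eval_add, Polynomial.eval_mul, Polynomial.eval_ofNat,
      Polynomial.eval_one]
    refine h2.runs_seq ?_
    rw [mix_set_tmp]
    exact (runs_loop hp hs (by omega) hn hQ _).mono (by gcongr)

end Prog

/-! ### Initializing the length and the cap; programs as log-space transducers -/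

theorem inputSymbol_of_lt {I : Type} (x : List I) {p : ℕ} (hp : p < x.length) :
    inputSymbol x (p + 1) = InSym.symbol x[p] := by
  simp [inputSymbol, hp]

theorem inputSymbol_end {I : Type} (x : List I) {p : ℕ} (hp : x.length ≤ p) :
    inputSymbol x (p + 1) = InSym.rightEnd := by
  simp [inputSymbol, hp]

namespace Expr

variable {V : Type}

/-- The expression for `(n + 2) ^ d`. -/
def lenPow : ℕ → Expr V
  | 0 => const 1
  | d + 1 => mul (lenPow d) (add len (const 2))

@[simp] theorem eval_lenPow (r : V → ℕ) (n Q d : ℕ) :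
    (lenPow d).eval r n Q = (n + 2) ^ d := by
  induction d with
  | zero => rfl
  | succ d ih => rw [lenPow, eval, ih, pow_succ]; rfl

end Expr

namespace Prog

variable {V I O : Type} [DecidableEq V]

/-- Store the input length in the register `i`. -/
def lenCode {ι : Type} [DecidableEq ι] (i : ι) : Frag ι I O :=
  (Frag.atom none Move.right none).seq
    ((Frag.loopWhile (fun a _ => match a with
        | InSym.rightEnd => false
        | _ => true) (Frag.atom (some (i, true)) Move.right none)).seq
      (Frag.loopWhile (fun a _ => match a with
        | InSym.leftEnd => false
        | _ => true) (Frag.atom none Move.left none)))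

/-- One sweep to the right end marker counts the symbols, and a second one brings the head back, so
that the program proper starts at position `0`. -/
theorem det_lenCode {ι : Type} [DecidableEq ι] (i : ι) (x : List I) :
    (lenCode i : Frag ι I O).Det x (Store.init ι O) (4 * x.length + 5)
      ((Store.init ι O).set i x.length) := by
  set σ : ℕ → Store ι O := fun j => ⟨Function.update (fun _ => 0) i j, j + 1, []⟩ with hσ
  set σ' : ℕ → Store ι O := fun j =>
    ⟨Function.update (fun _ => 0) i x.length, x.length + 1 - j, []⟩ with hσ'
  have h1 : (Frag.atom none Move.right none : Frag ι I O).Det x (Store.init ι O) 1 (σ 0) := by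
    have := Frag.runs_atom x none Move.right none (Store.init ι O)
    unfold Frag.Det
    convert this using 2
    refine Store.ext_reg (fun u => ?_) ?_ rfl
    · simp [hσ, Store.init, applyOp]
    · simp [hσ, Store.init, moveInput]
  have h2 := Frag.det_loopWhile (x := x) (test := fun a _ => match a with
        | InSym.rightEnd => false
        | _ => true) (F := (Frag.atom (some (i, true)) Move.right none : Frag ι I O)) (tb := 1)
        σ x.length
    (fun j hj => by simp [hσ, inputSymbol_of_lt x hj])
    (fun j hj => by
      have := Frag.runs_atom x (some (i, true)) Move.right none (σ j)
      unfold Frag.Det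
      convert this using 2
      refine Store.ext_reg (fun u => ?_) ?_ rfl
      · simp [hσ, applyOp]
      · simp [hσ, moveInput]; omega)
    (by simp [hσ, inputSymbol_end x le_rfl])
  have h3 := Frag.det_loopWhile (x := x) (test := fun a _ => match a with
        | InSym.leftEnd => false
        | _ => true) (F := (Frag.atom none Move.left none : Frag ι I O)) (tb := 1)
        σ' (x.length + 1)
    (fun j hj => by
      obtain ⟨p, hp⟩ : ∃ p, x.length + 1 - j = p + 1 := ⟨x.length - j, by omega⟩
      simp only [hσ', hp]
      rcases lt_or_ge p x.length with h | h
      · rw [inputSymbol_of_lt x h]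
      · rw [inputSymbol_end x h])
    (fun j hj => by
      have := Frag.runs_atom x none Move.left none (σ' j)
      unfold Frag.Det
      convert this using 2
      refine Store.ext_reg (fun u => rfl) ?_ rfl
      simp only [hσ', moveInput]
      omega)
    (by simp [hσ', inputSymbol])
  refine ((h1.seq (h2.seq h3)).of_eq ?_).mono (by omega)
  refine Store.ext_reg (fun u => ?_) ?_ rfl
  · simp [hσ', Store.init, Store.set]
  · simp [hσ', Store.init]

/-- The initial store of a program. -/
abbrev start (V O : Type) : Store V O := Store.init V O

/-- A program computes what some randomized log-space algorithm computes. -/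
theorem exists_transducer [Finite V] [Finite I] (c : Prog V I O) (d : ℕ) (hd : 1 ≤ d) :
    ∃ M : Transducer I O, M.IsLogSpace ∧ ∀ x (P : List O → Prop),
      prob (fun r => ∃ w, M.Outputs x r w ∧ P w) =
        (c.sem x ((x.length + 2) ^ d) (start V O)).ev fun s => ind (P s.out) := by
  have := Fintype.ofFinite V
  obtain ⟨h, p, hc⟩ := c.exists_correct
  obtain ⟨q, hq⟩ := (Expr.lenPow d : Expr V).exists_correct I O
  set w := h + (Expr.lenPow d : Expr V).height + 5 with hw
  set F : Frag (V ⊕ Fin (w + 1)) I O := (lenCode (tmp 0)).seq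
    (((Expr.lenPow d).code 2).seq ((Frag.addTo (tmp 2) (tmp 1)).seq (c.code 2))) with hF
  set P2 : Polynomial ℕ := (Polynomial.X + 2) ^ d with hP2
  have h2e : ∀ n : ℕ, P2.eval n = (n + 2) ^ d := fun n => by simp [hP2]
  set T : Polynomial ℕ := 4 * Polynomial.X + 5 + (q + (3 * P2 + 1 + p.comp P2)) with hT
  set τ : ℕ → Fin (w + 1) → ℕ := fun n => Function.update (Function.update (fun _ => 0)
    (Fin.ofNat (w + 1) 0) n) (Fin.ofNat (w + 1) 1) ((n + 2) ^ d) with hτ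
  have hrun : ∀ x : List I, F.Runs x (Store.init _ O) (T.eval x.length)
      ((c.sem x ((x.length + 2) ^ d) (start V O)).map fun s => mix s (τ x.length)) := by
    intro x
    simp only [hT, Polynomial.eval_add, Polynomial.eval_mul, Polynomial.eval_ofNat,
      Polynomial.eval_one, Polynomial.eval_X, Polynomial.eval_comp, h2e]
    have n20 : (tmp 2 : V ⊕ Fin (w + 1)) ≠ tmp 0 := tmp_ne (by omega) (by omega) (by omega)
    have n21 : (tmp 2 : V ⊕ Fin (w + 1)) ≠ tmp 1 := tmp_ne (by omega) (by omega) (by omega)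
    have n10 : (tmp 1 : V ⊕ Fin (w + 1)) ≠ tmp 0 := tmp_ne (by omega) (by omega) (by omega)
    refine (det_lenCode (tmp 0) x).runs_seq ?_
    -- While the cap is being computed, its register is still zero, so the code for `lenPow d` is
    -- used with the cap `0`, on which its value does not depend.
    have hr : Expr.Ready ((Store.init (V ⊕ Fin (w + 1)) O).set (tmp 0) x.length) 2 x.length 0 :=
      { le := le_rfl
        len := by simp only [Store.reg_set, if_true]
        cap := by simp only [Store.reg_set, n10, if_false]; rfl
        zero := fun k hk hkw => by
          rw [Store.reg_set, if_neg (tmp_ne hkw (by omega) (by omega))]; rfl }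
    have h1 := (hq w 2 x.length 0 x.length x _ hr (by omega)
      (fun v => by simp [Store.init]) le_rfl (Nat.zero_le _)).2
    rw [Expr.eval_lenPow] at h1
    refine h1.runs_seq (Frag.Det.runs_seq (Frag.Det.mono (Frag.Det.of_eq
      (Frag.det_addTo n21) (s'' := mix (start V O) (τ x.length)) ?_) ?_)
      (hc w 2 _ x (start V O) (τ x.length) ?_ (by omega) ?_ fun v => Nat.zero_le _))
    · refine Store.ext_reg (fun j => ?_) rfl rfl
      rcases j with j | j
      · simp only [Store.reg_set, reduceCtorEq, if_false]
        rfl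
      · simp only [Store.reg_set, n21.symm, n10, if_false, if_true]
        by_cases j2 : (Sum.inr j : V ⊕ Fin (w + 1)) = tmp 2
        · rw [j2]
          simp only [if_true]
          simp only [mix, hτ, Sum.elim_inr]
          rw [Function.update_of_ne (fun h => n21 (congrArg Sum.inr h)),
            Function.update_of_ne (fun h => n20 (congrArg Sum.inr h))]
        · simp only [j2, if_false]
          by_cases j1 : (Sum.inr j : V ⊕ Fin (w + 1)) = tmp 1
          · rw [j1]
            simp only [if_true, mix, hτ, Sum.elim_inr, Function.update_self]
            exact Nat.zero_add _
          · simp only [j1, if_false]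
            simp only [mix, hτ, Sum.elim_inr]
            rw [Function.update_of_ne (fun h => j1 (congrArg Sum.inr h)), Function.update_apply]
            simp only [Sum.inr.injEq]
            rfl
    · simp only [Store.reg_set, if_true]
      omega
    · refine ⟨le_rfl, ?_, ?_, fun k hk hkw => ?_⟩
      · simp only [mix, hτ, Sum.elim_inr]
        rw [Function.update_of_ne (fun h => n10 (congrArg Sum.inr h.symm)), Function.update_self]
      · simp only [mix, hτ, Sum.elim_inr, Function.update_self]
      · have k0 : (tmp k : V ⊕ Fin (w + 1)) ≠ tmp 0 := tmp_ne hkw (by omega) (by omega)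
        have k1 : (tmp k : V ⊕ Fin (w + 1)) ≠ tmp 1 := tmp_ne hkw (by omega) (by omega)
        simp only [mix, hτ, Sum.elim_inr]
        rw [Function.update_of_ne (fun h => k1 (congrArg Sum.inr h)),
          Function.update_of_ne (fun h => k0 (congrArg Sum.inr h))]
    · exact (by omega : x.length ≤ x.length + 2).trans (Nat.le_self_pow (by omega) _)
  obtain ⟨hM, hprob⟩ := F.isLogSpace_toTransducer hrun
  refine ⟨F.toTransducer, hM, fun x P => ?_⟩
  rw [hprob, Tree.ev_map]
  rfl

end Prog

/-! ### Case distinctions -/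

namespace Expr

variable {V : Type}

def mod (e f : Expr V) : Expr V := sub e (mul f (div e f))

/-- Zero if and only if the two values are equal. -/
def dist (e f : Expr V) : Expr V := add (sub e f) (sub f e)

@[simp] theorem eval_mod (r : V → ℕ) (n Q : ℕ) (e f : Expr V) :
    (mod e f).eval r n Q = e.eval r n Q % f.eval r n Q := by
  simp only [mod, eval]
  exact (Nat.mod_eq_sub_mul_div).symm

theorem eval_dist_eq_zero (r : V → ℕ) (n Q : ℕ) (e f : Expr V) :
    (dist e f).eval r n Q = 0 ↔ e.eval r n Q = f.eval r n Q := by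
  simp only [dist, eval]
  omega

end Expr

namespace Prog

variable {V I O : Type} [DecidableEq V]

/-- Continue with `f a`, where `a < m` is the value of `e`. -/
def switch (e : Expr V) (f : ℕ → Prog V I O) : ℕ → Prog V I O
  | 0 => skip
  | m + 1 => ite (Expr.dist e (Expr.const m)) (switch e f m) (f m)

theorem sem_switch (x : List I) (Q : ℕ) (e : Expr V) (f : ℕ → Prog V I O) (m : ℕ)
    (s : Store V O) (h : e.eval s.reg x.length Q < m) :
    (switch e f m).sem x Q s = (f (e.eval s.reg x.length Q)).sem x Q s := by
  induction m with
  | zero => omega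
  | succ m ih =>
    rw [switch, sem]
    by_cases hm : e.eval s.reg x.length Q = m
    · rw [if_pos ((Expr.eval_dist_eq_zero _ _ _ _ _).2 hm), hm]
    · rw [if_neg fun h0 => hm ((Expr.eval_dist_eq_zero _ _ _ _ _).1 h0)]
      exact ih (by omega)

/-- Case distinction on a tuple of values. -/
def switchFin (m : ℕ) : (k : ℕ) → (Fin k → Expr V) → ((Fin k → ℕ) → Prog V I O) → Prog V I O
  | 0, _, f => f Fin.elim0
  | k + 1, e, f => switch (e 0) (fun a => switchFin m k (fun i => e i.succ) fun v =>
      f (Fin.cons a v)) m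

theorem sem_switchFin (x : List I) (Q m k : ℕ) (e : Fin k → Expr V)
    (f : (Fin k → ℕ) → Prog V I O) (s : Store V O)
    (h : ∀ i, (e i).eval s.reg x.length Q < m) :
    (switchFin m k e f).sem x Q s = (f fun i => (e i).eval s.reg x.length Q).sem x Q s := by
  induction k with
  | zero =>
    rw [switchFin]
    congr 2
    funext i
    exact i.elim0
  | succ k ih =>
    rw [switchFin, sem_switch _ _ _ _ _ _ (h 0), ih _ _ fun i => h i.succ]
    congr 2
    funext i
    refine Fin.cases ?_ (fun i => ?_) i <;> simp

/-- One program after the other. -/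
def seqs : List (Prog V I O) → Prog V I O
  | [] => skip
  | c :: l => seq c (seqs l)

end Prog

/-! ### Numbers that represent tapes -/

section Digits

variable {g S : ℕ}

theorem sum_digits_lt (d : ℕ → ℕ) (hd : ∀ j, d j < g) (S : ℕ) :
    ∑ j ∈ Finset.range S, d j * g ^ j < g ^ S := by
  induction S with
  | zero => simp
  | succ S ih =>
    rw [Finset.sum_range_succ, pow_succ]
    have h1 := hd S
    have h2 : (d S + 1) * g ^ S ≤ g * g ^ S := Nat.mul_le_mul_right _ h1
    rw [Nat.succ_mul] at h2
    rw [mul_comm (g ^ S) g]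
    omega

/-- How the scanned symbol is read off from the number of the tape and the weight `g ^ h` of the
head position. -/
theorem sum_digits_div_mod (d : ℕ → ℕ) (hd : ∀ j, d j < g) {h : ℕ} (hS : h < S) :
    (∑ j ∈ Finset.range S, d j * g ^ j) / g ^ h % g = d h := by
  have hg : 0 < g := (Nat.zero_le _).trans_lt (hd 0)
  obtain ⟨u, rfl⟩ : ∃ u, S = h + (u + 1) := ⟨S - h - 1, by omega⟩
  rw [Finset.sum_range_add, Finset.sum_range_succ']
  have : ∑ k ∈ Finset.range u, d (h + (k + 1)) * g ^ (h + (k + 1)) + d (h + 0) * g ^ (h + 0) =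
      g ^ h * (g * (∑ k ∈ Finset.range u, d (h + (k + 1)) * g ^ k) + d h) := by
    rw [mul_add, Finset.mul_sum, Finset.mul_sum, Nat.add_zero, mul_comm (d h)]
    congr 1
    refine Finset.sum_congr rfl fun k _ => ?_
    ring
  rw [this, Nat.add_mul_div_left _ _ (by positivity), Nat.div_eq_of_lt (sum_digits_lt d hd h),
    zero_add, Nat.mul_add_mod, Nat.mod_eq_of_lt (hd h)]

/-- How a symbol is written. The new digit is added before the old one is subtracted, so that the
truncated subtraction is exact. -/
theorem sum_digits_update (d : ℕ → ℕ) {h : ℕ} (hS : h < S) (v : ℕ) :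
    ∑ j ∈ Finset.range S, Function.update d h v j * g ^ j =
      ∑ j ∈ Finset.range S, d j * g ^ j + v * g ^ h - d h * g ^ h := by
  have hmem := Finset.mem_range.2 hS
  rw [← Finset.add_sum_erase _ _ hmem, ← Finset.add_sum_erase (a := h) (Finset.range S)
    (fun j => d j * g ^ j) hmem, Function.update_self]
  have : ∑ j ∈ (Finset.range S).erase h, Function.update d h v j * g ^ j =
      ∑ j ∈ (Finset.range S).erase h, d j * g ^ j :=
    Finset.sum_congr rfl fun j hj => by rw [Function.update_of_ne (Finset.ne_of_mem_erase hj)]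
  rw [this]
  omega

end Digits

/-! ### Simulating transducers by programs -/

/-- The registers that represent the configuration of a transducer with `k` tapes: the state and,
for each tape, the number of its content and the weight of the head position. -/
inductive SimReg (k : ℕ) where
  | st
  | num (i : Fin k)
  | wt (i : Fin k)
  deriving DecidableEq

instance {k : ℕ} : Finite (SimReg k) := by
  refine Finite.of_surjective (α := Option (Fin k ⊕ Fin k))
    (fun u => match u with
      | none => SimReg.st
      | some (Sum.inl i) => SimReg.num i
      | some (Sum.inr i) => SimReg.wt i) ?_
  rintro (_ | i | i)
  exacts [⟨none, rfl⟩, ⟨some (Sum.inl i), rfl⟩, ⟨some (Sum.inr i), rfl⟩]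

namespace Transducer

variable {I' O' : Type} (M : Transducer I' O')

/-- The number of states. -/
noncomputable def numStates : ℕ := Nat.card M.State

noncomputable def stCode (q : M.State) : ℕ :=
  have := M.finiteState
  (Finite.equivFin M.State q).val

noncomputable def stDecode (n : ℕ) : M.State :=
  have := M.finiteState
  if h : n < Nat.card M.State then (Finite.equivFin M.State).symm ⟨n, h⟩ else M.start

theorem stCode_lt (q : M.State) : M.stCode q < M.numStates := Fin.is_lt _

@[simp] theorem stDecode_stCode (q : M.State) : M.stDecode (M.stCode q) = q := by
  have := M.finiteState
  unfold stDecode stCode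
  simp

/-- The base of the numbers that represent tapes. -/
noncomputable def base : ℕ := Nat.card M.Sym + 1

-- The blank has code zero, so an empty tape is the number zero; the codes of the other symbols are
-- shifted by one, whence the base `Nat.card M.Sym + 1`.
open Classical in
noncomputable def symCode (a : M.Sym) : ℕ :=
  have := M.finiteSym
  if a = M.blank then 0 else (Finite.equivFin M.Sym a).val + 1

noncomputable def symDecode (n : ℕ) : M.Sym :=
  have := M.finiteSym
  match n with
  | 0 => M.blank
  | n + 1 => if h : n < Nat.card M.Sym then (Finite.equivFin M.Sym).symm ⟨n, h⟩ else M.blank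

theorem symCode_lt (a : M.Sym) : M.symCode a < M.base := by
  have := M.finiteSym
  unfold symCode base
  split_ifs
  · exact Nat.succ_pos _
  · exact Nat.succ_lt_succ (Fin.is_lt _)

@[simp] theorem symDecode_symCode (a : M.Sym) : M.symDecode (M.symCode a) = a := by
  have := M.finiteSym
  unfold symDecode symCode
  by_cases h : a = M.blank
  · simp [h]
  · simp [h]

@[simp] theorem symCode_blank : M.symCode M.blank = 0 := by simp [symCode]

theorem two_le_base : 2 ≤ M.base := by
  have := M.finiteSym
  have : 0 < Nat.card M.Sym := Nat.card_pos_iff.2 ⟨⟨M.blank⟩, M.finiteSym⟩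
  unfold base
  omega

/-- From `c`, the work heads stay below `S`. -/
def Safe (x : List I') (S : ℕ) (c : M.Config) : Prop :=
  ∀ r t i, (iter (fun c b => M.step x b c) r t c).head i < S

variable {M}

theorem Safe.head_lt {x : List I'} {S : ℕ} {c : M.Config} (h : M.Safe x S c)
    (i : Fin M.tapes) : c.head i < S := h (fun _ => true) 0 i

theorem Safe.step {x : List I'} {S : ℕ} {c : M.Config} (h : M.Safe x S c) (b : Bool) :
    M.Safe x S (M.step x b c) := fun r t i => by
  have := h (consCoin b r) (t + 1) i
  rw [iter_succ] at this
  exact this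

/-- The number that represents tape `i` up to cell `S`. -/
noncomputable def tapeNum (S : ℕ) (c : M.Config) (i : Fin M.tapes) : ℕ :=
  ∑ j ∈ Finset.range S, M.symCode (c.tape i j) * M.base ^ j

theorem tapeNum_lt (S : ℕ) (c : M.Config) (i : Fin M.tapes) : tapeNum S c i < M.base ^ S :=
  sum_digits_lt (fun j => M.symCode (c.tape i j)) (fun _ => M.symCode_lt _) S

variable {V I O : Type}

/-- The registers `emb` represent the configuration `c`. -/
structure Rep (emb : SimReg M.tapes → V) (S : ℕ) (c : M.Config) (r : V → ℕ) : Prop where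
  st : r (emb SimReg.st) = M.stCode c.state
  num : ∀ i, r (emb (SimReg.num i)) = tapeNum S c i
  wt : ∀ i, r (emb (SimReg.wt i)) = M.base ^ c.head i

/-- The weight of the position after a movement. -/
def wtExpr (g : ℕ) (e : Expr V) : Move → Expr V
  | Move.left => Expr.add (Expr.div e (Expr.const g))
      (Expr.sub (Expr.const 1) (Expr.div e (Expr.const g)))
  | Move.stay => e
  | Move.right => Expr.mul e (Expr.const g)

/-- For a move to the left from cell `0` the quotient `1 / g` is zero, and the summand `1 -
quotient` restores the weight 1. In all other cases this summand vanishes. -/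
theorem eval_wtExpr {g : ℕ} (hg : 2 ≤ g) {e : Expr V} {r : V → ℕ} {n Q h : ℕ}
    (he : e.eval r n Q = g ^ h) (m : Move) : (wtExpr g e m).eval r n Q = g ^ moveWork h m := by
  cases m with
  | left =>
    simp only [wtExpr, Expr.eval, he, moveWork]
    cases h with
    | zero => rw [pow_zero, Nat.div_eq_of_lt (by omega)]; simp
    | succ h =>
      rw [pow_succ, Nat.mul_div_cancel _ (by omega), Nat.add_sub_cancel]
      have : 1 ≤ g ^ h := Nat.one_le_pow _ _ (by omega)
      omega
  | stay => exact he
  | right => simp only [wtExpr, Expr.eval, he, moveWork, pow_succ]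

/-- Write on tape `i` and move its head. -/
noncomputable def tapeProg (emb : SimReg M.tapes → V) (old new : M.Sym) (m : Move)
    (i : Fin M.tapes) : Prog V I O :=
  Prog.seq
    (Prog.assign (emb (SimReg.num i)) (Expr.sub
      (Expr.add (Expr.var (emb (SimReg.num i)))
        (Expr.mul (Expr.const (M.symCode new)) (Expr.var (emb (SimReg.wt i)))))
      (Expr.mul (Expr.const (M.symCode old)) (Expr.var (emb (SimReg.wt i))))))
    (Prog.assign (emb (SimReg.wt i)) (wtExpr M.base (Expr.var (emb (SimReg.wt i))) m))

variable (M) in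
/-- One step of `M` in a state that is not halting. The input of `M` is accessed by `read` and
`mv`, and `em` deals with the output. -/
noncomputable def actProg (emb : SimReg M.tapes → V) (mv : Move → Prog V I O)
    (em : O' → Prog V I O) (a : Action M.State M.Sym O' M.tapes) (old : Fin M.tapes → M.Sym) :
    Prog V I O :=
  Prog.seq (Prog.seqs ((List.finRange M.tapes).map fun i =>
      tapeProg emb (old i) (a.write i) (a.moveW i) i))
    (Prog.seq (Prog.assign (emb SimReg.st) (Expr.const (M.stCode a.next)))
      (Prog.seq (mv a.moveI) (match a.emit with
        | none => Prog.skip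
        | some o => em o)))

-- In a halting state a toss is consumed and nothing happens, so that each execution matches exactly
-- one application of `Transducer.step`, toss for toss.
open Classical in
variable (M) in
noncomputable def simStep (emb : SimReg M.tapes → V)
    (read : (InSym I' → Prog V I O) → Prog V I O) (mv : Move → Prog V I O)
    (em : O' → Prog V I O) : Prog V I O :=
  Prog.switch (Expr.var (emb SimReg.st)) (fun q =>
    if M.halt (M.stDecode q) then Prog.flip fun _ => Prog.skip
    else Prog.switchFin M.base M.tapes
      (fun i => Expr.mod (Expr.div (Expr.var (emb (SimReg.num i))) (Expr.var (emb (SimReg.wt i))))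
        (Expr.const M.base))
      fun v => read fun a => Prog.flip fun b =>
        actProg M emb mv em (M.δ (M.stDecode q) a (fun i => M.symDecode (v i)) b)
          fun i => M.symDecode (v i)) M.numStates

variable [DecidableEq V]

/-- The caps do not interfere: the new number still has `S` digits and the new head position is
below `S`, so both results are at most `M.base ^ S ≤ Q`. -/
theorem sem_tapeProg {emb : SimReg M.tapes → V} (hemb : Function.Injective emb) {S Q : ℕ}
    (hQ : M.base ^ S ≤ Q) (x : List I) (s : Store V O) (i : Fin M.tapes) {tape : ℕ → M.Sym}
    {h : ℕ} (hh : h < S) (new : M.Sym) (m : Move) (hm : moveWork h m < S)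
    (hnum : s.reg (emb (SimReg.num i)) =
      ∑ j ∈ Finset.range S, M.symCode (tape j) * M.base ^ j)
    (hwt : s.reg (emb (SimReg.wt i)) = M.base ^ h) :
    (tapeProg emb (tape h) new m i).sem x Q s = Tree.leaf
      ((s.set (emb (SimReg.num i)) (∑ j ∈ Finset.range S,
        M.symCode (Function.update tape h new j) * M.base ^ j)).set
          (emb (SimReg.wt i)) (M.base ^ moveWork h m)) := by
  have hg := M.two_le_base
  have hne : emb (SimReg.wt i) ≠ emb (SimReg.num i) := hemb.ne (by simp)
  have hsum : ∑ j ∈ Finset.range S, M.symCode (Function.update tape h new j) * M.base ^ j =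
      ∑ j ∈ Finset.range S, M.symCode (tape j) * M.base ^ j + M.symCode new * M.base ^ h -
        M.symCode (tape h) * M.base ^ h := by
    rw [← sum_digits_update (fun j => M.symCode (tape j)) hh (M.symCode new)]
    refine Finset.sum_congr rfl fun j _ => ?_
    rw [Function.update_apply, Function.update_apply]
    split_ifs <;> rfl
  have hlt : ∑ j ∈ Finset.range S, M.symCode (Function.update tape h new j) * M.base ^ j <
      M.base ^ S :=
    sum_digits_lt (fun j => M.symCode (Function.update tape h new j)) (fun _ => M.symCode_lt _) S
  have hpow : M.base ^ moveWork h m ≤ M.base ^ S := Nat.pow_le_pow_right (by omega) hm.le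
  rw [tapeProg, Prog.sem, Prog.sem, Tree.leaf_bind, Prog.sem]
  have e1 : (Expr.sub
      (Expr.add (Expr.var (emb (SimReg.num i)))
        (Expr.mul (Expr.const (M.symCode new)) (Expr.var (emb (SimReg.wt i)))))
      (Expr.mul (Expr.const (M.symCode (tape h))) (Expr.var (emb (SimReg.wt i))))).eval s.reg
      x.length Q = ∑ j ∈ Finset.range S,
        M.symCode (Function.update tape h new j) * M.base ^ j := by
    simp only [Expr.eval]
    rw [hsum, hnum, hwt]
  rw [e1, min_eq_left (hlt.le.trans hQ), eval_wtExpr hg (h := h)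
    (by simp only [Expr.eval, Store.reg_set, hne, if_false, hwt]),
    min_eq_left (hpow.trans hQ)]

theorem sem_tapeProgs {emb : SimReg M.tapes → V} (hemb : Function.Injective emb) {S Q : ℕ}
    (hQ : M.base ^ S ≤ Q) (x : List I) (c : M.Config) (hc : ∀ i, c.head i < S)
    (new : Fin M.tapes → M.Sym) (m : Fin M.tapes → Move)
    (hm : ∀ i, moveWork (c.head i) (m i) < S) (l : List (Fin M.tapes)) (hl : l.Nodup)
    (s : Store V O) (hnum : ∀ i ∈ l, s.reg (emb (SimReg.num i)) = tapeNum S c i)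
    (hwt : ∀ i ∈ l, s.reg (emb (SimReg.wt i)) = M.base ^ c.head i) :
    ∃ s' : Store V O, (Prog.seqs (l.map fun i =>
        tapeProg emb (c.tape i (c.head i)) (new i) (m i) i)).sem x Q s = Tree.leaf s' ∧
      (∀ i ∈ l, s'.reg (emb (SimReg.num i)) = ∑ j ∈ Finset.range S,
        M.symCode (Function.update (c.tape i) (c.head i) (new i) j) * M.base ^ j) ∧
      (∀ i ∈ l, s'.reg (emb (SimReg.wt i)) = M.base ^ moveWork (c.head i) (m i)) ∧
      (∀ v, (∀ i ∈ l, v ≠ emb (SimReg.num i) ∧ v ≠ emb (SimReg.wt i)) → s'.reg v = s.reg v) ∧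
      s'.pos = s.pos ∧ s'.out = s.out := by
  induction l generalizing s with
  | nil => exact ⟨s, rfl, by simp, by simp, fun _ _ => rfl, rfl, rfl⟩
  | cons i l ih =>
    have hil := (List.nodup_cons.1 hl).1
    have hne : ∀ i' ∈ l, i' ≠ i := fun i' hi' h => hil (h ▸ hi')
    obtain ⟨s', h1, h2, h3, h4, h5, h6⟩ := ih (List.nodup_cons.1 hl).2
      ((s.set (emb (SimReg.num i)) (∑ j ∈ Finset.range S,
        M.symCode (Function.update (c.tape i) (c.head i) (new i) j) * M.base ^ j)).set
          (emb (SimReg.wt i)) (M.base ^ moveWork (c.head i) (m i)))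
      (fun i' hi' => by
        rw [Store.reg_set, if_neg (hemb.ne (by simp)), Store.reg_set,
          if_neg (hemb.ne (by simpa using hne i' hi')), hnum i' (List.mem_cons_of_mem _ hi')])
      (fun i' hi' => by
        rw [Store.reg_set, if_neg (hemb.ne (by simpa using hne i' hi')), Store.reg_set,
          if_neg (hemb.ne (by simp)), hwt i' (List.mem_cons_of_mem _ hi')])
    have hother : ∀ v, (∀ i' ∈ l, v ≠ emb (SimReg.num i') ∧ v ≠ emb (SimReg.wt i')) →
        v = emb (SimReg.num i) ∨ v = emb (SimReg.wt i) ∨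
          (v ≠ emb (SimReg.num i) ∧ v ≠ emb (SimReg.wt i)) := fun v _ => by tauto
    refine ⟨s', ?_, ?_, ?_, ?_, h5, h6⟩
    · rw [List.map_cons, Prog.seqs, Prog.sem, sem_tapeProg hemb hQ x s i (hc i) (new i) (m i)
        (hm i) (hnum i List.mem_cons_self) (hwt i List.mem_cons_self), Tree.leaf_bind, h1]
    · intro i' hi'
      rcases List.mem_cons.1 hi' with rfl | hi'
      · rw [h4 _ fun j hj => ⟨hemb.ne (by simpa using (hne j hj).symm), hemb.ne (by simp)⟩,
          Store.reg_set, if_neg (hemb.ne (by simp)), Store.reg_set, if_pos rfl]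
      · exact h2 i' hi'
    · intro i' hi'
      rcases List.mem_cons.1 hi' with rfl | hi'
      · rw [h4 _ fun j hj => ⟨hemb.ne (by simp), hemb.ne (by simpa using (hne j hj).symm)⟩,
          Store.reg_set, if_pos rfl]
      · exact h3 i' hi'
    · intro v hv
      rw [h4 v fun j hj => hv j (List.mem_cons_of_mem _ hj), Store.reg_set,
        if_neg (hv i List.mem_cons_self).2, Store.reg_set, if_neg (hv i List.mem_cons_self).1]

/-- What a step of the simulation does after updating the registers. -/
def after (mv : Move → Prog V I O) (em : O' → Prog V I O)
    (a : Action M.State M.Sym O' M.tapes) : Prog V I O :=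
  Prog.seq (mv a.moveI) (match a.emit with
        | none => Prog.skip
        | some o => em o)

/-- The action of `M` in the configuration `c`. -/
def action (M : Transducer I' O') (x' : List I') (c : M.Config) (b : Bool) :
    Action M.State M.Sym O' M.tapes :=
  M.δ c.state (inputSymbol x' c.inputHead) (fun i => c.tape i (c.head i)) b

theorem step_of_not_halt {x' : List I'} {c : M.Config} (h : ¬M.halt c.state) (b : Bool) :
    M.step x' b c =
      { state := (action M x' c b).next
        inputHead := moveInput x'.length c.inputHead (action M x' c b).moveI
        head := fun i => moveWork (c.head i) ((action M x' c b).moveW i)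
        tape := fun i => Function.update (c.tape i) (c.head i) ((action M x' c b).write i)
        output := c.output ++ (action M x' c b).emit.toList } := by
  rw [step, if_neg h]
  rfl

theorem sem_actProg {emb : SimReg M.tapes → V} (hemb : Function.Injective emb) {S Q : ℕ}
    (hQ : M.base ^ S ≤ Q) (hQ' : M.numStates ≤ Q) (x : List I) (x' : List I') {c : M.Config}
    {s : Store V O} (hrep : Rep emb S c s.reg) (hc : M.Safe x' S c) (hh : ¬M.halt c.state)
    (mv : Move → Prog V I O) (em : O' → Prog V I O) (b : Bool) :
    ∃ u : Store V O, (actProg M emb mv em (action M x' c b)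
        fun i => c.tape i (c.head i)).sem x Q s = (after mv em (action M x' c b)).sem x Q u ∧
      Rep emb S (M.step x' b c) u.reg ∧ (∀ v, (∀ i, v ≠ emb i) → u.reg v = s.reg v) ∧
      u.pos = s.pos ∧ u.out = s.out := by
  have hstep := step_of_not_halt (x' := x') hh b
  obtain ⟨s', h1, h2, h3, h4, h5, h6⟩ := sem_tapeProgs hemb hQ x c hc.head_lt
    (action M x' c b).write (action M x' c b).moveW
    -- The bound for the moved heads is the safety of the next configuration.
    (fun i => by have := (hc.step b).head_lt i; rwa [hstep] at this) (List.finRange M.tapes)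
    (List.nodup_finRange _) s (fun i _ => hrep.num i) (fun i _ => hrep.wt i)
  refine ⟨s'.set (emb SimReg.st) (M.stCode (action M x' c b).next), ?_, ⟨?_, ?_, ?_⟩, ?_, h5, h6⟩
  · rw [actProg, Prog.sem, h1, Tree.leaf_bind, Prog.sem, Prog.sem, Tree.leaf_bind]
    rw [show (Expr.const (M.stCode (action M x' c b).next) : Expr V).eval s'.reg x.length Q =
      M.stCode (action M x' c b).next from rfl, min_eq_left ((M.stCode_lt _).le.trans hQ')]
    rfl
  · rw [Store.reg_set, if_pos rfl, hstep]
  · intro i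
    rw [Store.reg_set, if_neg (hemb.ne (by simp)), h2 i (List.mem_finRange i), hstep]
    rfl
  · intro i
    rw [Store.reg_set, if_neg (hemb.ne (by simp)), h3 i (List.mem_finRange i), hstep]
  · intro v hv
    rw [Store.reg_set, if_neg (hv _), h4 v fun i _ => ⟨hv _, hv _⟩]

theorem sem_simStep {emb : SimReg M.tapes → V} (hemb : Function.Injective emb) {S Q : ℕ}
    (hQ : M.base ^ S ≤ Q) (hQ' : M.numStates ≤ Q) (x : List I) (x' : List I') {c : M.Config}
    {s : Store V O} (hrep : Rep emb S c s.reg) (hc : M.Safe x' S c)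
    (read : (InSym I' → Prog V I O) → Prog V I O) (mv : Move → Prog V I O)
    (em : O' → Prog V I O)
    (hread : ∀ f, (read f).sem x Q s = (f (inputSymbol x' c.inputHead)).sem x Q s) :
    ∃ T : Bool → Tree (Store V O), (simStep M emb read mv em).sem x Q s = Tree.node T ∧
      (M.halt c.state → ∀ b, T b = Tree.leaf s) ∧
      (¬M.halt c.state → ∀ b, ∃ u : Store V O,
        T b = (after mv em (action M x' c b)).sem x Q u ∧
        Rep emb S (M.step x' b c) u.reg ∧ (∀ v, (∀ i, v ≠ emb i) → u.reg v = s.reg v) ∧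
        u.pos = s.pos ∧ u.out = s.out) := by
  have hst : (Expr.var (emb SimReg.st) : Expr V).eval s.reg x.length Q = M.stCode c.state :=
    hrep.st
  rw [simStep, Prog.sem_switch _ _ _ _ _ _ (by rw [hst]; exact M.stCode_lt _), hst,
    stDecode_stCode]
  by_cases hh : M.halt c.state
  · rw [if_pos hh]
    exact ⟨fun _ => Tree.leaf s, rfl, fun _ _ => rfl, fun h => absurd hh h⟩
  · have hsym : ∀ i, (Expr.mod (Expr.div (Expr.var (emb (SimReg.num i)))
        (Expr.var (emb (SimReg.wt i)))) (Expr.const M.base)).eval s.reg x.length Q =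
        M.symCode (c.tape i (c.head i)) := by
      intro i
      rw [Expr.eval_mod]
      simp only [Expr.eval, hrep.num, hrep.wt]
      exact sum_digits_div_mod (fun j => M.symCode (c.tape i j)) (fun _ => M.symCode_lt _)
        (hc.head_lt i)
    rw [if_neg hh, Prog.sem_switchFin _ _ _ _ _ _ _ fun i => by
      rw [hsym]; exact M.symCode_lt _]
    simp only [hsym, symDecode_symCode]
    rw [hread, Prog.sem]
    exact ⟨_, rfl, fun h => absurd h hh, fun _ b =>
      sem_actProg hemb hQ hQ' x x' hrep hc hh mv em b⟩

end Transducer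

/-! ### Bounds for the simulation, and its initialization -/

theorem Tree.ev_nonneg {α : Type} (T : Tree α) {φ : α → ℝ} (h : ∀ a, 0 ≤ φ a) : 0 ≤ T.ev φ := by
  have := T.ev_mono h
  rwa [Tree.ev_const] at this

theorem Tree.ev_le_one {α : Type} (T : Tree α) {φ : α → ℝ} (h : ∀ a, φ a ≤ 1) : T.ev φ ≤ 1 := by
  have := T.ev_mono h
  rwa [Tree.ev_const] at this

theorem two_pow_log_le (n : ℕ) : 2 ^ Nat.log 2 n ≤ n + 2 := by
  by_cases hn : n = 0
  · simp [hn]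
  · exact (Nat.pow_log_le_self 2 hn).trans (by omega)

theorem two_pow_log_succ_le (n : ℕ) : 2 ^ (Nat.log 2 n + 1) ≤ (n + 2) ^ 2 := by
  rw [pow_succ, pow_two]
  exact Nat.mul_le_mul (two_pow_log_le n) (by omega)

/-- Exponentials of multiples of the logarithm are polynomial. -/
theorem pow_log_le (g c n : ℕ) : g ^ (c * (Nat.log 2 n + 1)) ≤ (n + 2) ^ (2 * g * c) := by
  calc g ^ (c * (Nat.log 2 n + 1)) ≤ (2 ^ g) ^ (c * (Nat.log 2 n + 1)) :=
        Nat.pow_le_pow_left Nat.lt_two_pow_self.le _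
    _ = (2 ^ (Nat.log 2 n + 1)) ^ (g * c) := by rw [← pow_mul, ← pow_mul]; ring_nf
    _ ≤ ((n + 2) ^ 2) ^ (g * c) := Nat.pow_le_pow_left (two_pow_log_succ_le n) _
    _ = (n + 2) ^ (2 * g * c) := by rw [← pow_mul, mul_assoc]

theorem pow_mono_exp (n : ℕ) {d d' : ℕ} (h : d ≤ d') : (n + 2) ^ d ≤ (n + 2) ^ d' :=
  Nat.pow_le_pow_right (by omega) h

theorem const_le_pow (n c : ℕ) : c ≤ (n + 2) ^ c :=
  Nat.lt_two_pow_self.le.trans (Nat.pow_le_pow_left (by omega) c)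

namespace Transducer

variable {I' O' : Type} {M : Transducer I' O'}

/-- The quantities needed for the simulation of `M` on `x` with cap `Q`. -/
structure Fits (M : Transducer I' O') (x : List I') (S Q : ℕ) : Prop where
  safe : M.Safe x S M.init
  base_le : M.base ^ S ≤ Q
  states_le : M.numStates ≤ Q
  halts : ∀ r, M.halt (M.run x r Q).state

theorem Fits.mono {x : List I'} {S Q Q' : ℕ} (h : M.Fits x S Q) (hQ : Q ≤ Q') :
    M.Fits x S Q' where
  safe := h.safe
  base_le := h.base_le.trans hQ
  states_le := h.states_le.trans hQ
  halts r := by rw [M.run_eq_of_halt x r hQ (h.halts r)]; exact h.halts r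

/-- Here logarithmic space is used: a tape with `S = c * (log n + 1)` cells is a number below
`M.base ^ S`, which is polynomial in `n`. The exponent `d` also covers the running time and the
number of states. -/
theorem IsLogSpace.exists_fits (h : M.IsLogSpace) :
    ∃ d, ∀ x, ∃ S, M.Fits x S ((x.length + 2) ^ d) := by
  obtain ⟨⟨p, hp⟩, c, hc⟩ := h
  obtain ⟨e, he⟩ := exists_eval_le_pow p
  refine ⟨2 * M.base * c + e + M.numStates, fun x => ⟨c * (Nat.log 2 x.length + 1), ?_, ?_, ?_,
    fun r => ?_⟩⟩
  · intro r t i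
    have := hc x r t i
    rwa [run_eq_iter] at this
  · exact (pow_log_le _ _ _).trans (pow_mono_exp _ (by omega))
  · exact (const_le_pow _ _).trans (pow_mono_exp _ (by omega))
  · rw [M.run_eq_of_halt x r ((he x.length).trans (pow_mono_exp _ (by omega))) (hp x r)]
    exact hp x r

theorem output_length_run (x : List I') (r : ℕ → Bool) (t : ℕ) :
    (M.run x r t).output.length ≤ t := by
  induction t with
  | zero => simp [run, init]
  | succ t ih =>
    rw [run, step]
    split_ifs
    · omega
    · simp only [List.length_append]
      generalize (M.δ _ _ _ _).emit = o
      cases o <;> simp <;> omega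

theorem length_le_of_outputs {x : List I'} {r : ℕ → Bool} {w : List O'} {Q : ℕ}
    (hQ : M.halt (M.run x r Q).state) (h : M.Outputs x r w) : w.length ≤ Q := by
  rw [M.outputs_iff x r hQ] at h
  rw [← h]
  exact output_length_run x r Q

theorem iterTree_halt (x : List I') {Q : ℕ} (h : ∀ r, M.halt (M.run x r Q).state) :
    (iterTree (fun c b => M.step x b c) Q M.init).All fun c => M.halt c.state := by
  refine iterTree_all _ _ _ _ fun r => ?_
  rw [← run_eq_iter]
  exact h r

variable {V I O : Type} [DecidableEq V]

/-- Represent the initial configuration. -/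
noncomputable def initProg (M : Transducer I' O') (emb : SimReg M.tapes → V) : Prog V I O :=
  Prog.seq (Prog.assign (emb SimReg.st) (Expr.const (M.stCode M.start)))
    (Prog.seqs ((List.finRange M.tapes).map fun i =>
      Prog.seq (Prog.assign (emb (SimReg.num i)) (Expr.const 0))
        (Prog.assign (emb (SimReg.wt i)) (Expr.const 1))))

/-- The disjunctions let the induction on `l` remember the tapes that are initialized already. -/
theorem sem_initTapes {emb : SimReg M.tapes → V} (hemb : Function.Injective emb) {Q : ℕ}
    (hQ : 1 ≤ Q) (x : List I) (l : List (Fin M.tapes)) (s : Store V O) :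
    ∃ s' : Store V O, (Prog.seqs (l.map fun i =>
      Prog.seq (Prog.assign (emb (SimReg.num i)) (Expr.const 0))
        (Prog.assign (emb (SimReg.wt i)) (Expr.const 1)))).sem x Q s = Tree.leaf s' ∧
      (∀ i, (i ∈ l ∨ s.reg (emb (SimReg.num i)) = 0) → s'.reg (emb (SimReg.num i)) = 0) ∧
      (∀ i, (i ∈ l ∨ s.reg (emb (SimReg.wt i)) = 1) → s'.reg (emb (SimReg.wt i)) = 1) ∧
      (∀ v, (∀ i, v ≠ emb (SimReg.num i) ∧ v ≠ emb (SimReg.wt i)) → s'.reg v = s.reg v) ∧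
      s'.pos = s.pos ∧ s'.out = s.out := by
  induction l generalizing s with
  | nil => exact ⟨s, rfl, by simp, by simp, fun _ _ => rfl, rfl, rfl⟩
  | cons i l ih =>
    obtain ⟨s', h1, h2, h3, h4, h5, h6⟩ := ih
      ((s.set (emb (SimReg.num i)) 0).set (emb (SimReg.wt i)) 1)
    refine ⟨s', ?_, fun i' hi' => h2 i' ?_, fun i' hi' => h3 i' ?_, fun v hv => ?_, h5, h6⟩
    · rw [List.map_cons, Prog.seqs, Prog.sem, Prog.sem, Prog.sem, Tree.leaf_bind, Prog.sem,
        Tree.leaf_bind]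
      simp only [Expr.eval, Nat.zero_min, min_eq_left hQ]
      exact h1
    · rw [Store.reg_set, if_neg (hemb.ne (by simp)), Store.reg_set]
      split_ifs with h
      · exact Or.inr rfl
      · have : i' ≠ i := fun h' => h (by rw [h'])
        simpa [this] using hi'
    · rw [Store.reg_set]
      split_ifs with h
      · exact Or.inr rfl
      · have : i' ≠ i := fun h' => h (by rw [h'])
        rw [Store.reg_set, if_neg (hemb.ne (by simp))]
        simpa [this] using hi'
    · rw [h4 v hv, Store.reg_set, if_neg (hv i).2, Store.reg_set, if_neg (hv i).1]

theorem sem_initProg {emb : SimReg M.tapes → V} (hemb : Function.Injective emb) {S Q : ℕ}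
    {x' : List I'} (hQ : M.Fits x' S Q) (x : List I) (s : Store V O) :
    ∃ s' : Store V O, (initProg M emb).sem x Q s = Tree.leaf s' ∧ Rep emb S M.init s'.reg ∧
      (∀ v, (∀ i, v ≠ emb i) → s'.reg v = s.reg v) ∧ s'.pos = s.pos ∧ s'.out = s.out := by
  have h1Q : 1 ≤ Q := (Nat.one_le_pow _ _ (by have := M.two_le_base; omega)).trans hQ.base_le
  obtain ⟨s', h1, h2, h3, h4, h5, h6⟩ := sem_initTapes hemb h1Q x (List.finRange M.tapes)
    (s.set (emb SimReg.st) (M.stCode M.start))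
  refine ⟨s', ?_, ⟨?_, fun i => ?_, fun i => ?_⟩, fun v hv => ?_, h5, h6⟩
  · rw [initProg, Prog.sem, Prog.sem, Tree.leaf_bind]
    simp only [Expr.eval, min_eq_left ((M.stCode_lt _).le.trans hQ.states_le)]
    exact h1
  · rw [h4 _ fun i => ⟨hemb.ne (by simp), hemb.ne (by simp)⟩, Store.reg_set, if_pos rfl]
    rfl
  · rw [h2 i (Or.inl (List.mem_finRange i))]
    simp [tapeNum, init]
  · rw [h3 i (Or.inl (List.mem_finRange i))]
    simp [init]
  · rw [h4 v fun i => ⟨hv _, hv _⟩, Store.reg_set, if_neg (hv _)]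

end Transducer

/-- Comparing a loop with a random process that it simulates. -/
theorem ev_iterTree_le_iterate {C α : Type} {f : C → Bool → C} (Inv : C → α → Prop)
    {k : α → Tree α}
    (hstep : ∀ c s, Inv c s → ∃ σ : Bool → α,
      k s = Tree.node (fun b => Tree.leaf (σ b)) ∧ ∀ b, Inv (f c b) (σ b))
    {ψ : C → ℝ} {φ : α → ℝ} (m : ℕ) {c : C} {s : α}
    (hcs : Inv c s) (hle : (iterTree f m c).All fun c => ∀ s, Inv c s → ψ c ≤ φ s) :
    (iterTree f m c).ev ψ ≤ (Tree.iterate k m s).ev φ := by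
  induction m generalizing c s with
  | zero => exact hle s hcs
  | succ m ih =>
    obtain ⟨σ, h1, h2⟩ := hstep c s hcs
    have ht := ih (h2 true) (hle true)
    have hf := ih (h2 false) (hle false)
    rw [iterTree, Tree.iterate, h1]
    simp only [Tree.ev_node, Tree.node_bind, Tree.leaf_bind]
    linarith

/-! ### Words as numbers -/

/-- The number of a word, least significant digit first, with a leading one. -/
def wordNum : List Bool → ℕ
  | [] => 1
  | b :: l => b.toNat + 2 * wordNum l

/-- The leading one moves up by one place and `b` takes its place, so the number grows by `(1 + b) *
2 ^ l.length`. A word is stored symbol by symbol in this way, with a second register for the power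
of two. -/
theorem wordNum_append (l : List Bool) (b : Bool) :
    wordNum (l ++ [b]) = wordNum l + 2 ^ l.length + b.toNat * 2 ^ l.length := by
  induction l with
  | nil => cases b <;> rfl
  | cons a l ih =>
    simp only [List.cons_append, wordNum, ih, List.length_cons, pow_succ]
    ring

theorem wordNum_pos (l : List Bool) : 1 ≤ wordNum l := by
  induction l with
  | nil => exact le_rfl
  | cons a l ih => simp only [wordNum]; omega

theorem wordNum_lt (l : List Bool) : wordNum l < 2 ^ (l.length + 1) := by
  induction l with
  | nil => simp [wordNum]
  | cons a l ih =>
    simp only [wordNum, List.length_cons]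
    rw [pow_succ]
    cases a
    · simp only [Bool.toNat_false]; omega
    · simp only [Bool.toNat_true]; omega

theorem wordNum_div_pow (l : List Bool) (e : ℕ) (he : e ≤ l.length) :
    wordNum l / 2 ^ e = wordNum (l.drop e) := by
  induction e generalizing l with
  | zero => simp
  | succ e ih =>
    cases l with
    | nil => simp at he
    | cons a l =>
      rw [List.drop_succ_cons, ← ih l (by simpa using he), pow_succ, mul_comm,
        ← Nat.div_div_eq_div_mul]
      congr 1
      simp only [wordNum]
      cases a <;> (simp; try omega)

/-- Together with `wordNum_div_length` this shows how the end of a word is recognized: the quotient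
is at least 2 inside the word and equals 1 at its end. -/
theorem wordNum_digit (l : List Bool) {e : ℕ} (he : e < l.length) :
    2 ≤ wordNum l / 2 ^ e ∧ wordNum l / 2 ^ e % 2 = l[e].toNat := by
  rw [wordNum_div_pow l e he.le, List.drop_eq_getElem_cons he, wordNum]
  have := wordNum_pos (l.drop (e + 1))
  cases l[e] <;> simp <;> omega

theorem wordNum_div_length (l : List Bool) : wordNum l / 2 ^ l.length = 1 := by
  rw [wordNum_div_pow l _ le_rfl, List.drop_length]
  rfl


/-! ### Rules for evaluating programs -/

namespace Prog

variable {V I O : Type} [DecidableEq V]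

theorem sem_seq_of_leaf {x : List I} {Q : ℕ} {c c' : Prog V I O} {s s' : Store V O}
    (h : c.sem x Q s = Tree.leaf s') : (seq c c').sem x Q s = c'.sem x Q s' := by
  rw [sem, h, Tree.leaf_bind]

theorem sem_assign_of_le {x : List I} {Q : ℕ} {v : V} {e : Expr V} {s : Store V O}
    (h : e.eval s.reg x.length Q ≤ Q) :
    (assign v e : Prog V I O).sem x Q s = Tree.leaf (s.set v (e.eval s.reg x.length Q)) := by
  rw [sem, min_eq_left h]

theorem sem_ite_of_eq {x : List I} {Q : ℕ} {e : Expr V} {c c' : Prog V I O} {s : Store V O}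
    (h : e.eval s.reg x.length Q = 0) : (ite e c c').sem x Q s = c'.sem x Q s := if_pos h

theorem sem_ite_of_ne {x : List I} {Q : ℕ} {e : Expr V} {c c' : Prog V I O} {s : Store V O}
    (h : e.eval s.reg x.length Q ≠ 0) : (ite e c c').sem x Q s = c.sem x Q s := if_neg h

theorem ev_seq (x : List I) (Q : ℕ) (c c' : Prog V I O) (s : Store V O) (φ : Store V O → ℝ) :
    ((seq c c').sem x Q s).ev φ = (c.sem x Q s).ev fun s' => (c'.sem x Q s').ev φ := by
  rw [sem, Tree.ev_bind]

/-- Move the input head to the left end. -/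
def rewind : Prog V I O := loop (Expr.add Expr.len (Expr.const 1)) (move Move.left)

theorem iterate_move_left (x : List I) (Q m : ℕ) (s : Store V O) :
    Tree.iterate ((move Move.left : Prog V I O).sem x Q) m s =
      Tree.leaf ⟨s.reg, s.pos - m, s.out⟩ := by
  induction m generalizing s with
  | zero => rfl
  | succ m ih =>
    rw [Tree.iterate, sem, Tree.leaf_bind, ih]
    simp only [moveInput, Nat.sub_sub, Nat.add_comm]

theorem sem_rewind (x : List I) (Q : ℕ) (s : Store V O) (h : s.pos ≤ x.length + 1) :
    (rewind : Prog V I O).sem x Q s = Tree.leaf ⟨s.reg, 0, s.out⟩ := by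
  rw [rewind, sem, iterate_move_left]
  simp only [Expr.eval, Nat.sub_eq_zero_of_le h]

end Prog

/-! ### Amplification: from short hints to two copies -/

/-- The registers of the amplified algorithm: configurations of `A` and `B`, the hint `t`, with
the power of two `pt` for its length, the position `p` in the hint, the index `i` of the bit that
is computed, the number `j` of bits output so far by `B`, the numbers of votes, the present vote,
and a flag for the end. -/
inductive VoteReg (k l : ℕ) where
  | a (r : SimReg k)
  | b (r : SimReg l)
  | t
  | pt
  | p
  | i
  | j
  | c1
  | c0
  | vote
  | fin
  deriving DecidableEq

instance {k l : ℕ} : Finite (VoteReg k l) := by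
  refine Finite.of_surjective (α := (SimReg k ⊕ SimReg l) ⊕ Fin 9)
    (fun u => match u with
      | Sum.inl (Sum.inl r) => VoteReg.a r
      | Sum.inl (Sum.inr r) => VoteReg.b r
      | Sum.inr 0 => VoteReg.t
      | Sum.inr 1 => VoteReg.pt
      | Sum.inr 2 => VoteReg.p
      | Sum.inr 3 => VoteReg.i
      | Sum.inr 4 => VoteReg.j
      | Sum.inr 5 => VoteReg.c1
      | Sum.inr 6 => VoteReg.c0
      | Sum.inr 7 => VoteReg.vote
      | Sum.inr 8 => VoteReg.fin) ?_
  rintro (r | r | _ | _ | _ | _ | _ | _ | _ | _ | _)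
  exacts [⟨Sum.inl (Sum.inl r), rfl⟩, ⟨Sum.inl (Sum.inr r), rfl⟩, ⟨Sum.inr 0, rfl⟩,
    ⟨Sum.inr 1, rfl⟩, ⟨Sum.inr 2, rfl⟩, ⟨Sum.inr 3, rfl⟩, ⟨Sum.inr 4, rfl⟩, ⟨Sum.inr 5, rfl⟩,
    ⟨Sum.inr 6, rfl⟩, ⟨Sum.inr 7, rfl⟩, ⟨Sum.inr 8, rfl⟩]

theorem VoteReg.a_injective {k l : ℕ} :
    Function.Injective (VoteReg.a : SimReg k → VoteReg k l) := fun _ _ h => by cases h; rfl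

theorem VoteReg.b_injective {k l : ℕ} :
    Function.Injective (VoteReg.b : SimReg l → VoteReg k l) := fun _ _ h => by cases h; rfl

/-! ### A virtual input tape for the pair of input and hint -/

section Pair

variable {k l : ℕ}

local notation "P" => Prog (VoteReg k l) Bool (Option Bool)
local notation "S" => Store (VoteReg k l) (Option Bool)

open RandLogSpace.Prog RandLogSpace.Expr

/-- Read a symbol of the pair that consists of the input and the hint. -/
def readPair (f : InSym (Option Bool) → P) : P :=
  sym fun a => match a with
    | InSym.leftEnd => f InSym.leftEnd
    | InSym.symbol a => f (InSym.symbol (some a))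
    | InSym.rightEnd =>
      ite (var VoteReg.p)
        (ite (sub (div (var VoteReg.t) (var VoteReg.p)) (const 1))
          (ite (mod (div (var VoteReg.t) (var VoteReg.p)) (const 2))
            (f (InSym.symbol (some true))) (f (InSym.symbol (some false))))
          (f InSym.rightEnd))
        (f (InSym.symbol none))

def movePair : Move → P
  | Move.left => ite (var VoteReg.p) (assign VoteReg.p (div (var VoteReg.p) (const 2)))
      (move Move.left)
  | Move.stay => skip
  | Move.right => sym fun a => match a with
    | InSym.rightEnd =>
      ite (var VoteReg.p)
        (ite (sub (div (var VoteReg.t) (var VoteReg.p)) (const 1))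
          (assign VoteReg.p (add (var VoteReg.p) (var VoteReg.p))) skip)
        (assign VoteReg.p (const 1))
    | _ => move Move.right

/-- The position `h` on the tape with the pair `(x, t)` is represented. -/
structure AtPair (x t : List Bool) (h : ℕ) (s : S) : Prop where
  hint : s.reg VoteReg.t = wordNum t
  pos : (h ≤ x.length + 1 ∧ s.pos = h ∧ s.reg VoteReg.p = 0) ∨
    ∃ e ≤ t.length, h = x.length + 2 + e ∧ s.pos = x.length + 1 ∧ s.reg VoteReg.p = 2 ^ e

theorem length_encodePair (x t : List Bool) :
    (encodePair x t).length = x.length + 1 + t.length := by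
  simp [encodePair]; omega

theorem inputSymbol_encodePair_lt (x t : List Bool) {h : ℕ} (hh : h < x.length) :
    inputSymbol (encodePair x t) (h + 1) = InSym.symbol (some x[h]) := by
  simp [inputSymbol, encodePair, List.getElem?_append_left, hh]

theorem inputSymbol_encodePair_comma (x t : List Bool) :
    inputSymbol (encodePair x t) (x.length + 1) = InSym.symbol none := by
  simp [inputSymbol, encodePair]

theorem inputSymbol_encodePair_hint (x t : List Bool) {e : ℕ} (he : e < t.length) :
    inputSymbol (encodePair x t) (x.length + 2 + e) = InSym.symbol (some t[e]) := by
  have : x.length + 2 + e = (x.length + 1 + e) + 1 := by omega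
  rw [this, inputSymbol_of_lt _ (by rw [length_encodePair]; omega)]
  congr 1
  unfold encodePair
  rw [List.getElem_append_right (by simp; omega)]
  have h2 : x.length + 1 + e - (List.map some x).length = e + 1 := by simp; omega
  simp only [h2, List.getElem_cons_succ, List.getElem_map]

theorem inputSymbol_encodePair_end (x t : List Bool) :
    inputSymbol (encodePair x t) (x.length + 2 + t.length) = InSym.rightEnd := by
  have : x.length + 2 + t.length = (x.length + 1 + t.length) + 1 := by omega
  rw [this, inputSymbol_end _ (by rw [length_encodePair])]

/-- The right end marker of `x` plays the comma as long as `p` is zero. When `p = 2 ^ e`, the real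
head rests there and the virtual head is at the symbol of `t` with index `e`, or at the right end
marker if `e` is the length of `t`. -/
theorem sem_readPair {x t : List Bool} {h Q : ℕ} {s : S} (hs : AtPair x t h s)
    (f : InSym (Option Bool) → P) :
    (readPair f).sem x Q s = (f (inputSymbol (encodePair x t) h)).sem x Q s := by
  rw [readPair, sem]
  rcases hs.pos with ⟨h1, h2, h3⟩ | ⟨e, he, rfl, h2, h3⟩
  · rw [h2]
    cases h with
    | zero => rfl
    | succ h =>
      rcases lt_or_ge h x.length with hlt | hge
      · rw [inputSymbol_of_lt x hlt, inputSymbol_encodePair_lt x t hlt]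
      · have : h = x.length := by omega
        subst this
        rw [inputSymbol_end x le_rfl, inputSymbol_encodePair_comma]
        simp only [sem]
        rw [if_pos (by exact h3)]
  · rw [h2, inputSymbol_end x le_rfl]
    have hp : (var VoteReg.p : Expr (VoteReg k l)).eval s.reg x.length Q ≠ 0 := by
      simp only [eval, h3]; positivity
    have hd : (div (var VoteReg.t) (var VoteReg.p) : Expr (VoteReg k l)).eval s.reg x.length Q =
        wordNum t / 2 ^ e := by
      simp only [eval, h3, hs.hint]
    simp only [sem]
    rw [if_neg hp]
    rcases lt_or_eq_of_le he with hlt | heq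
    · obtain ⟨d1, d2⟩ := wordNum_digit t hlt
      have hm : (mod (div (var VoteReg.t) (var VoteReg.p)) (const 2) :
          Expr (VoteReg k l)).eval s.reg x.length Q = t[e].toNat := by
        rw [eval_mod, hd]
        exact d2
      rw [if_neg (by rw [eval, hd]; simp only [eval]; omega), inputSymbol_encodePair_hint x t hlt]
      cases hb : t[e] with
      | false => rw [if_pos (by rw [hm, hb]; rfl)]
      | true => rw [if_neg (by rw [hm, hb]; simp)]
    · subst heq
      rw [if_pos (by rw [eval, hd, wordNum_div_length]; rfl), inputSymbol_encodePair_end]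

theorem sem_movePair {x t : List Bool} {h Q : ℕ} {s : S} (hs : AtPair x t h s)
    (hQ : 2 ^ t.length ≤ Q) (m : Move) :
    ∃ s' : S, (movePair m : P).sem x Q s = Tree.leaf s' ∧
      AtPair x t (moveInput (encodePair x t).length h m) s' ∧
      (∀ v, v ≠ VoteReg.p → s'.reg v = s.reg v) ∧ s'.out = s.out := by
  have h1Q : 1 ≤ Q := Nat.one_le_two_pow.trans hQ
  cases m with
  | stay => exact ⟨s, rfl, hs, fun _ _ => rfl, rfl⟩
  | left =>
    rw [movePair, sem]
    rcases hs.pos with ⟨h1, h2, h3⟩ | ⟨e, he, rfl, h2, h3⟩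
    · rw [if_pos (by exact h3), sem]
      refine ⟨_, rfl, ⟨hs.hint, Or.inl ⟨?_, ?_, h3⟩⟩, fun _ _ => rfl, rfl⟩
      · simp only [moveInput]; omega
      · simp only [moveInput, h2]
    · rw [if_neg (by simp only [eval, h3]; positivity), sem_assign_of_le (by
        simp only [eval, h3]
        exact (Nat.div_le_self _ _).trans ((Nat.pow_le_pow_right (by omega) he).trans hQ))]
      refine ⟨_, rfl, ⟨by simpa using hs.hint, ?_⟩, fun v hv => by simp [hv], rfl⟩
      simp only [Store.pos_set, Store.reg_set, if_true, moveInput, eval, h3]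
      -- At the first symbol of the hint `p = 1`, and halving gives zero: the virtual head is back
      -- at the comma.
      cases e with
      | zero => exact Or.inl ⟨by omega, by omega, by simp⟩
      | succ e =>
        exact Or.inr ⟨e, by omega, by omega, h2, by rw [pow_succ]; simp⟩
  | right =>
    rw [movePair, sem, length_encodePair]
    rcases hs.pos with ⟨h1, h2, h3⟩ | ⟨e, he, rfl, h2, h3⟩
    · rcases Nat.lt_or_ge h (x.length + 1) with hlt | hge
      · have hsym : inputSymbol x s.pos ≠ InSym.rightEnd := by
          rw [h2]
          cases h with
          | zero => simp [inputSymbol]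
          | succ h => rw [inputSymbol_of_lt x (by omega)]; simp
        have hmove : ∀ a : InSym Bool, a ≠ InSym.rightEnd → (match a with
            | InSym.rightEnd => ite (var VoteReg.p)
              (ite (sub (div (var VoteReg.t) (var VoteReg.p)) (const 1))
                (assign VoteReg.p (add (var VoteReg.p) (var VoteReg.p))) skip)
              (assign VoteReg.p (const 1))
            | _ => move Move.right : P) = move Move.right := by
          intro a ha
          cases a <;> simp at ha ⊢
        rw [hmove _ hsym, sem]
        refine ⟨_, rfl, ⟨hs.hint, Or.inl ⟨?_, ?_, h3⟩⟩, fun _ _ => rfl, rfl⟩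
        · simp only [moveInput]; omega
        · simp only [moveInput, h2]; omega
      · have hh : h = x.length + 1 := by omega
        subst hh
        rw [h2, inputSymbol_end x le_rfl]
        simp only
        rw [sem, if_pos (by exact h3), sem_assign_of_le (by exact h1Q)]
        refine ⟨_, rfl, ⟨by simpa using hs.hint, Or.inr ⟨0, by omega, ?_, h2, by simp [eval]⟩⟩,
          fun v hv => by simp [hv], rfl⟩
        simp only [moveInput]; omega
    · rw [h2, inputSymbol_end x le_rfl]
      have hd : (div (var VoteReg.t) (var VoteReg.p) : Expr (VoteReg k l)).eval s.reg x.length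
          Q = wordNum t / 2 ^ e := by
        simp only [eval, h3, hs.hint]
      simp only
      rw [sem, if_neg (by simp only [eval, h3]; positivity), sem]
      rcases lt_or_eq_of_le he with hlt | heq
      · obtain ⟨d1, _⟩ := wordNum_digit t hlt
        have h2e : 2 ^ e + 2 ^ e = 2 ^ (e + 1) := by rw [pow_succ]; omega
        rw [if_neg (by rw [eval, hd]; simp only [eval]; omega), sem_assign_of_le (by
          simp only [eval, h3, h2e]
          exact (Nat.pow_le_pow_right (by omega) hlt).trans hQ)]
        refine ⟨_, rfl, ⟨by simpa using hs.hint, Or.inr ⟨e + 1, hlt, ?_, h2, ?_⟩⟩,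
          fun v hv => by simp [hv], rfl⟩
        · simp only [moveInput]; omega
        · simp only [Store.reg_set, if_true, eval, h3, h2e]
      · subst heq
        -- At the right end marker of the pair `p` is not doubled any more, as `moveInput` requires.
        rw [if_pos (by rw [eval, hd, wordNum_div_length]; rfl), sem]
        refine ⟨_, rfl, ⟨hs.hint, Or.inr ⟨t.length, le_rfl, ?_, h2, h3⟩⟩, fun _ _ => rfl, rfl⟩
        simp only [moveInput]; omega

end Pair


/-! ### Simulation with abstract access to input and output -/

namespace Transducer

variable {I' O' : Type} {M : Transducer I' O'} {V I O : Type} [DecidableEq V]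

/-- The programs `read`, `mv` and `em` provide the access of the simulated transducer to its input
`x'` and output: `J h w s` says how the store `s` represents the position `h` of the input head
and the output `w`. -/
structure Access (emb : SimReg M.tapes → V) (Q : ℕ) (x : List I) (x' : List I')
    (read : (InSym I' → Prog V I O) → Prog V I O) (mv : Move → Prog V I O)
    (em : O' → Prog V I O) (J : ℕ → List O' → Store V O → Prop) : Prop where
  frame : ∀ h w s u, J h w s → (∀ v, (∀ i, v ≠ emb i) → u.reg v = s.reg v) →
    u.pos = s.pos → u.out = s.out → J h w u
  read : ∀ h w s, J h w s → ∀ f, (read f).sem x Q s = (f (inputSymbol x' h)).sem x Q s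
  mv : ∀ h w s m, J h w s → ∃ s', (mv m).sem x Q s = Tree.leaf s' ∧
    (∀ i, s'.reg (emb i) = s.reg (emb i)) ∧ J (moveInput x'.length h m) w s'
  em : ∀ h w s o, J h w s → ∃ s', (em o).sem x Q s = Tree.leaf s' ∧
    (∀ i, s'.reg (emb i) = s.reg (emb i)) ∧ J h (w ++ [o]) s'

theorem Access.step {emb : SimReg M.tapes → V} (hemb : Function.Injective emb)
    {S Q : ℕ} (hQ : M.base ^ S ≤ Q) (hQ' : M.numStates ≤ Q) {x : List I} {x' : List I'}
    {J : ℕ → List O' → Store V O → Prop} {read : (InSym I' → Prog V I O) → Prog V I O}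
    {mv : Move → Prog V I O} {em : O' → Prog V I O} (hacc : Access emb Q x x' read mv em J)
    {c : M.Config} {s : Store V O} (hc : M.Safe x' S c) (hrep : Rep emb S c s.reg)
    (hJ : J c.inputHead c.output s) :
    ∃ σ : Bool → Store V O,
      (simStep M emb read mv em).sem x Q s = Tree.node (fun b => Tree.leaf (σ b)) ∧
      ∀ b, Rep emb S (M.step x' b c) (σ b).reg ∧
        J (M.step x' b c).inputHead (M.step x' b c).output (σ b) := by
  obtain ⟨T, h1, h2, h3⟩ := sem_simStep hemb hQ hQ' x x' hrep hc read mv em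
    (hacc.read _ _ _ hJ)
  by_cases hh : M.halt c.state
  · refine ⟨fun _ => s, ?_, fun b => ?_⟩
    · rw [h1]
      exact congrArg _ (funext (h2 hh))
    · rw [M.step_of_halt x' b c hh]
      exact ⟨hrep, hJ⟩
  · have key : ∀ b, ∃ s', T b = Tree.leaf s' ∧ Rep emb S (M.step x' b c) s'.reg ∧
        J (M.step x' b c).inputHead (M.step x' b c).output s' := by
      intro b
      obtain ⟨u, k1, k2, k3, k4, k5⟩ := h3 hh b
      obtain ⟨s1, m1, m2, m3⟩ := hacc.mv _ _ u (action M x' c b).moveI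
        (hacc.frame _ _ _ _ hJ k3 k4 k5)
      have hrep' : ∀ s' : Store V O, (∀ i, s'.reg (emb i) = u.reg (emb i)) →
          Rep emb S (M.step x' b c) s'.reg := fun s' hs' =>
        ⟨(hs' _).trans k2.st, fun i => (hs' _).trans (k2.num i), fun i => (hs' _).trans (k2.wt i)⟩
      rw [k1, after, Prog.sem_seq_of_leaf m1]
      have hstep := step_of_not_halt (x' := x') hh b
      have hhead : (M.step x' b c).inputHead =
          moveInput x'.length c.inputHead (action M x' c b).moveI := by rw [hstep]
      have hout : (M.step x' b c).output = c.output ++ (action M x' c b).emit.toList := by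
        rw [hstep]
      rw [hhead, hout]
      cases hemit : (action M x' c b).emit with
      | none =>
        refine ⟨s1, rfl, hrep' s1 m2, ?_⟩
        simpa using m3
      | some o =>
        obtain ⟨s2, n1, n2, n3⟩ := hacc.em _ _ s1 o m3
        exact ⟨s2, n1, hrep' s2 fun i => (n2 i).trans (m2 i), n3⟩
    choose σ hσ1 hσ2 using key
    exact ⟨σ, by rw [h1]; exact congrArg _ (funext hσ1), hσ2⟩

/-- One round of the loop is one step of `M`, and `cap` rounds are `Q` steps. Lower bounds for
success probabilities are all that is needed, so an inequality between `ψ` and `φ` at the end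
suffices. -/
theorem Access.ev_loop {emb : SimReg M.tapes → V} (hemb : Function.Injective emb)
    {S Q : ℕ} (hQ : M.base ^ S ≤ Q) (hQ' : M.numStates ≤ Q) {x : List I} {x' : List I'}
    {J : ℕ → List O' → Store V O → Prop} {read : (InSym I' → Prog V I O) → Prog V I O}
    {mv : Move → Prog V I O} {em : O' → Prog V I O} (hacc : Access emb Q x x' read mv em J)
    {c : M.Config} {s : Store V O} (hsafe : M.Safe x' S c)
    (hrep : Rep emb S c s.reg) (hJ : J c.inputHead c.output s)
    {ψ : List O' → ℝ} {φ : Store V O → ℝ} (hle : ∀ h w s, J h w s → ψ w ≤ φ s) :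
    (iterTree (fun c b => M.step x' b c) Q c).ev (fun c => ψ c.output) ≤
      ((Prog.loop Expr.cap (simStep M emb read mv em)).sem x Q s).ev φ := by
  refine ev_iterTree_le_iterate (fun c s => Rep emb S c s.reg ∧ M.Safe x' S c ∧
    J c.inputHead c.output s) ?_ Q ⟨hrep, hsafe, hJ⟩
    ((Tree.all_true _).mono fun c _ s hs => hle _ _ s hs.2.2)
  rintro c s ⟨hrep, hc, hJ⟩
  obtain ⟨σ, h1, h2⟩ := hacc.step hemb hQ hQ' hc hrep hJ
  exact ⟨σ, h1, fun b => ⟨(h2 b).1, hc.step b, (h2 b).2⟩⟩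

end Transducer

/-! ### The program for two copies: the hint and a single vote -/

section Amplify

open RandLogSpace.Prog RandLogSpace.Expr

variable (A : Transducer Bool Bool) (B : Transducer (Option Bool) Bool)

local notation "R" => VoteReg A.tapes B.tapes
local notation "P" => Prog (VoteReg A.tapes B.tapes) Bool (Option Bool)
local notation "S" => Store (VoteReg A.tapes B.tapes) (Option Bool)

/-- Compute the hint. -/
noncomputable def gather : P :=
  seq (Transducer.initProg A VoteReg.a) (seq (assign VoteReg.t (const 1))
    (seq (assign VoteReg.pt (const 1)) (loop cap (Transducer.simStep A VoteReg.a sym move fun b =>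
      seq (assign VoteReg.t (add (var VoteReg.t) (mul (const (1 + b.toNat)) (var VoteReg.pt))))
        (assign VoteReg.pt (add (var VoteReg.pt) (var VoteReg.pt)))))))

/-- One run of `B`, which votes for the bit with index `i` of its output. -/
noncomputable def trial : P :=
  seq rewind (seq (assign VoteReg.p (const 0)) (seq (Transducer.initProg B VoteReg.b)
    (seq (assign VoteReg.j (const 0)) (seq (assign VoteReg.vote (const 2))
      (seq (loop cap (Transducer.simStep B VoteReg.b readPair movePair fun b =>
          seq (ite (Expr.dist (var VoteReg.j) (var VoteReg.i)) skip
            (assign VoteReg.vote (const b.toNat)))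
            (assign VoteReg.j (add (var VoteReg.j) (const 1)))))
        (seq (ite (Expr.dist (var VoteReg.vote) (const 1)) skip
            (assign VoteReg.c1 (add (var VoteReg.c1) (const 1))))
          (ite (Expr.dist (var VoteReg.vote) (const 0)) skip
            (assign VoteReg.c0 (add (var VoteReg.c0) (const 1))))))))))

/-- Determine one bit of the output of `B` by a majority vote. -/
noncomputable def voteBit : P :=
  seq (assign VoteReg.c1 (const 0)) (seq (assign VoteReg.c0 (const 0))
    (seq (loop len (trial A B))
      (ite (sub (add (var VoteReg.c1) (var VoteReg.c1)) len)
        (seq (emit (some true)) (assign VoteReg.i (add (var VoteReg.i) (const 1))))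
        (ite (sub (add (var VoteReg.c0) (var VoteReg.c0)) len)
          (seq (emit (some false)) (assign VoteReg.i (add (var VoteReg.i) (const 1))))
          (assign VoteReg.fin (const 1))))))

/-- Output what `B` outputs most of the time. -/
noncomputable def copyOutput : P :=
  seq (assign VoteReg.i (const 0)) (seq (assign VoteReg.fin (const 0))
    (loop cap (ite (var VoteReg.fin) skip (voteBit A B))))

noncomputable def twoCopies : P :=
  seq (gather A B) (seq (copyOutput A B) (seq (emit none) (copyOutput A B)))

variable {A B}

/-- The hint `t` is present, and `o` has been output. -/
structure Hinted (x t : List Bool) (o : List (Option Bool)) (s : S) : Prop where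
  hint : s.reg VoteReg.t = wordNum t
  pos : s.pos ≤ x.length + 1
  out : s.out = o

/-- The registers `t` and `pt` are guaranteed to be right only while the output of `A` has length at
most `L`; beyond that the cap may distort them. Longer outputs count for nothing by `hψ`, so the
invariant says nothing about them. -/
theorem ev_gather {x : List Bool} {Sz Q L : ℕ} (hA : A.Fits x Sz Q) (hL : 2 ^ (L + 1) ≤ Q)
    {ψ : List Bool → ℝ} {φ : S → ℝ} (h0 : ∀ s, 0 ≤ φ s)
    (hψ : ∀ w, L < w.length → ψ w ≤ 0)
    (hle : ∀ w s, w.length ≤ L → Hinted x w [] s → ψ w ≤ φ s) :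
    (iterTree (fun c b => A.step x b c) Q A.init).ev (fun c => ψ c.output) ≤
      ((gather A B).sem x Q (start R (Option Bool))).ev φ := by
  have h1Q : 1 ≤ Q := Nat.one_le_two_pow.trans hL
  obtain ⟨s1, e1, hrep, hfr, hpos, hout⟩ := Transducer.sem_initProg
    (emb := (VoteReg.a : _ → R)) VoteReg.a_injective hA x (start R (Option Bool))
  rw [gather, sem_seq_of_leaf e1, sem_seq_of_leaf (sem_assign_of_le h1Q),
    sem_seq_of_leaf (sem_assign_of_le h1Q)]
  refine Transducer.Access.ev_loop VoteReg.a_injective hA.base_le hA.states_le (x := x) (x' := x)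
    (J := fun h w s => s.pos = h ∧ h ≤ x.length + 1 ∧ s.out = [] ∧ (w.length ≤ L →
      s.reg VoteReg.t = wordNum w ∧ s.reg VoteReg.pt = 2 ^ w.length))
    ⟨?_, ?_, ?_, ?_⟩ hA.safe ?_ ?_ ?_
  · rintro h w s u ⟨j1, j2, j3, j4⟩ hf hp ho
    rw [hf _ fun i => by simp, hf _ fun i => by simp, hp, ho]
    exact ⟨j1, j2, j3, j4⟩
  · rintro h w s ⟨rfl, -⟩ f
    rfl
  · rintro h w s m ⟨rfl, j2, j3, j4⟩
    refine ⟨_, rfl, fun _ => rfl, rfl, ?_, j3, j4⟩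
    cases m <;> simp only [moveInput] <;> omega
  · rintro h w s b ⟨rfl, j2, j3, j4⟩
    refine ⟨_, rfl, fun i => by simp, rfl, j2, j3, fun hw => ?_⟩
    simp only [List.length_append, List.length_singleton] at hw
    obtain ⟨t1, t2⟩ := j4 (by omega)
    have ht : wordNum (w ++ [b]) ≤ Q := by
      refine (wordNum_lt _).le.trans (le_trans (Nat.pow_le_pow_right (by omega) ?_) hL)
      simpa using hw
    have hpt : 2 ^ (w.length + 1) ≤ Q := (Nat.pow_le_pow_right (by omega) (by omega)).trans hL
    have ht' : wordNum w + (1 + b.toNat) * 2 ^ w.length = wordNum (w ++ [b]) := by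
      rw [wordNum_append]; ring
    have hpt' : 2 ^ w.length + 2 ^ w.length = 2 ^ (w.length + 1) := by ring
    constructor
    · simp only [Store.reg_set, reduceCtorEq, if_false, if_true, eval, t1, t2, ht',
        min_eq_left ht]
    · simp only [Store.reg_set, reduceCtorEq, if_false, if_true, eval, t2, hpt',
        min_eq_left hpt, List.length_append, List.length_singleton]
  · refine ⟨?_, fun i => ?_, fun i => ?_⟩
    · simpa using hrep.st
    · simpa using hrep.num i
    · simpa using hrep.wt i
  · refine ⟨?_, ?_, ?_, fun _ => ⟨?_, ?_⟩⟩
    · exact hpos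
    · exact Nat.zero_le _
    · exact hout
    · simp [Transducer.init, wordNum, eval]
    · simp [Transducer.init, eval]
  · rintro h w s ⟨rfl, j2, j3, j4⟩
    rcases le_or_gt w.length L with hw | hw
    · exact hle w s hw ⟨(j4 hw).1, j2, j3⟩
    · exact (hψ w hw).trans (h0 s)

/-- The number that stands for a vote. -/
def voteCode : Option Bool → ℕ
  | none => 2
  | some b => b.toNat

/-- The number of votes for `b` in a vote. -/
def voteCount (v : Option Bool) (b : Bool) : ℕ := if v = some b then 1 else 0

/-- Additionally, the bit with index `i` is being determined, with `a1` and `a0` votes. -/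
structure Voting (x t : List Bool) (o : List (Option Bool)) (i f a1 a0 : ℕ) (s : S) : Prop
    extends Hinted x t o s where
  idx : s.reg VoteReg.i = i
  fin : s.reg VoteReg.fin = f
  c1 : s.reg VoteReg.c1 = a1
  c0 : s.reg VoteReg.c0 = a0

/-- The vote of one trial is `c.output[i]?` for a random run of `B`; the value `none` means that the
output is too short to have a bit with index `i`. -/
theorem ev_trial {x t : List Bool} {Sz Q i f a1 a0 : ℕ} {o : List (Option Bool)}
    (hB : B.Fits (encodePair x t) Sz Q) (ht : 2 ^ t.length ≤ Q) (h2 : 2 ≤ Q) (hi : i < Q)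
    (ha1 : a1 < Q) (ha0 : a0 < Q) {s : S} (hs : Voting x t o i f a1 a0 s)
    {ψ : Option Bool → ℝ} {φ : S → ℝ}
    (hle : ∀ v s, Voting x t o i f (a1 + voteCount v true) (a0 + voteCount v false) s →
      ψ v ≤ φ s) :
    (iterTree (fun c b => B.step (encodePair x t) b c) Q B.init).ev (fun c => ψ c.output[i]?) ≤
      ((trial A B).sem x Q s).ev φ := by
  obtain ⟨s1, e1, hrep, hfr, hpos, hout⟩ := Transducer.sem_initProg
    (emb := (VoteReg.b : _ → R)) VoteReg.b_injective hB x
    ((⟨s.reg, 0, s.out⟩ : S).set VoteReg.p 0)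
  have hfr' : ∀ v : R, (∀ i, v ≠ VoteReg.b i) → v ≠ VoteReg.p → s1.reg v = s.reg v := by
    intro v hv hp
    rw [hfr v hv, Store.reg_set, if_neg hp]
  rw [trial, sem_seq_of_leaf (sem_rewind x Q s hs.pos),
    sem_seq_of_leaf (sem_assign_of_le (Nat.zero_le _)), eval, sem_seq_of_leaf e1,
    sem_seq_of_leaf (sem_assign_of_le (Nat.zero_le _)), sem_seq_of_leaf (sem_assign_of_le h2),
    ev_seq]
  refine Transducer.Access.ev_loop VoteReg.b_injective hB.base_le hB.states_le (x := x)
    (x' := encodePair x t) (ψ := fun w => ψ w[i]?)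
    (J := fun h w s => AtPair x t h s ∧ s.out = o ∧ s.reg VoteReg.j = min w.length Q ∧
      s.reg VoteReg.i = i ∧ s.reg VoteReg.vote = voteCode w[i]? ∧ s.reg VoteReg.c1 = a1 ∧
      s.reg VoteReg.c0 = a0 ∧ s.reg VoteReg.fin = f)
    ⟨?_, ?_, ?_, ?_⟩ hB.safe ?_ ?_ ?_
  · rintro h w s u ⟨j1, j2, j3, j4, j5, j6, j7, j8⟩ hf hp ho
    have hf' : ∀ v : R, (∀ i, v ≠ VoteReg.b i) → u.reg v = s.reg v := hf
    refine ⟨⟨?_, ?_⟩, ho.trans j2, ?_, ?_, ?_, ?_, ?_, ?_⟩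
    · rw [hf' _ fun i => by simp, j1.hint]
    · rw [hf' _ fun i => by simp, hp]
      exact j1.pos
    all_goals rw [hf' _ fun i => by simp]; assumption
  · rintro h w s ⟨j1, -⟩ f
    exact sem_readPair j1 f
  · rintro h w s m ⟨j1, j2, j3, j4, j5, j6, j7, j8⟩
    obtain ⟨s', m1, m2, m3, m4⟩ := sem_movePair (Q := Q) j1 ht m
    refine ⟨s', m1, fun i => m3 _ (by simp), m2, m4.trans j2, ?_, ?_, ?_, ?_, ?_, ?_⟩
    all_goals rw [m3 _ (by simp)]; assumption
  · rintro h w s b ⟨j1, j2, j3, j4, j5, j6, j7, j8⟩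
    -- The counter `j` saturates at `Q`. Since `i < Q`, a saturated counter is never mistaken for
    -- the index `i`.
    have hdist : (Expr.dist (var VoteReg.j) (var VoteReg.i) : Expr R).eval s.reg x.length Q = 0 ↔
        w.length = i := by
      rw [eval_dist_eq_zero]
      simp only [eval, j3, j4]
      omega
    have hmin : min (min w.length Q + 1) Q = min (w ++ [b]).length Q := by
      simp only [List.length_append, List.length_singleton]; omega
    by_cases hwi : w.length = i
    · have hb : (const b.toNat : Expr R).eval s.reg x.length Q ≤ Q := by
        cases b <;> (simp [eval]; try omega)
      refine ⟨_, (sem_seq_of_leaf ((sem_ite_of_eq (hdist.2 hwi)).trans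
          (sem_assign_of_le hb))).trans rfl, fun i => by simp, ⟨by simpa using j1.hint, by simpa using j1.pos⟩, j2, ?_, by simpa using j4,
        ?_, by simpa using j6, by simpa using j7, by simpa using j8⟩
      · simpa [eval, j3] using hmin
      · subst hwi
        simp [eval, voteCode]
    · refine ⟨_, (sem_seq_of_leaf ((sem_ite_of_ne (mt hdist.1 hwi)).trans rfl)).trans rfl,
        fun i => by simp, ⟨by simpa using j1.hint, by simpa using j1.pos⟩, j2, ?_, by simpa using j4,
        ?_, by simpa using j6, by simpa using j7, by simpa using j8⟩
      · simpa [eval, j3] using hmin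
      · have : (w ++ [b])[i]? = w[i]? := by
          rcases lt_or_gt_of_ne hwi with h | h
          · rw [List.getElem?_eq_none (by simp; omega), List.getElem?_eq_none (by omega)]
          · rw [List.getElem?_append_left h]
        rw [this]
        simpa using j5
  · refine ⟨?_, fun i => ?_, fun i => ?_⟩
    · simpa using hrep.st
    · simpa using hrep.num i
    · simpa using hrep.wt i
  · refine ⟨⟨?_, Or.inl ⟨Nat.zero_le _, ?_, ?_⟩⟩, ?_, ?_, ?_, ?_, ?_, ?_, ?_⟩
    · simpa [hfr'] using hs.hint
    · exact hpos
    · simp [hfr, eval]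
    · exact hout.trans hs.out
    · simp [Transducer.init, eval]
    · simpa [hfr'] using hs.idx
    · simp [Transducer.init, eval, voteCode]
    · simpa [hfr'] using hs.c1
    · simpa [hfr'] using hs.c0
    · simpa [hfr'] using hs.fin
  · rintro h w s ⟨j1, j2, j3, j4, j5, j6, j7, j8⟩
    have hpos' : s.pos ≤ x.length + 1 := by
      rcases j1.pos with h | ⟨e, -, -, h, -⟩ <;> omega
    have h1 : ∀ (r : R → ℕ) (b : Bool) {v : Option Bool}, r VoteReg.vote = voteCode v →
        ((Expr.dist (var VoteReg.vote) (const b.toNat) : Expr R).eval r x.length Q = 0 ↔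
          v = some b) := by
      intro r b v hr
      rw [eval_dist_eq_zero]
      simp only [eval, hr]
      rcases v with _ | b' <;> cases b <;> try cases b'
      all_goals simp [voteCode]
    have ht1 : ∀ (r : R → ℕ) {v : Option Bool}, r VoteReg.vote = voteCode v →
        ((Expr.dist (var VoteReg.vote) (const 1) : Expr R).eval r x.length Q = 0 ↔
          v = some true) := fun r => h1 r true
    have hf1 : ∀ (r : R → ℕ) {v : Option Bool}, r VoteReg.vote = voteCode v →
        ((Expr.dist (var VoteReg.vote) (const 0) : Expr R).eval r x.length Q = 0 ↔
          v = some false) := fun r => h1 r false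
    have hs0 : Voting x t o i f a1 a0 s := ⟨⟨j1.hint, hpos', j2⟩, j4, j8, j6, j7⟩
    have hle' := hle w[i]?
    generalize w[i]? = v at *
    rcases v with _ | _ | _
    · rw [sem_seq_of_leaf ((sem_ite_of_ne (mt (ht1 s.reg j5).1 (by simp))).trans rfl),
        sem_ite_of_ne (mt (hf1 s.reg j5).1 (by simp)), sem, Tree.ev_leaf]
      exact hle' _ hs0
    · rw [sem_seq_of_leaf ((sem_ite_of_ne (mt (ht1 s.reg j5).1 (by simp))).trans rfl),
        (sem_ite_of_eq ((hf1 s.reg j5).2 rfl)).trans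
          (sem_assign_of_le (by simp only [eval, j7]; omega)), Tree.ev_leaf]
      refine hle' _ ⟨⟨?_, hpos', j2⟩, ?_, ?_, ?_, ?_⟩ <;>
        simp [voteCount, eval, hs0.hint, hs0.idx, hs0.fin, hs0.c1, hs0.c0]
    · have h5 : (s.set VoteReg.c1 ((add (var VoteReg.c1) (const 1)).eval s.reg x.length
          Q)).reg VoteReg.vote = voteCode (some true) := by simpa using j5
      rw [sem_seq_of_leaf ((sem_ite_of_eq ((ht1 s.reg j5).2 rfl)).trans
          (sem_assign_of_le (by simp only [eval, j6]; omega))),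
        sem_ite_of_ne (mt (hf1 _ h5).1 (by simp)), sem, Tree.ev_leaf]
      refine hle' _ ⟨⟨?_, hpos', j2⟩, ?_, ?_, ?_, ?_⟩ <;>
        simp [voteCount, eval, hs0.hint, hs0.idx, hs0.fin, hs0.c1, hs0.c0]

end Amplify


/-! ### Majority votes and the error of the two copies -/

section Amplify

open RandLogSpace.Prog RandLogSpace.Expr

variable {A : Transducer Bool Bool} {B : Transducer (Option Bool) Bool}

local notation "R" => VoteReg A.tapes B.tapes
local notation "P" => Prog (VoteReg A.tapes B.tapes) Bool (Option Bool)
local notation "S" => Store (VoteReg A.tapes B.tapes) (Option Bool)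

/-- On input `(x, t)`, the transducer `B` outputs `y` with probability at least `2 / 3`. -/
structure Likely (B : Transducer (Option Bool) Bool) (x t y : List Bool) (Sz Q : ℕ) : Prop where
  fits : B.Fits (encodePair x t) Sz Q
  length_hint : 2 ^ t.length ≤ Q
  length_out : y.length < Q
  length_in : x.length + 2 ≤ Q
  prob : 2 / 3 ≤ (iterTree (fun c b => B.step (encodePair x t) b c) Q B.init).ev
    fun c => ind (c.output = y)

/-- A run that outputs `y` gives the right vote, worth `α`; any other run is worth at least `β`. As
`β ≤ α`, the worst case is probability exactly 2/3. -/
theorem Likely.ev_trial {x t y : List Bool} {Sz Q i f a1 a0 : ℕ} {o : List (Option Bool)}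
    (h : Likely B x t y Sz Q) (hi : i < Q) (ha1 : a1 < Q) (ha0 : a0 < Q) {s : S}
    (hs : Voting x t o i f a1 a0 s) {α β : ℝ} (hβ : β ≤ α) {φ : S → ℝ}
    (hα : ∀ s, Voting x t o i f (a1 + voteCount y[i]? true) (a0 + voteCount y[i]? false) s →
      α ≤ φ s)
    (hle : ∀ v s, Voting x t o i f (a1 + voteCount v true) (a0 + voteCount v false) s →
      β ≤ φ s) :
    2 / 3 * α + 1 / 3 * β ≤ ((trial A B).sem x Q s).ev φ := by
  classical
  refine le_trans ?_ (RandLogSpace.ev_trial h.fits h.length_hint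
    (by have := h.length_in; omega) hi ha1 ha0 hs (ψ := fun v => if v = y[i]? then α else β) ?_)
  · have h1 : (iterTree (fun c b => B.step (encodePair x t) b c) Q B.init).ev
        (fun c => β + (α - β) * ind (c.output = y)) ≤
        (iterTree (fun c b => B.step (encodePair x t) b c) Q B.init).ev
          fun c => if c.output[i]? = y[i]? then α else β := by
      refine Tree.ev_mono _ fun c => ?_
      by_cases hc : c.output = y
      · rw [ind_true hc, hc, if_pos rfl]
        linarith
      · rw [ind_false hc]
        split_ifs <;> linarith
    refine le_trans ?_ h1
    rw [Tree.ev_add, Tree.ev_const, Tree.ev_const_mul]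
    nlinarith [h.prob]
  · intro v s hv
    split_ifs with hvi
    · exact hα s (hvi ▸ hv)
    · exact hle v s hv

/-- After some trials, `g` of which have given the correct bit, `f` have not. -/
structure Tally (u : Option Bool) (g f a1 a0 : ℕ) : Prop where
  true : if u = some true then a1 = g else a1 ≤ f
  false : if u = some false then a0 = g else a0 ≤ f

/-- A supermartingale argument with the potential `(3/2)^(b - g)`, for `g` right and `b` wrong
votes. A right vote multiplies it by 2/3, a wrong one by 3/2, so a trial multiplies its mean by at
most 2/3 · 2/3 + 1/3 · 3/2 = 17/18. If in the end `b ≥ g`, the potential is at least 1 and the claim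
is void because `α ≤ 1`. -/
theorem ev_trials {x t y : List Bool} {Sz Q i f : ℕ} {o : List (Option Bool)}
    (h : Likely B x t y Sz Q) (hi : i < Q) {α : ℝ} (hα1 : α ≤ 1) {φ : S → ℝ} (h0 : ∀ s, 0 ≤ φ s)
    (hα : ∀ g b a1 a0 s, g + b = x.length → b < g → Tally y[i]? g b a1 a0 →
      Voting x t o i f a1 a0 s → α ≤ φ s)
    (m g b a1 a0 : ℕ) (hm : g + b + m = x.length) (ht : Tally y[i]? g b a1 a0) {s : S}
    (hs : Voting x t o i f a1 a0 s) :
    α - (3 / 2) ^ b / (3 / 2) ^ g * (17 / 18) ^ m ≤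
      (Tree.iterate ((trial A B).sem x Q) m s).ev φ := by
  induction m generalizing g b a1 a0 s with
  | zero =>
    rw [Tree.iterate, Tree.ev_leaf, pow_zero, mul_one]
    rcases lt_or_ge b g with hbg | hbg
    · have := hα g b a1 a0 s (by omega) hbg ht hs
      have : (0 : ℝ) ≤ (3 / 2) ^ b / (3 / 2) ^ g := by positivity
      linarith
    · have h1 : (1 : ℝ) ≤ (3 / 2) ^ b / (3 / 2) ^ g := by
        rw [one_le_div (by positivity)]
        exact pow_le_pow_right₀ (by norm_num) hbg
      linarith [h0 s]
  | succ m ih =>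
    have hle : a1 ≤ g + b ∧ a0 ≤ g + b := by
      have h1 := ht.true
      have h2 := ht.false
      split_ifs at h1 h2 <;> omega
    have hQ := h.length_in
    rw [Tree.iterate, Tree.ev_bind]
    set q : ℝ := (3 / 2) ^ b / (3 / 2) ^ g * (17 / 18) ^ m with hq
    have hq0 : 0 ≤ q := by positivity
    have hg : (3 / 2 : ℝ) ^ b / (3 / 2) ^ (g + 1) * (17 / 18) ^ m = 2 / 3 * q := by
      rw [hq, pow_succ]; field_simp
    have hb : (3 / 2 : ℝ) ^ (b + 1) / (3 / 2) ^ g * (17 / 18) ^ m = 3 / 2 * q := by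
      rw [hq, pow_succ]; field_simp
    refine le_trans ?_ (h.ev_trial (α := α - 2 / 3 * q) (β := α - 3 / 2 * q) hi (by omega)
      (by omega) hs (by linarith) ?_ ?_)
    · have : (3 / 2 : ℝ) ^ b / (3 / 2) ^ g * (17 / 18) ^ (m + 1) = 17 / 18 * q := by
        rw [hq, pow_succ]; ring
      rw [this]
      linarith
    · intro s' hs'
      rw [← hg]
      refine ih (g + 1) b _ _ (by omega) ⟨?_, ?_⟩ hs'
      · have h1 := ht.true
        unfold voteCount
        split_ifs at h1 ⊢ <;> omega
      · have h1 := ht.false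
        unfold voteCount
        split_ifs at h1 ⊢ <;> omega
    · intro v s' hs'
      -- The bound with `3/2` is required for every vote; a right vote satisfies it all the more.
      by_cases hv : v = y[i]?
      · subst hv
        refine le_trans ?_ (ih (g + 1) b _ _ (by omega) ⟨?_, ?_⟩ hs')
        · rw [hg]
          linarith
        · have h1 := ht.true
          unfold voteCount
          split_ifs at h1 ⊢ <;> omega
        · have h1 := ht.false
          unfold voteCount
          split_ifs at h1 ⊢ <;> omega
      · rw [← hb]
        have hle : ∀ v' : Option Bool, ∀ c, voteCount v' c ≤ 1 := fun v' c => by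
          unfold voteCount; split_ifs <;> omega
        have hne : ∀ c, y[i]? = some c → voteCount v c = 0 := fun c hc => by
          unfold voteCount
          rw [if_neg fun h' => hv (h'.trans hc.symm)]
        refine ih g (b + 1) _ _ (by omega) ⟨?_, ?_⟩ hs'
        · have h1 := ht.true
          have := hle v Bool.true
          split_ifs at h1 ⊢ with hc
          · rw [hne _ hc, h1, Nat.add_zero]
          · omega
        · have h1 := ht.false
          have := hle v Bool.false
          split_ifs at h1 ⊢ with hc
          · rw [hne _ hc, h1, Nat.add_zero]
          · omega

/-- The next bit with index `i` is about to be determined. -/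
structure Copying (x t : List Bool) (o : List (Option Bool)) (i f : ℕ) (s : S) : Prop
    extends Hinted x t o s where
  idx : s.reg VoteReg.i = i
  fin : s.reg VoteReg.fin = f

/-- If more than half of the n trials are right, then the right bit has more than n/2 votes and the
other one fewer. If `y` has no bit with index `i`, then both bits have fewer than n/2 votes, and the
end is recognized. -/
theorem ev_voteBit {x t y : List Bool} {Sz Q i : ℕ} {o : List (Option Bool)}
    (h : Likely B x t y Sz Q) (hi : i < Q) {α : ℝ} (hα1 : α ≤ 1) {φ : S → ℝ} (h0 : ∀ s, 0 ≤ φ s)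
    {s : S} (hs : Copying x t o i 0 s)
    (hsome : ∀ b, y[i]? = some b → ∀ s, Copying x t (o ++ [some b]) (i + 1) 0 s → α ≤ φ s)
    (hnone : y[i]? = none → ∀ s, Copying x t o i 1 s → α ≤ φ s) :
    α - (17 / 18) ^ x.length ≤ ((voteBit A B).sem x Q s).ev φ := by
  have hQ := h.length_in
  rw [voteBit, sem_seq_of_leaf (sem_assign_of_le (Nat.zero_le _)),
    sem_seq_of_leaf (sem_assign_of_le (Nat.zero_le _)), ev_seq]
  have key := ev_trials (f := 0) (o := o) h hi hα1 (φ := fun s => ((Prog.ite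
      (sub (add (var VoteReg.c1) (var VoteReg.c1)) len)
        (seq (emit (some true)) (assign VoteReg.i (add (var VoteReg.i) (const 1))))
        (ite (sub (add (var VoteReg.c0) (var VoteReg.c0)) len)
          (seq (emit (some false)) (assign VoteReg.i (add (var VoteReg.i) (const 1))))
          (assign VoteReg.fin (const 1))) : P).sem x Q s).ev φ)
    (fun s => Tree.ev_nonneg _ h0) ?_ x.length 0 0 0 0 (by omega) ⟨by simp, by simp⟩
    (s := (s.set VoteReg.c1 0).set VoteReg.c0 0) ?_
  · have e : α - (17 / 18 : ℝ) ^ x.length =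
        α - (3 / 2) ^ 0 / (3 / 2) ^ 0 * (17 / 18) ^ x.length := by norm_num
    rw [e]
    exact key
  · intro g b a1 a0 s hgb hlt ht hs
    have h1 : (sub (add (var VoteReg.c1) (var VoteReg.c1)) len : Expr R).eval s.reg x.length Q =
        a1 + a1 - x.length := by simp only [eval, hs.c1]
    have h2 : (sub (add (var VoteReg.c0) (var VoteReg.c0)) len : Expr R).eval s.reg x.length Q =
        a0 + a0 - x.length := by simp only [eval, hs.c0]
    have hti := ht.true
    have hfi := ht.false
    have hstep : ∀ c, Copying x t (o ++ [c]) (i + 1) 0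
        ((⟨s.reg, s.pos, s.out ++ [c]⟩ : S).set VoteReg.i (s.reg VoteReg.i + 1)) := fun c =>
      ⟨⟨by simpa using hs.hint, hs.pos, congrArg (· ++ [c]) hs.out⟩,
        by simp [hs.idx], by simpa using hs.fin⟩
    rcases hu : y[i]? with _ | _ | _
    · rw [hu, if_neg (by simp)] at hti hfi
      rw [sem_ite_of_eq (by rw [h1]; omega), sem_ite_of_eq (by rw [h2]; omega),
        sem_assign_of_le (by simp only [eval]; omega), Tree.ev_leaf]
      exact hnone hu _ ⟨⟨by simpa using hs.hint, hs.pos, hs.out⟩, by simpa using hs.idx,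
        by simp [eval]⟩
    · rw [hu] at hti hfi
      rw [if_neg (by simp)] at hti
      rw [if_pos rfl] at hfi
      rw [sem_ite_of_eq (by rw [h1]; omega), sem_ite_of_ne (by rw [h2]; omega),
        sem_seq_of_leaf rfl, sem_assign_of_le (by simp only [eval, hs.idx]; omega), Tree.ev_leaf]
      exact hsome _ hu _ (hstep _)
    · rw [hu] at hti hfi
      rw [if_pos rfl] at hti
      rw [sem_ite_of_ne (by rw [h1]; omega),
        sem_seq_of_leaf rfl, sem_assign_of_le (by simp only [eval, hs.idx]; omega), Tree.ev_leaf]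
      exact hsome _ hu _ (hstep _)
  · exact ⟨⟨by simpa using hs.hint, hs.pos, hs.out⟩, by simpa using hs.idx,
      by simpa using hs.fin, by simp, by simp⟩

theorem iterate_fin {x t : List Bool} {Q i : ℕ} {o : List (Option Bool)} {s : S}
    (hs : Copying x t o i 1 s) (m : ℕ) :
    Tree.iterate ((ite (var VoteReg.fin) skip (voteBit A B)).sem x Q) m s = Tree.leaf s := by
  induction m with
  | zero => rfl
  | succ m ih =>
    rw [Tree.iterate, sem_ite_of_ne (by simp [eval, hs.fin]), sem, Tree.leaf_bind, ih]

/-- A union bound over the `k` remaining bits and the vote that detects the end. There are more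
rounds than bits; the rounds after the end are idle. -/
theorem ev_copying {x t y : List Bool} {Sz Q : ℕ} {o : List (Option Bool)}
    (h : Likely B x t y Sz Q) {α : ℝ} (hα1 : α ≤ 1) {φ : S → ℝ} (h0 : ∀ s, 0 ≤ φ s)
    (hα : ∀ s, Hinted x t (o ++ y.map some) s → α ≤ φ s) (m i k : ℕ) (hk : i + k = y.length)
    (hm : k < m) {s : S} (hs : Copying x t (o ++ (y.take i).map some) i 0 s) :
    α - (k + 1) * (17 / 18) ^ x.length ≤
      (Tree.iterate ((ite (var VoteReg.fin) skip (voteBit A B)).sem x Q) m s).ev φ := by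
  have hQ := h.length_out
  induction m generalizing i k s with
  | zero => omega
  | succ m ih =>
    rw [Tree.iterate, sem_ite_of_eq (by simp [eval, hs.fin]), Tree.ev_bind]
    have hp : (0 : ℝ) ≤ (17 / 18) ^ x.length := by positivity
    have := ev_voteBit h (i := i) (by omega) (α := α - k * (17 / 18) ^ x.length)
      (by have : (0 : ℝ) ≤ k * (17 / 18) ^ x.length := by positivity
          linarith)
      (φ := fun s => (Tree.iterate
        ((ite (var VoteReg.fin) skip (voteBit A B)).sem x Q) m s).ev φ)
      (fun s => Tree.ev_nonneg _ h0) hs ?_ ?_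
    · linarith
    · intro b hb s' hs'
      obtain ⟨hlt, hbi⟩ := List.getElem?_eq_some_iff.1 hb
      obtain ⟨k, rfl⟩ : ∃ k', k = k' + 1 := ⟨k - 1, by omega⟩
      rw [Nat.cast_succ]
      refine ih (i + 1) k (by omega) (by omega) ?_
      rw [List.take_add_one, hb]
      simpa using hs'
    · intro hn s' hs'
      have hlen := List.getElem?_eq_none_iff.1 hn
      rw [iterate_fin hs', Tree.ev_leaf]
      have hk0 : k = 0 := by omega
      subst hk0
      rw [List.take_of_length_le hlen] at hs'
      simpa using hα s' hs'.toHinted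

theorem ev_copyOutput {x t y : List Bool} {Sz Q : ℕ} {o : List (Option Bool)}
    (h : Likely B x t y Sz Q) {α : ℝ} (hα1 : α ≤ 1) {φ : S → ℝ} (h0 : ∀ s, 0 ≤ φ s)
    (hα : ∀ s, Hinted x t (o ++ y.map some) s → α ≤ φ s) {s : S} (hs : Hinted x t o s) :
    α - (y.length + 1) * (17 / 18) ^ x.length ≤ ((copyOutput A B).sem x Q s).ev φ := by
  rw [copyOutput, sem_seq_of_leaf (sem_assign_of_le (Nat.zero_le _)),
    sem_seq_of_leaf (sem_assign_of_le (Nat.zero_le _))]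
  refine ev_copying h hα1 h0 hα Q 0 y.length (by omega) h.length_out ?_
  exact ⟨⟨by simpa using hs.hint, hs.pos, by simpa using hs.out⟩, by simp [eval], by simp [eval]⟩

/-- Given a good hint, each copy fails with probability at most `q`, since `y.length + 1 ≤ Q`. Both
copies are made from the same hint and are compared with the same `y`. -/
theorem ev_twoCopies {x : List Bool} {Sz Q L : ℕ} (hA : A.Fits x Sz Q) (hL : 2 ^ (L + 1) ≤ Q)
    (good valid : List Bool → Prop)
    (hgood : ∀ t, good t → t.length ≤ L ∧ ∃ y, valid y ∧ ∃ Sz, Likely B x t y Sz Q) :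
    (iterTree (fun c b => A.step x b c) Q A.init).ev (fun c => ind (good c.output)) -
        2 * (Q * (17 / 18) ^ x.length) ≤
      ((twoCopies A B).sem x Q (start R (Option Bool))).ev
        fun s => ind (∃ y, valid y ∧ s.out = encodePair y y) := by
  set q : ℝ := Q * (17 / 18) ^ x.length with hq
  have hq0 : 0 ≤ q := by positivity
  rw [twoCopies, ev_seq]
  refine le_trans ?_ (ev_gather hA hL
    (ψ := fun t => ind (good t) * max (1 - 2 * q) 0) (fun s => Tree.ev_nonneg _ fun _ =>
      ind_nonneg _) ?_ ?_)
  · have h1 : (iterTree (fun c b => A.step x b c) Q A.init).ev (fun c => ind (good c.output)) ≤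
        1 := Tree.ev_le_one _ fun _ => ind_le_one _
    have h2 : 0 ≤ (iterTree (fun c b => A.step x b c) Q A.init).ev
        (fun c => ind (good c.output)) := Tree.ev_nonneg _ fun _ => ind_nonneg _
    simp only [mul_comm _ (max (1 - 2 * q) 0)]
    rw [Tree.ev_const_mul]
    nlinarith [le_max_left (1 - 2 * q) 0]
  · intro w hw
    have : ¬good w := fun h => by have := (hgood w h).1; omega
    simp [ind_false this]
  · intro t s ht hs
    by_cases hg : good t
    · obtain ⟨-, y, hval, Sz, hy⟩ := hgood t hg
      have hyq : (y.length + 1) * (17 / 18 : ℝ) ^ x.length ≤ q := by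
        refine mul_le_mul_of_nonneg_right ?_ (by positivity)
        exact_mod_cast hy.length_out
      rw [ind_true hg, one_mul]
      refine max_le ?_ (Tree.ev_nonneg _ fun _ => ind_nonneg _)
      rw [ev_seq]
      refine le_trans ?_ (ev_copyOutput hy (α := 1 - q) (by linarith) (o := [])
        (fun s => Tree.ev_nonneg _ fun _ => ind_nonneg _) ?_ hs)
      · linarith
      · intro s' hs'
        rw [sem_seq_of_leaf rfl]
        refine le_trans ?_ (ev_copyOutput hy (α := 1) le_rfl (o := y.map some ++ [none])
          (fun s => ind_nonneg _) ?_ (s := ⟨s'.reg, s'.pos, s'.out ++ [none]⟩)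
          ⟨hs'.hint, hs'.pos, congrArg (· ++ [none]) hs'.out⟩)
        · linarith
        · intro s2 hs2
          rw [ind_true]
          refine ⟨y, hval, ?_⟩
          rw [hs2.out, encodePair]
          simp
    · rw [ind_false hg, zero_mul]
      exact Tree.ev_nonneg _ fun _ => ind_nonneg _

end Amplify

/-! ### From success probability 2/3 to two copies -/

theorem tendsto_pow_mul_pow (d : ℕ) :
    Tendsto (fun n : ℕ => ((n + 2 : ℕ) ^ d : ℝ) * (17 / 18) ^ n) atTop (𝓝 0) := by
  have h := ((tendsto_pow_const_mul_const_pow_of_abs_lt_one d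
    (r := 17 / 18) (by rw [abs_lt]; constructor <;> norm_num)).comp
      (tendsto_add_atTop_nat 2)).mul_const ((17 / 18 : ℝ) ^ 2)⁻¹
  rw [zero_mul] at h
  refine h.congr fun n => ?_
  simp only [Function.comp]
  rw [pow_add]
  field_simp

theorem hasTwoCopies_of_twoThirds {R : SearchProblem} (h : LogSpaceReproducibleTwoThirds R) :
    HasTwoCopies R := by
  obtain ⟨ε, hε, A, B, hA, hB, c, h⟩ := h
  obtain ⟨dA, hdA⟩ := hA.exists_fits
  obtain ⟨dB, hdB⟩ := hB.exists_fits
  -- The cap has to accommodate the configurations of `A`, the number of a hint of length `L`, and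
  -- the configurations of `B` on the pair, whose length is at most `(n + 2) ^ (c + 4)`.
  set d := dA + (c + 4) * (dB + 1) + 4 * c + 8 with hd
  obtain ⟨C, hC, hCprob⟩ := (twoCopies A B).exists_transducer d (by omega)
  refine ⟨C, hC, fun n => ε n + 2 * ((n + 2 : ℕ) ^ d * (17 / 18) ^ n), ?_, fun x hx => ?_⟩
  · simpa using hε.add ((tendsto_pow_mul_pow d).const_mul 2)
  · set n := x.length with hn
    set L := c * (Nat.log 2 n + 1) with hL
    obtain ⟨SA, hSA⟩ := hdA x
    have hLpow : 2 ^ (L + 1) ≤ (n + 2) ^ d := by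
      rw [pow_succ]
      calc 2 ^ L * 2 ≤ (n + 2) ^ (2 * 2 * c) * (n + 2) ^ 1 :=
            Nat.mul_le_mul (pow_log_le 2 c n) (by rw [pow_one]; omega)
        _ = (n + 2) ^ (2 * 2 * c + 1) := (pow_add _ _ _).symm
        _ ≤ _ := pow_mono_exp _ (by nlinarith)
    have hAfit : A.Fits x SA ((n + 2) ^ d) := hSA.mono (pow_mono_exp _ (by nlinarith))
    have hlen : n + 2 ≤ (n + 2) ^ d := Nat.le_self_pow (by omega) _
    have hpair : ∀ t : List Bool, t.length ≤ L →
        (encodePair x t).length + 2 ≤ (n + 2) ^ (c + 4) := by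
      intro t ht
      rw [length_encodePair]
      have hlog : Nat.log 2 n ≤ n := Nat.log_le_self 2 n
      have h1 : x.length + 1 + t.length + 2 ≤ (c + 3) * (n + 2) := by
        have : L ≤ c * (n + 2) := Nat.mul_le_mul_left _ (by omega)
        nlinarith
      refine h1.trans ((Nat.mul_le_mul_right _ (const_le_pow n (c + 3))).trans ?_)
      rw [← pow_succ]
    have hfitB : ∀ t : List Bool, t.length ≤ L →
        ∃ Sz, B.Fits (encodePair x t) Sz ((n + 2) ^ ((c + 4) * (dB))) := by
      intro t ht
      obtain ⟨Sz, hSz⟩ := hdB (encodePair x t)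
      refine ⟨Sz, hSz.mono ?_⟩
      rw [pow_mul]
      exact Nat.pow_le_pow_left (hpair t ht) _
    have hmono : (n + 2) ^ ((c + 4) * dB) < (n + 2) ^ d :=
      Nat.pow_lt_pow_right (by omega) (by nlinarith)
    have key := ev_twoCopies (B := B) hAfit hLpow
      (fun t => t.length ≤ L ∧ Reproduces R B (1 / 3) x t) (fun y => R x y) ?_
    · rw [← A.prob_outputs x hAfit.halts fun t => t.length ≤ L ∧ Reproduces R B (1 / 3) x t] at key
      have h1 := h x hx
      have h2 := hCprob x fun w => ∃ y, R x y ∧ w = encodePair y y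
      have h3 : (fun r => ∃ w, C.Outputs x r w ∧ ∃ y, R x y ∧ w = encodePair y y) =
          fun r => ∃ y, R x y ∧ C.Outputs x r (encodePair y y) := by
        funext r
        refine propext ⟨?_, ?_⟩
        · rintro ⟨_, h1, y, h2, rfl⟩
          exact ⟨y, h2, h1⟩
        · rintro ⟨y, h2, h1⟩
          exact ⟨_, h1, y, h2, rfl⟩
      rw [h3] at h2
      rw [h2]
      refine le_trans ?_ key
      push_cast at h1 ⊢
      linarith
    · rintro t ⟨ht, y, hRy, hy⟩
      obtain ⟨Sz, hSz⟩ := hfitB t ht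
      refine ⟨ht, y, hRy, Sz, hSz.mono hmono.le, ?_, ?_, hlen, ?_⟩
      · exact (Nat.pow_le_pow_right (by omega) (by omega)).trans hLpow
      · refine lt_of_le_of_lt ?_ hmono
        -- A word longer than the running time of `B` would be output with probability zero, which
        -- contradicts probability at least 2/3.
        by_contra hlt
        have : (fun r => B.Outputs (encodePair x t) r y) = fun _ => False := by
          funext r
          exact propext ⟨fun hr => hlt (Transducer.length_le_of_outputs (hSz.halts r) hr),
            False.elim⟩
        rw [this, prob_const, ind_false not_false] at hy
        norm_num at hy
      · have h3 := B.prob_outputs (encodePair x t) (hSz.mono hmono.le).halts fun w => w = y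
        simp only [exists_eq_right] at h3
        rw [← h3]
        linarith


/-! ### Stopping a transducer at the comma -/

namespace Transducer

variable {I O : Type} {M : Transducer I O}

/-- From `c`, the machine halts within `m` steps. -/
def HaltsWithin (M : Transducer I O) (x : List I) (m : ℕ) (c : M.Config) : Prop :=
  (iterTree (fun c b => M.step x b c) m c).All fun c => M.halt c.state

theorem HaltsWithin.succ {x : List I} {m : ℕ} {c : M.Config} (h : M.HaltsWithin x m c) :
    M.HaltsWithin x (m + 1) c := by
  induction m generalizing c with
  | zero =>
    intro b
    change M.halt (M.step x b c).state
    rw [M.step_of_halt x b c h]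
    exact h
  | succ m ih => exact fun b => ih (h b)

theorem HaltsWithin.step {x : List I} {m : ℕ} {c : M.Config} (h : M.HaltsWithin x m c)
    (b : Bool) : M.HaltsWithin x m (M.step x b c) := h.succ b

theorem HaltsWithin.ev_succ {x : List I} {m : ℕ} {c : M.Config} (h : M.HaltsWithin x m c)
    (ψ : M.Config → ℝ) : (iterTree (fun c b => M.step x b c) (m + 1) c).ev ψ =
      (iterTree (fun c b => M.step x b c) m c).ev ψ := by
  induction m generalizing c with
  | zero =>
    simp only [iterTree, Tree.ev_node, M.step_of_halt x _ c h, Tree.ev_leaf]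
    ring
  | succ m ih =>
    rw [iterTree, iterTree, Tree.ev_node, Tree.ev_node, ih (h true), ih (h false)]

theorem HaltsWithin.ev_eq {x : List I} {m m' : ℕ} {c : M.Config} (h : M.HaltsWithin x m c)
    (hm : m ≤ m') (ψ : M.Config → ℝ) : (iterTree (fun c b => M.step x b c) m' c).ev ψ =
      (iterTree (fun c b => M.step x b c) m c).ev ψ := by
  have key : M.HaltsWithin x m' c ∧ (iterTree (fun c b => M.step x b c) m' c).ev ψ =
      (iterTree (fun c b => M.step x b c) m c).ev ψ := by
    induction m', hm using Nat.le_induction with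
    | base => exact ⟨h, rfl⟩
    | succ m' _ ih => exact ⟨ih.1.succ, (ih.1.ev_succ ψ).trans ih.2⟩
  exact key.2

open Classical in
/-- A step of the machine that stops in configurations where `p` holds. -/
noncomputable def stoppedStep (M : Transducer I O) (x : List I) (p : M.Config → Prop)
    (c : M.Config) (b : Bool) : M.Config := if p c then c else M.step x b c

/-- The outcome of a computation can be determined by stopping and resuming it. -/
theorem HaltsWithin.ev_stopped {x : List I} {Q : ℕ} (p : M.Config → Prop) (ψ : M.Config → ℝ)
    (m : ℕ) {c : M.Config} (h : M.HaltsWithin x Q c) :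
    (iterTree (M.stoppedStep x p) m c).ev
        (fun c => (iterTree (fun c b => M.step x b c) Q c).ev ψ) =
      (iterTree (fun c b => M.step x b c) Q c).ev ψ := by
  induction m generalizing c with
  | zero => rfl
  | succ m ih =>
    rw [iterTree, Tree.ev_node]
    by_cases hp : p c
    · simp only [stoppedStep, if_pos hp]
      rw [ih h]
      ring
    · simp only [stoppedStep, if_neg hp]
      -- Resuming takes `Q` steps from any point, so a step made before stopping is one step too
      -- many; it is harmless because the machine halts within `Q` steps anyway.
      rw [ih (h.step true), ih (h.step false), ← h.ev_succ, iterTree, Tree.ev_node]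

/-- Before `p` holds, the stopped process agrees with the machine, which halts within `m` steps;
once `p` holds, it stays put. -/
theorem HaltsWithin.stopped {x : List I} (p : M.Config → Prop) {m : ℕ} {c : M.Config}
    (h : M.HaltsWithin x m c) :
    (iterTree (M.stoppedStep x p) m c).All fun c => p c ∨ M.halt c.state := by
  induction m generalizing c with
  | zero => exact Or.inr h
  | succ m ih =>
    intro b
    by_cases hp : p c
    · have key : ∀ m, (iterTree (M.stoppedStep x p) m c).All p := by
        intro m
        induction m with
        | zero => exact hp
        | succ m ih =>
          intro b
          simp only [stoppedStep, if_pos hp]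
          exact ih
      simp only [stoppedStep, if_pos hp]
      exact (key m).mono fun _ => Or.inl
    · simp only [stoppedStep, if_neg hp]
      exact ih (h b)

/-- The output only grows. -/
theorem prefix_output (x : List I) (m : ℕ) (c : M.Config) :
    (iterTree (fun c b => M.step x b c) m c).All fun c' => c.output <+: c'.output := by
  induction m generalizing c with
  | zero => exact List.prefix_rfl
  | succ m ih =>
    intro b
    refine (ih (M.step x b c)).mono fun c' hc' => List.IsPrefix.trans ?_ hc'
    unfold step
    split_ifs
    · exact List.prefix_rfl
    · exact List.prefix_append _ _

end Transducer

/-- If a mean of numbers in `[0, 1]` is close to one, then most of them are. -/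
theorem ev_ind_ge {α : Type} (T : Tree α) (H : α → ℝ) (h1 : ∀ a, H a ≤ 1) {ε δ : ℝ}
    (hδ : 0 < δ) (hε : ε ≤ δ ^ 2) (h : 1 - ε ≤ T.ev H) :
    1 - δ ≤ T.ev fun a => ind (1 - δ ≤ H a) := by
  have h2 : T.ev H ≤ T.ev fun a => (1 - δ) + δ * ind (1 - δ ≤ H a) := by
    refine Tree.ev_mono _ fun a => ?_
    by_cases ha : 1 - δ ≤ H a
    · rw [ind_true ha]
      linarith [h1 a]
    · rw [ind_false ha]
      linarith
  rw [Tree.ev_add, Tree.ev_const, Tree.ev_const_mul] at h2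
  -- With `P` for the expectation on the right, `h2` and `h` give `δ * (1 - P) ≤ ε ≤ δ ^ 2`, and `δ`
  -- can be cancelled.
  nlinarith

/-! ### Packing numbers into one number -/

def packNum (K : ℕ) : List ℕ → ℕ
  | [] => 0
  | a :: l => a + K * packNum K l

theorem packNum_lt {K : ℕ} (l : List ℕ) (h : ∀ a ∈ l, a < K) : packNum K l < K ^ l.length := by
  induction l with
  | nil => simp [packNum]
  | cons a l ih =>
    have h1 := h a List.mem_cons_self
    have h2 := ih fun b hb => h b (List.mem_cons_of_mem _ hb)
    rw [packNum, List.length_cons, pow_succ]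
    nlinarith

namespace Expr

variable {V : Type}

def pow (e : Expr V) : ℕ → Expr V
  | 0 => const 1
  | d + 1 => mul (pow e d) e

@[simp] theorem eval_pow (r : V → ℕ) (n Q : ℕ) (e : Expr V) (d : ℕ) :
    (pow e d).eval r n Q = e.eval r n Q ^ d := by
  induction d with
  | zero => rfl
  | succ d ih => rw [pow, eval, ih, pow_succ]

def pack (K : Expr V) : List V → Expr V
  | [] => const 0
  | v :: l => add (var v) (mul K (pack K l))

theorem eval_pack (r : V → ℕ) (n Q : ℕ) (K : Expr V) (l : List V) :
    (pack K l).eval r n Q = packNum (K.eval r n Q) (l.map r) := by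
  induction l with
  | nil => rfl
  | cons v l ih => rw [pack, eval, List.map_cons, packNum, ← ih]; rfl

end Expr

namespace Prog

variable {V I O : Type} [DecidableEq V]

/-- Unpack the register `z`. -/
def unpack (K : Expr V) (z : V) : List V → Prog V I O
  | [] => skip
  | v :: l => seq (assign v (Expr.mod (Expr.var z) K))
      (seq (assign z (Expr.div (Expr.var z) K)) (unpack K z l))

/-- The base `K` is evaluated anew for each component, so `hK` demands that its value be unaffected
by the registers that are being overwritten. -/
theorem sem_unpack {x : List I} {Q k : ℕ} {z : V} {K : Expr V} (ρ : V → ℕ) (l : List V)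
    (hl : l.Nodup) (hz : z ∉ l) (hρ : ∀ v ∈ l, ρ v < k) (hk : k ≤ Q) {s : Store V O}
    (hK : ∀ s' : Store V O, (∀ v, v ∉ l → v ≠ z → s'.reg v = s.reg v) →
      K.eval s'.reg x.length Q = k)
    (hs : s.reg z = packNum k (l.map ρ)) (hQ : packNum k (l.map ρ) ≤ Q) :
    ∃ s' : Store V O, (unpack K z l).sem x Q s = Tree.leaf s' ∧ (∀ v ∈ l, s'.reg v = ρ v) ∧
      (∀ v, v ∉ l → v ≠ z → s'.reg v = s.reg v) ∧ s'.pos = s.pos ∧ s'.out = s.out := by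
  induction l generalizing s with
  | nil => exact ⟨s, rfl, by simp, fun _ _ _ => rfl, rfl, rfl⟩
  | cons v l ih =>
    rw [List.map_cons, packNum] at hs hQ
    have hv := hρ v List.mem_cons_self
    have hzv : z ≠ v := fun h => hz (h ▸ List.mem_cons_self)
    have hvl := (List.nodup_cons.1 hl).1
    have e1 : (Expr.mod (Expr.var z) K).eval s.reg x.length Q = ρ v := by
      rw [Expr.eval_mod, hK s fun _ _ _ => rfl]
      simp only [Expr.eval]
      rw [hs, Nat.add_mul_mod_self_left, Nat.mod_eq_of_lt hv]
    have e2 : (Expr.div (Expr.var z) K).eval (s.set v (ρ v)).reg x.length Q =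
        packNum k (l.map ρ) := by
      simp only [Expr.eval]
      rw [hK (s.set v (ρ v)) fun u hu _ => by
        rw [Store.reg_set, if_neg (fun h => hu (List.mem_cons.2 (Or.inl h)))]]
      rw [Store.reg_set, if_neg hzv, hs, Nat.add_mul_div_left _ _ (by omega),
        Nat.div_eq_of_lt hv, zero_add]
    have hle : packNum k (l.map ρ) ≤ Q := by
      refine le_trans ?_ hQ
      have : 1 ≤ k := by omega
      nlinarith
    obtain ⟨s', h1, h2, h3, h4, h5⟩ := ih (List.nodup_cons.1 hl).2
      (fun h => hz (List.mem_cons_of_mem _ h)) (fun u hu => hρ u (List.mem_cons_of_mem _ hu))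
      (s := (s.set v (ρ v)).set z (packNum k (l.map ρ)))
      (fun s' hs' => hK s' fun u hu huz => by
        rw [hs' u (fun h => hu (List.mem_cons_of_mem _ h)) huz, Store.reg_set, if_neg huz,
          Store.reg_set, if_neg (fun h => hu (List.mem_cons.2 (Or.inl h)))])
      (by rw [Store.reg_set, if_pos rfl]) hle
    refine ⟨s', ?_, ?_, ?_, h4, h5⟩
    · rw [unpack, sem_seq_of_leaf ((sem_assign_of_le (by rw [e1]; omega)).trans (by rw [e1])),
        sem_seq_of_leaf ((sem_assign_of_le (by rw [e2]; exact hle)).trans (by rw [e2])), h1]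
    · intro u hu
      rcases List.mem_cons.1 hu with rfl | hu
      · rw [h3 u hvl hzv.symm, Store.reg_set, if_neg hzv.symm, Store.reg_set, if_pos rfl]
      · exact h2 u hu
    · intro u hu huz
      rw [h3 u (fun h => hu (List.mem_cons_of_mem _ h)) huz, Store.reg_set, if_neg huz,
        Store.reg_set, if_neg (fun h => hu (List.mem_cons.2 (Or.inl h)))]

end Prog

/-! ### From two copies to short hints -/

/-- Every positive number can thus be sent as a word, and its leading one need not be transmitted.
-/
theorem exists_wordNum (m : ℕ) (hm : 1 ≤ m) : ∃ t, wordNum t = m := by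
  induction m using Nat.strong_induction_on with
  | _ m ih =>
    rcases Nat.lt_or_ge m 2 with h | h
    · exact ⟨[], by simp only [wordNum]; omega⟩
    · obtain ⟨t, ht⟩ := ih (m / 2) (by omega) (by omega)
      refine ⟨decide (m % 2 = 1) :: t, ?_⟩
      rw [wordNum, ht]
      by_cases h1 : m % 2 = 1
      · simp only [h1, decide_true, Bool.toNat_true]; omega
      · simp only [h1, decide_false, Bool.toNat_false]; omega

theorem two_pow_length_le_wordNum (t : List Bool) : 2 ^ t.length ≤ wordNum t := by
  induction t with
  | nil => exact le_rfl
  | cons b t ih => simp only [List.length_cons, pow_succ, wordNum]; omega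

/-- The registers for passing on a configuration: its representation, its head position `hp`, and
for the hint a number `z` together with the next power of two `pt`, the length `nx` of the
original input, and a flag `ph` for the comma. -/
inductive CutReg (k : ℕ) where
  | sim (r : SimReg k)
  | hp
  | z
  | pt
  | nx
  | ph
  deriving DecidableEq

instance {k : ℕ} : Finite (CutReg k) := by
  refine Finite.of_surjective (α := SimReg k ⊕ Fin 5)
    (fun u => match u with
      | Sum.inl r => CutReg.sim r
      | Sum.inr 0 => CutReg.hp
      | Sum.inr 1 => CutReg.z
      | Sum.inr 2 => CutReg.pt
      | Sum.inr 3 => CutReg.nx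
      | Sum.inr 4 => CutReg.ph) ?_
  rintro (r | _ | _ | _ | _ | _)
  exacts [⟨Sum.inl r, rfl⟩, ⟨Sum.inr 0, rfl⟩, ⟨Sum.inr 1, rfl⟩, ⟨Sum.inr 2, rfl⟩,
    ⟨Sum.inr 3, rfl⟩, ⟨Sum.inr 4, rfl⟩]

theorem CutReg.sim_injective {k : ℕ} :
    Function.Injective (CutReg.sim : SimReg k → CutReg k) := fun _ _ h => by cases h; rfl

/-- The registers that make up a configuration. -/
def configRegs (k : ℕ) : List (CutReg k) :=
  CutReg.hp :: CutReg.sim SimReg.st :: ((List.finRange k).map fun i => CutReg.sim (SimReg.num i)) ++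
    (List.finRange k).map fun i => CutReg.sim (SimReg.wt i)

theorem length_configRegs (k : ℕ) : (configRegs k).length = 2 * k + 2 := by
  simp [configRegs]; omega

theorem nodup_configRegs (k : ℕ) : (configRegs k).Nodup := by
  unfold configRegs
  simp only [List.cons_append, List.nodup_cons, List.mem_cons, List.mem_append, List.mem_map]
  refine ⟨by simp, by simp, ?_⟩
  refine List.Nodup.append (List.Nodup.map ?_ (List.nodup_finRange _))
    (List.Nodup.map ?_ (List.nodup_finRange _)) ?_
  · intro i j h; simpa using h
  · intro i j h; simpa using h
  · intro v hv hv'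
    simp only [List.mem_map] at hv hv'
    obtain ⟨i, -, rfl⟩ := hv
    obtain ⟨j, -, h⟩ := hv'
    simp at h

theorem mem_configRegs {k : ℕ} (v : CutReg k) :
    v ∈ configRegs k ↔ v = CutReg.hp ∨ ∃ r, v = CutReg.sim r := by
  unfold configRegs
  simp only [List.cons_append, List.mem_cons, List.mem_append, List.mem_map, List.mem_finRange,
    true_and]
  constructor
  · rintro (h | h | ⟨i, h⟩ | ⟨i, h⟩)
    exacts [Or.inl h, Or.inr ⟨_, h⟩, Or.inr ⟨_, h.symm⟩, Or.inr ⟨_, h.symm⟩]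
  · rintro (h | ⟨_ | i | i, rfl⟩)
    exacts [Or.inl h, Or.inr (Or.inl rfl), Or.inr (Or.inr (Or.inl ⟨i, rfl⟩)),
      Or.inr (Or.inr (Or.inr ⟨i, rfl⟩))]

/-- The contents of the registers for a configuration. -/
noncomputable def configNum {I O : Type} {M : Transducer I O} (S : ℕ) (c : M.Config) :
    CutReg M.tapes → ℕ
  | CutReg.hp => c.inputHead
  | CutReg.sim SimReg.st => M.stCode c.state
  | CutReg.sim (SimReg.num i) => Transducer.tapeNum S c i
  | CutReg.sim (SimReg.wt i) => M.base ^ c.head i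
  | _ => 0


/-! ### The program that outputs the configuration at the comma -/

section Hint

open RandLogSpace.Prog RandLogSpace.Expr

variable (C : Transducer Bool (Option Bool))

/-- Move the head of the input tape to the left end and count the steps. -/
def countLeft (k : ℕ) : Prog (CutReg k) Bool Bool :=
  loop (add len (const 1)) (sym fun a => match a with
    | InSym.leftEnd => skip
    | _ => seq (move Move.left) (assign CutReg.hp (add (var CutReg.hp) (const 1))))

/-- Output the digits of the number `z`, except for the leading one. -/
def dump (k : ℕ) : Prog (CutReg k) Bool Bool :=
  loop cap (ite (sub (var CutReg.z) (const 1))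
    (seq (ite (mod (var CutReg.z) (const 2)) (emit true) (emit false))
      (assign CutReg.z (div (var CutReg.z) (const 2)))) skip)

/-- Simulate `C` up to the comma. -/
noncomputable def firstHalf : Prog (CutReg C.tapes) Bool Bool :=
  loop cap (ite (var CutReg.ph) (flip fun _ => skip)
    (Transducer.simStep C CutReg.sim sym move fun o => match o with
      | some _ => skip
      | none => assign CutReg.ph (const 1)))

/-- Run `C` up to the comma and output the configuration. -/
noncomputable def cutHint (d : ℕ) : Prog (CutReg C.tapes) Bool Bool :=
  seq (Transducer.initProg C CutReg.sim) (seq (firstHalf C) (seq (countLeft C.tapes)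
    (seq (assign CutReg.z (add (pack (lenPow d) (configRegs C.tapes)) (const 1)))
      (dump C.tapes))))

/-- The simulation uses the real input head for that of `C`, so its position is in no register and
has to be measured before it can become part of the hint. -/
theorem sem_countLeft {k : ℕ} {x : List Bool} {Q : ℕ} {s : Store (CutReg k) Bool}
    (hs : s.reg CutReg.hp = 0) (hp : s.pos ≤ x.length + 1) (hQ : x.length + 1 ≤ Q) :
    ∃ s', (countLeft k).sem x Q s = Tree.leaf s' ∧ s'.reg CutReg.hp = s.pos ∧
      (∀ v, v ≠ CutReg.hp → s'.reg v = s.reg v) ∧ s'.out = s.out := by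
  set c : Prog (CutReg k) Bool Bool := sym fun a => match a with
    | InSym.leftEnd => skip
    | _ => seq (move Move.left) (assign CutReg.hp (add (var CutReg.hp) (const 1))) with hc
  have key : ∀ m (s : Store (CutReg k) Bool), s.pos ≤ m → s.reg CutReg.hp + s.pos ≤ Q →
      ∃ s', Tree.iterate (c.sem x Q) m s = Tree.leaf s' ∧
        s'.reg CutReg.hp = s.reg CutReg.hp + s.pos ∧
        (∀ v, v ≠ CutReg.hp → s'.reg v = s.reg v) ∧ s'.out = s.out := by
    intro m
    induction m with
    | zero => exact fun s h _ => ⟨s, rfl, by omega, fun _ _ => rfl, rfl⟩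
    | succ m ih =>
      intro s h1 h2
      rw [Tree.iterate, hc, sem]
      cases hpos : s.pos with
      | zero =>
        obtain ⟨s', h3, h4, h5, h6⟩ := ih s (by omega) h2
        refine ⟨s', ?_, by omega, h5, h6⟩
        simp only [inputSymbol]
        rw [sem, Tree.leaf_bind, h3]
      | succ p =>
        obtain ⟨s', h3, h4, h5, h6⟩ := ih
          ((⟨s.reg, p, s.out⟩ : Store (CutReg k) Bool).set CutReg.hp (s.reg CutReg.hp + 1))
          (by simp only [Store.pos_set]; omega) (by simp; omega)
        refine ⟨s', ?_, ?_, fun v hv => ?_, h6⟩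
        · have hmove : ∀ a : InSym Bool, a ≠ InSym.leftEnd → (match a with
              | InSym.leftEnd => skip
              | _ => seq (move Move.left) (assign CutReg.hp (add (var CutReg.hp) (const 1))) :
                Prog (CutReg k) Bool Bool) =
              seq (move Move.left) (assign CutReg.hp (add (var CutReg.hp) (const 1))) := by
            intro a ha
            cases a <;> simp at ha ⊢
          have hsym : inputSymbol x (p + 1) ≠ InSym.leftEnd := by
            rcases lt_or_ge p x.length with hlt | hge
            · rw [inputSymbol_of_lt x hlt]; simp
            · rw [inputSymbol_end x hge]; simp
          rw [hmove _ hsym, sem_seq_of_leaf rfl, sem_assign_of_le (by simp only [eval]; omega),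
            Tree.leaf_bind, ← h3, hpos]
          rfl
        · rw [h4]
          simp
          omega
        · rw [h5 v hv]
          simp [hv]
  obtain ⟨s', h1, h2, h3, h4⟩ := key (x.length + 1) s hp (by omega)
  exact ⟨s', h1, by omega, h3, h4⟩

theorem sem_dump {k : ℕ} {x : List Bool} {Q : ℕ} {s : Store (CutReg k) Bool} {t : List Bool}
    (hs : s.reg CutReg.z = wordNum t) (hQ : wordNum t ≤ Q) :
    ∃ s', (dump k).sem x Q s = Tree.leaf s' ∧ s'.out = s.out ++ t := by
  have key : ∀ (t : List Bool) m (s : Store (CutReg k) Bool), s.reg CutReg.z = wordNum t →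
      wordNum t ≤ Q → t.length ≤ m → ∃ s', Tree.iterate
        ((ite (sub (var CutReg.z) (const 1))
          (seq (ite (mod (var CutReg.z) (const 2)) (emit true) (emit false))
            (assign CutReg.z (div (var CutReg.z) (const 2)))) skip).sem x Q) m s =
        Tree.leaf s' ∧ s'.out = s.out ++ t := by
    intro t
    induction t with
    | nil =>
      intro m s hs _ _
      refine ⟨s, ?_, by simp⟩
      induction m with
      | zero => rfl
      | succ m ih =>
        rw [Tree.iterate, sem_ite_of_eq (by simp [eval, hs, wordNum]), sem, Tree.leaf_bind, ih]
        simp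
    | cons b t ih =>
      intro m s hs hQ hm
      obtain ⟨m, rfl⟩ : ∃ m', m = m' + 1 := ⟨m - 1, by simp at hm; omega⟩
      have hpos := wordNum_pos t
      rw [wordNum] at hs hQ
      have hdiv : (b.toNat + 2 * wordNum t) / 2 = wordNum t := by
        cases b <;> (simp only [Bool.toNat_true, Bool.toNat_false]; omega)
      have hmod : (mod (var CutReg.z) (const 2) : Expr (CutReg k)).eval s.reg x.length Q =
          b.toNat := by
        rw [eval_mod]
        simp only [eval, hs]
        cases b <;> (simp only [Bool.toNat_true, Bool.toNat_false]; omega)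
      obtain ⟨s', h1, h2⟩ := ih m
        ((⟨s.reg, s.pos, s.out ++ [b]⟩ : Store (CutReg k) Bool).set CutReg.z (wordNum t))
        (by simp) (by omega) (by simpa using hm)
      refine ⟨s', ?_, by rw [h2]; simp⟩
      have hemit : (ite (mod (var CutReg.z) (const 2)) (emit true) (emit false) :
          Prog (CutReg k) Bool Bool).sem x Q s = Tree.leaf ⟨s.reg, s.pos, s.out ++ [b]⟩ := by
        cases b
        · rw [sem_ite_of_eq (by rw [hmod]; rfl), sem]
        · rw [sem_ite_of_ne (by rw [hmod]; simp), sem]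
      rw [Tree.iterate, sem_ite_of_ne (by simp only [eval, hs]; omega), sem_seq_of_leaf hemit,
        sem_assign_of_le (by simp only [eval, hs]; omega), Tree.leaf_bind, ← h1]
      simp only [eval, hs, hdiv]
  exact key t Q s hs hQ (by have := two_pow_length_le_wordNum t
                            have := Nat.lt_two_pow_self (n := t.length)
                            omega)

variable {C}

/-- Properties of the configurations at the comma. -/
structure Halfway (C : Transducer Bool (Option Bool)) (x : List Bool) (S Q : ℕ) (c : C.Config) :
    Prop where
  safe : C.Safe x S c
  halts : C.HaltsWithin x Q c
  head : c.inputHead ≤ x.length + 1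
  comma : none ∈ c.output → ∃ w : List Bool, c.output = w.map some ++ [none]

theorem moveInput_le {n h : ℕ} (hh : h ≤ n + 1) (m : Move) : moveInput n h m ≤ n + 1 := by
  cases m <;> simp only [moveInput] <;> omega

theorem exists_map_some {l : List (Option Bool)} (h : none ∉ l) :
    ∃ w : List Bool, l = w.map some := by
  induction l with
  | nil => exact ⟨[], rfl⟩
  | cons a l ih =>
    obtain ⟨w, hw⟩ := ih fun h' => h (List.mem_cons_of_mem _ h')
    cases a with
    | none => simp at h
    | some a => exact ⟨a :: w, by rw [hw]; rfl⟩

/-- A step appends at most one symbol, so a comma that appears for the first time is the last symbol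
of the output. -/
theorem Halfway.step {x : List Bool} {S Q : ℕ} {c : C.Config} (h : Halfway C x S Q c)
    (hn : none ∉ c.output) (b : Bool) : Halfway C x S Q (C.step x b c) := by
  by_cases hh : C.halt c.state
  · rwa [C.step_of_halt x b c hh]
  · refine ⟨h.safe.step b, h.halts.step b, ?_, ?_⟩
    · rw [Transducer.step_of_not_halt hh]
      exact moveInput_le h.head _
    · rw [Transducer.step_of_not_halt hh]
      intro hmem
      obtain ⟨w, hw⟩ := exists_map_some hn
      refine ⟨w, ?_⟩
      simp only [List.mem_append, hn, false_or, Option.mem_toList] at hmem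
      simp only [hw]
      rw [Option.mem_def.1 hmem]
      rfl

/-- The flag `ph` is raised exactly when the comma has been printed. From then on each round wastes
a toss, just as the stopped process does, so the two can be compared round by round. -/
theorem ev_firstHalf {x : List Bool} {S Q : ℕ} (hS : C.base ^ S ≤ Q) (hQ : C.numStates ≤ Q)
    {s : Store (CutReg C.tapes) Bool} {c : C.Config} (hc : Halfway C x S Q c)
    (hn : none ∉ c.output) (hrep : Transducer.Rep CutReg.sim S c s.reg)
    (hpos : s.pos = c.inputHead) (hout : s.out = []) (hph : s.reg CutReg.ph = 0)
    (hhp : s.reg CutReg.hp = 0)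
    {ψ : C.Config → ℝ} {φ : Store (CutReg C.tapes) Bool → ℝ}
    (hle : ∀ c s, Halfway C x S Q c → none ∈ c.output ∨ C.halt c.state →
      Transducer.Rep CutReg.sim S c s.reg →
      s.pos = c.inputHead → s.out = [] → s.reg CutReg.hp = 0 → ψ c ≤ φ s) :
    (iterTree (C.stoppedStep x fun c => none ∈ c.output) Q c).ev ψ ≤
      ((firstHalf C).sem x Q s).ev φ := by
  have h1Q : 1 ≤ Q := (Nat.one_le_pow _ _ (by have := C.two_le_base; omega)).trans hS
  have hacc : Transducer.Access (M := C) CutReg.sim Q x x (sym (V := CutReg C.tapes) (O := Bool))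
      move (fun o => match o with
        | some _ => skip
        | none => assign CutReg.ph (const 1))
      fun h w s => s.pos = h ∧ s.out = [] ∧ s.reg CutReg.hp = 0 ∧
        (none ∉ w ∧ s.reg CutReg.ph = 0 ∨ none ∈ w ∧ s.reg CutReg.ph = 1) := by
    refine ⟨?_, ?_, ?_, ?_⟩
    · rintro h w s u ⟨j1, j2, j3, j4⟩ hf hp ho
      rw [hf _ fun i => by simp, hf _ fun i => by simp, hp, ho]
      exact ⟨j1, j2, j3, j4⟩
    · rintro h w s ⟨rfl, -⟩ f
      rfl
    · rintro h w s m ⟨rfl, j2, j3, j4⟩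
      exact ⟨_, rfl, fun _ => rfl, rfl, j2, j3, j4⟩
    · rintro h w s (_ | b) ⟨rfl, j2, j3, j4⟩
      · refine ⟨_, sem_assign_of_le (by simpa [eval] using h1Q), fun i => by simp, rfl, j2,
          by simpa using j3, Or.inr ⟨by simp, by simp [eval]⟩⟩
      · exact ⟨_, rfl, fun _ => rfl, rfl, j2, j3, by simpa using j4⟩
  refine ev_iterTree_le_iterate (fun c s => Halfway C x S Q c ∧
    Transducer.Rep CutReg.sim S c s.reg ∧ s.pos = c.inputHead ∧ s.out = [] ∧
    s.reg CutReg.hp = 0 ∧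
    (none ∉ c.output ∧ s.reg CutReg.ph = 0 ∨ none ∈ c.output ∧ s.reg CutReg.ph = 1)) ?_ Q
    ⟨hc, hrep, hpos, hout, hhp, Or.inl ⟨hn, hph⟩⟩
    ((hc.halts.stopped _).mono fun c hd s hs =>
      hle c s hs.1 hd hs.2.1 hs.2.2.1 hs.2.2.2.1 hs.2.2.2.2.1)
  rintro c s ⟨hc, hrep, j1, j2, j3, ⟨hn, hph⟩ | ⟨hn, hph⟩⟩
  · obtain ⟨σ, h1, h2⟩ := hacc.step CutReg.sim_injective hS hQ hc.safe hrep
      ⟨j1, j2, j3, Or.inl ⟨hn, hph⟩⟩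
    refine ⟨σ, by rw [sem_ite_of_eq (by simpa [eval] using hph), h1], fun b => ?_⟩
    rw [Transducer.stoppedStep, if_neg hn]
    exact ⟨hc.step hn b, (h2 b).1, (h2 b).2⟩
  · refine ⟨fun _ => s, by rw [sem_ite_of_ne (by simp [eval, hph]), sem]; rfl, fun b => ?_⟩
    rw [Transducer.stoppedStep, if_pos hn]
    exact ⟨hc, hrep, j1, j2, j3, Or.inr ⟨hn, hph⟩⟩

theorem configNum_lt {x : List Bool} {S Q k : ℕ} {c : C.Config} (h : Halfway C x S Q c)
    (hS : C.base ^ S ≤ k) (hk : C.numStates ≤ k) (hn : x.length + 2 ≤ k) (v : CutReg C.tapes) :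
    configNum S c v < k := by
  have hg := C.two_le_base
  rcases v with (_ | i | i) | _ | _ | _ | _ | _
  · exact (C.stCode_lt _).trans_le hk
  · exact (Transducer.tapeNum_lt S c i).trans_le hS
  · exact (Nat.pow_lt_pow_right (by omega) (h.safe.head_lt i)).trans_le hS
  · have := h.head
    simp only [configNum]
    omega
  all_goals simp only [configNum]; omega

theorem packNum_configNum_lt {x : List Bool} {S Q k : ℕ} {c : C.Config}
    (h : Halfway C x S Q c) (hS : C.base ^ S ≤ k) (hk : C.numStates ≤ k)
    (hn : x.length + 2 ≤ k) :
    packNum k ((configRegs C.tapes).map (configNum S c)) < k ^ (2 * C.tapes + 2) := by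
  have := packNum_lt (K := k) ((configRegs C.tapes).map (configNum S c)) (by
    intro a ha
    obtain ⟨v, -, rfl⟩ := List.mem_map.1 ha
    exact configNum_lt h hS hk hn v)
  rwa [List.length_map, length_configRegs] at this

theorem ev_cutHint {x : List Bool} {S Q d : ℕ} (hS : C.base ^ S ≤ (x.length + 2) ^ d)
    (hstates : C.numStates ≤ (x.length + 2) ^ d) (hd : 1 ≤ d) (hfit : C.Fits x S Q)
    (hQ : ((x.length + 2) ^ d) ^ (2 * C.tapes + 2) ≤ Q)
    {ψ : C.Config → ℝ} {φ : List Bool → ℝ}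
    (hle : ∀ c t, Halfway C x S Q c → none ∈ c.output ∨ C.halt c.state →
      wordNum t = packNum ((x.length + 2) ^ d) ((configRegs C.tapes).map (configNum S c)) + 1 →
      ψ c ≤ φ t) :
    (iterTree (C.stoppedStep x fun c => none ∈ c.output) Q C.init).ev ψ ≤
      ((cutHint C d).sem x Q (start (CutReg C.tapes) Bool)).ev fun s => φ s.out := by
  set k := (x.length + 2) ^ d with hk
  have hkQ : k ≤ Q := (Nat.le_self_pow (by omega) _).trans hQ
  have hn : x.length + 2 ≤ k := Nat.le_self_pow (by omega) _
  obtain ⟨s1, e1, hrep, hfr, hpos, hout⟩ := Transducer.sem_initProg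
    (emb := (CutReg.sim : _ → CutReg C.tapes)) CutReg.sim_injective hfit x
    (start (CutReg C.tapes) Bool)
  rw [cutHint, sem_seq_of_leaf e1, ev_seq]
  refine ev_firstHalf (hS.trans hkQ) (hstates.trans hkQ)
    ⟨hfit.safe, Transducer.iterTree_halt x hfit.halts, Nat.zero_le _, ?_⟩ ?_ hrep hpos hout
    (hfr _ fun i => by simp) (hfr _ fun i => by simp) ?_
  · simp [Transducer.init]
  · simp [Transducer.init]
  · intro c s hc hdone hrep hpos hout hhp
    obtain ⟨s2, e2, h1, h2, h3⟩ := sem_countLeft (Q := Q) hhp (hpos ▸ hc.head) (by omega)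
    have hregs : (configRegs C.tapes).map s2.reg = (configRegs C.tapes).map (configNum S c) := by
      refine List.map_congr_left fun v hv => ?_
      rcases (mem_configRegs v).1 hv with rfl | ⟨_ | i | i, rfl⟩
      · rw [h1, hpos]; rfl
      · rw [h2 _ (by simp), hrep.st]; rfl
      · rw [h2 _ (by simp), hrep.num]; rfl
      · rw [h2 _ (by simp), hrep.wt]; rfl
    -- The packed number may be zero, while numbers of words are positive; hence the `+ 1`.
    obtain ⟨t, ht⟩ := exists_wordNum (packNum k ((configRegs C.tapes).map (configNum S c)) + 1)
      (by omega)
    have hlt := packNum_configNum_lt hc hS hstates hn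
    have hz : (add (pack (lenPow d) (configRegs C.tapes)) (const 1) :
        Expr (CutReg C.tapes)).eval s2.reg x.length Q = wordNum t := by
      rw [eval, eval_pack, eval_lenPow, hregs, ht]
      rfl
    obtain ⟨s3, e3, h4⟩ := sem_dump (k := C.tapes) (x := x) (Q := Q) (t := t)
      (s := s2.set CutReg.z (wordNum t)) (by simp) (by omega)
    rw [sem_seq_of_leaf e2, sem_seq_of_leaf ((sem_assign_of_le (by rw [hz]; omega)).trans
      (by rw [hz])), e3, Tree.ev_leaf, h4]
    have : (s2.set CutReg.z (wordNum t)).out ++ t = t := by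
      change s2.out ++ t = t
      rw [h3, hout, List.nil_append]
    rw [this]
    exact hle c t hc hdone ht

end Hint


theorem Prog.iterate_move_right {V I O : Type} [DecidableEq V] (x : List I) (Q m : ℕ)
    (s : Store V O) (h : s.pos + m ≤ x.length + 1) :
    Tree.iterate ((move Move.right : Prog V I O).sem x Q) m s =
      Tree.leaf ⟨s.reg, s.pos + m, s.out⟩ := by
  induction m generalizing s with
  | zero => rfl
  | succ m ih =>
    have hp : moveInput x.length s.pos Move.right = s.pos + 1 := by
      simp only [moveInput]; omega
    rw [Tree.iterate, sem, Tree.leaf_bind, hp, ih _ (by simp only; omega)]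
    simp only [Nat.add_assoc, Nat.add_comm 1 m]

/-! ### The program that resumes from the hint -/

section Resume

open RandLogSpace.Prog RandLogSpace.Expr

/-- Store the length of the first component of the input in `nx`. -/
def readLength (k : ℕ) : Prog (CutReg k) (Option Bool) Bool :=
  loop len (sym fun a => match a with
    | InSym.symbol (some _) =>
      seq (assign CutReg.nx (add (var CutReg.nx) (const 1))) (move Move.right)
    | _ => skip)

/-- Store the number of the second component of the input in `z`. -/
def readHint (k : ℕ) : Prog (CutReg k) (Option Bool) Bool :=
  loop len (sym fun a => match a with
    | InSym.symbol (some b) => seq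
      (assign CutReg.z (add (var CutReg.z) (mul (const (1 + b.toNat)) (var CutReg.pt))))
      (seq (assign CutReg.pt (add (var CutReg.pt) (var CutReg.pt))) (move Move.right))
    | _ => skip)

variable (C : Transducer Bool (Option Bool))

/-- Read an input symbol of `C`, which works on the first component. -/
def readFirst (f : InSym Bool → Prog (CutReg C.tapes) (Option Bool) Bool) :
    Prog (CutReg C.tapes) (Option Bool) Bool :=
  sym fun a => match a with
    | InSym.leftEnd => f InSym.leftEnd
    | InSym.symbol (some b) => f (InSym.symbol b)
    | _ => f InSym.rightEnd

def moveFirst : Move → Prog (CutReg C.tapes) (Option Bool) Bool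
  | Move.left => move Move.left
  | Move.stay => skip
  | Move.right => sym fun a => match a with
    | InSym.symbol none => skip
    | _ => move Move.right

/-- Resume the computation of `C` from the configuration given by the hint. -/
noncomputable def cutResume (d : ℕ) : Prog (CutReg C.tapes) (Option Bool) Bool :=
  seq (move Move.right) (seq (readLength C.tapes) (seq (move Move.right)
    (seq (assign CutReg.z (const 1)) (seq (assign CutReg.pt (const 1)) (seq (readHint C.tapes)
      (seq (assign CutReg.z (sub (var CutReg.z) (const 1))) (seq rewind
        (seq (unpack (pow (add (var CutReg.nx) (const 2)) d) CutReg.z (configRegs C.tapes))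
          (seq (loop (var CutReg.hp) (move Move.right))
            (loop cap (Transducer.simStep C CutReg.sim (readFirst C) (moveFirst C) fun o =>
              match o with
              | some b => emit b
              | none => skip)))))))))))

/-- The base for unpacking is a power of `x.length + 2`, but the input of this program is the pair,
so the length of `x` has to be found out first. The loop has more rounds than needed and idles at
the comma. -/
theorem sem_readLength {k : ℕ} {x t : List Bool} {Q : ℕ} {s : Store (CutReg k) Bool}
    (hs : s.reg CutReg.nx = 0) (hp : s.pos = 1) (hQ : x.length ≤ Q) :
    ∃ s', (readLength k).sem (encodePair x t) Q s = Tree.leaf s' ∧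
      s'.reg CutReg.nx = x.length ∧ (∀ v, v ≠ CutReg.nx → s'.reg v = s.reg v) ∧
      s'.pos = x.length + 1 ∧ s'.out = s.out := by
  set c : Prog (CutReg k) (Option Bool) Bool := sym fun a => match a with
    | InSym.symbol (some _) =>
      seq (assign CutReg.nx (add (var CutReg.nx) (const 1))) (move Move.right)
    | _ => skip with hc
  have key : ∀ m p (s : Store (CutReg k) Bool), s.reg CutReg.nx = p → s.pos = p + 1 →
      p ≤ x.length → x.length ≤ p + m →
      ∃ s', Tree.iterate (c.sem (encodePair x t) Q) m s = Tree.leaf s' ∧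
        s'.reg CutReg.nx = x.length ∧ (∀ v, v ≠ CutReg.nx → s'.reg v = s.reg v) ∧
        s'.pos = x.length + 1 ∧ s'.out = s.out := by
    intro m
    induction m with
    | zero =>
      intro p s h1 h2 h3 h4
      exact ⟨s, rfl, by omega, fun _ _ => rfl, by omega, rfl⟩
    | succ m ih =>
      intro p s h1 h2 h3 h4
      rw [Tree.iterate, hc, sem, h2]
      rcases Nat.lt_or_ge p x.length with hlt | hge
      · obtain ⟨s', k1, k2, k3, k4, k5⟩ := ih (p + 1)
          (⟨(s.set CutReg.nx (p + 1)).reg, p + 2, s.out⟩) (by simp) rfl hlt (by omega)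
        refine ⟨s', ?_, k2, fun v hv => ?_, k4, k5⟩
        · rw [inputSymbol_encodePair_lt x t hlt, ← k1]
          simp only
          have hmv : moveInput (encodePair x t).length (p + 1) Move.right = p + 2 := by
            rw [length_encodePair]; simp only [moveInput]; omega
          rw [sem_seq_of_leaf (sem_assign_of_le (by simp only [eval, h1]; omega)), sem,
            Tree.leaf_bind]
          simp only [Store.pos_set, h2, hmv, eval, h1]
          rfl
        · rw [k3 v hv]
          simp [hv]
      · have hp : p = x.length := by omega
        obtain ⟨s', k1, k2⟩ := ih p s h1 h2 h3 (by omega)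
        refine ⟨s', ?_, k2⟩
        rw [hp, inputSymbol_encodePair_comma]
        simp only
        rw [sem, Tree.leaf_bind, k1]
  exact key (encodePair x t).length 0 s hs hp (Nat.zero_le _) (by
    rw [length_encodePair]; omega)

theorem sem_readHint {k : ℕ} {x t : List Bool} {Q : ℕ} {s : Store (CutReg k) Bool}
    (hz : s.reg CutReg.z = 1) (hpt : s.reg CutReg.pt = 1) (hp : s.pos = x.length + 2)
    (hQ : wordNum t ≤ Q) :
    ∃ s', (readHint k).sem (encodePair x t) Q s = Tree.leaf s' ∧
      s'.reg CutReg.z = wordNum t ∧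
      (∀ v, v ≠ CutReg.z → v ≠ CutReg.pt → s'.reg v = s.reg v) ∧
      s'.pos ≤ (encodePair x t).length + 1 ∧ s'.out = s.out := by
  set c : Prog (CutReg k) (Option Bool) Bool := sym fun a => match a with
    | InSym.symbol (some b) => seq
      (assign CutReg.z (add (var CutReg.z) (mul (const (1 + b.toNat)) (var CutReg.pt))))
      (seq (assign CutReg.pt (add (var CutReg.pt) (var CutReg.pt))) (move Move.right))
    | _ => skip with hc
  have hpow := (two_pow_length_le_wordNum t).trans hQ
  have key : ∀ m e (s : Store (CutReg k) Bool), s.reg CutReg.z = wordNum (t.take e) →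
      s.reg CutReg.pt = 2 ^ e → s.pos = x.length + 2 + e → e ≤ t.length → t.length ≤ e + m →
      ∃ s', Tree.iterate (c.sem (encodePair x t) Q) m s = Tree.leaf s' ∧
        s'.reg CutReg.z = wordNum t ∧
        (∀ v, v ≠ CutReg.z → v ≠ CutReg.pt → s'.reg v = s.reg v) ∧
        s'.pos ≤ (encodePair x t).length + 1 ∧ s'.out = s.out := by
    intro m
    induction m with
    | zero =>
      intro e s h1 h2 h3 h4 h5
      rw [List.take_of_length_le (by omega)] at h1
      exact ⟨s, rfl, h1, fun _ _ _ => rfl, by rw [length_encodePair]; omega, rfl⟩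
    | succ m ih =>
      intro e s h1 h2 h3 h4 h5
      rw [Tree.iterate, hc, sem, h3]
      rcases Nat.lt_or_ge e t.length with hlt | hge
      · have hw : wordNum (t.take e) + (1 + t[e].toNat) * 2 ^ e = wordNum (t.take (e + 1)) := by
          rw [List.take_add_one, List.getElem?_eq_getElem hlt, Option.toList_some,
            wordNum_append, List.length_take, min_eq_left h4]
          ring
        -- The number of a proper prefix is below `2 ^ t.length`, which is at most the number of the
        -- whole word.
        have hwQ : wordNum (t.take (e + 1)) ≤ Q := by
          have := wordNum_lt (t.take (e + 1))
          rw [List.length_take, min_eq_left hlt] at this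
          rcases Nat.lt_or_ge (e + 1) t.length with h | h
          · have := Nat.pow_le_pow_right (n := 2) (by omega) h
            omega
          · rwa [List.take_of_length_le h]
        have hpQ : 2 ^ e + 2 ^ e ≤ Q := by
          have := Nat.pow_le_pow_right (n := 2) (by omega) hlt
          rw [pow_succ] at this
          omega
        obtain ⟨s', k1, k2, k3, k4, k5⟩ := ih (e + 1)
          (⟨((s.set CutReg.z (wordNum (t.take (e + 1)))).set CutReg.pt (2 ^ e + 2 ^ e)).reg,
            x.length + 2 + e + 1, s.out⟩) (by simp) (by simp; ring) rfl hlt (by omega)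
        refine ⟨s', ?_, k2, fun v hv hv' => ?_, k4, k5⟩
        · rw [inputSymbol_encodePair_hint x t hlt, ← k1]
          simp only
          have hmv : moveInput (encodePair x t).length (x.length + 2 + e) Move.right =
              x.length + 2 + e + 1 := by
            rw [length_encodePair]; simp only [moveInput]; omega
          have e1 : (add (var CutReg.z) (mul (const (1 + t[e].toNat)) (var CutReg.pt)) :
              Expr (CutReg k)).eval s.reg (encodePair x t).length Q =
              wordNum (t.take (e + 1)) := by
            simp only [eval, h1, h2, hw]
          have e2 : (add (var CutReg.pt) (var CutReg.pt) :
              Expr (CutReg k)).eval (s.set CutReg.z (wordNum (t.take (e + 1)))).reg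
                (encodePair x t).length Q = 2 ^ e + 2 ^ e := by
            simp [eval, h2]
          rw [sem_seq_of_leaf (sem_assign_of_le (by rw [e1]; exact hwQ)), e1,
            sem_seq_of_leaf (sem_assign_of_le (by rw [e2]; exact hpQ)), e2, sem, Tree.leaf_bind]
          simp only [Store.pos_set, h3, hmv]
          rfl
        · rw [k3 v hv hv']
          simp [hv, hv']
      · have he : e = t.length := by omega
        obtain ⟨s', k1, k2⟩ := ih e s h1 h2 h3 h4 (by omega)
        refine ⟨s', ?_, k2⟩
        rw [he, inputSymbol_encodePair_end]
        simp only
        rw [sem, Tree.leaf_bind, k1]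
  exact key (encodePair x t).length 0 s hz hpt hp (Nat.zero_le _) (by
    rw [length_encodePair]; omega)

variable {C}

/-- The comma of the pair is presented to `C` as its right end marker, and moves beyond it are
suppressed. Of the output of `C` only the symbols that come after `pre` are printed, without commas.
-/
theorem access_first {x t : List Bool} (Q : ℕ) (pre : List (Option Bool)) :
    Transducer.Access (M := C) CutReg.sim Q (encodePair x t) x (readFirst C) (moveFirst C)
      (fun o => match o with
        | some b => emit b
        | none => skip)
      fun h w s => s.pos = h ∧ h ≤ x.length + 1 ∧ ∃ z, w = pre ++ z ∧ s.out = z.reduceOption := by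
  refine ⟨?_, ?_, ?_, ?_⟩
  · rintro h w s u ⟨j1, j2, j3⟩ hf hp ho
    rw [hp, ho]
    exact ⟨j1, j2, j3⟩
  · rintro h w s ⟨rfl, j2, -⟩ f
    rw [readFirst, sem]
    cases hpos : s.pos with
    | zero => rfl
    | succ p =>
      rcases Nat.lt_or_ge p x.length with hlt | hge
      · rw [inputSymbol_of_lt x hlt, inputSymbol_encodePair_lt x t hlt]
      · have : p = x.length := by omega
        rw [inputSymbol_end x hge, this, inputSymbol_encodePair_comma]
  · rintro h w s m ⟨rfl, j2, j3⟩
    have hlen := length_encodePair x t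
    cases m with
    | left =>
      exact ⟨_, rfl, fun _ => rfl, rfl, moveInput_le j2 _, j3⟩
    | stay => exact ⟨s, rfl, fun _ => rfl, rfl, j2, j3⟩
    | right =>
      rw [moveFirst, sem]
      rcases Nat.lt_or_ge s.pos (x.length + 1) with hlt | hge
      · have hsym : inputSymbol (encodePair x t) s.pos ≠ InSym.symbol none := by
          cases hpos : s.pos with
          | zero => simp [inputSymbol]
          | succ p => rw [inputSymbol_encodePair_lt x t (by omega)]; simp
        have hmove : ∀ a : InSym (Option Bool), a ≠ InSym.symbol none → (match a with
            | InSym.symbol none => skip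
            | _ => move Move.right : Prog (CutReg C.tapes) (Option Bool) Bool) =
              move Move.right := by
          rintro (_ | (_ | b) | _) ha <;> simp at ha ⊢
        rw [hmove _ hsym]
        refine ⟨_, rfl, fun _ => rfl, ?_, moveInput_le j2 _, j3⟩
        simp only [moveInput]
        omega
      · have hp : s.pos = x.length + 1 := by omega
        rw [hp, inputSymbol_encodePair_comma]
        refine ⟨s, rfl, fun _ => rfl, ?_, moveInput_le le_rfl _, j3⟩
        simp only [moveInput]
        omega
  · rintro h w s (_ | b) ⟨rfl, j2, z, rfl, j3⟩
    · refine ⟨s, rfl, fun _ => rfl, rfl, j2, z ++ [none], by simp, ?_⟩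
      rw [j3, List.reduceOption_append]
      simp
    · refine ⟨_, rfl, fun _ => rfl, rfl, j2, z ++ [some b], by simp, ?_⟩
      simp only [j3]
      rw [List.reduceOption_append]
      simp

/-- When `C` ends with `encodePair w w` after having printed `w` and the comma, the part printed
since then is `w`. The cap `Q` belongs to the longer input `(x, t)`, so it is separate from the `Q₀`
used for the hint. -/
theorem ev_cutResume {x t w : List Bool} {S Q Q₀ d : ℕ} {c : C.Config}
    (hS : C.base ^ S ≤ (x.length + 2) ^ d) (hstates : C.numStates ≤ (x.length + 2) ^ d)
    (hd : 1 ≤ d) (hQ : (x.length + 2) ^ d ≤ Q) (htQ : wordNum t ≤ Q)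
    (hc : Halfway C x S Q₀ c) (hw : c.output = w.map some ++ [none])
    (ht : wordNum t = packNum ((x.length + 2) ^ d)
      ((configRegs C.tapes).map (configNum S c)) + 1) :
    (iterTree (fun c b => C.step x b c) Q c).ev (fun c => ind (c.output = encodePair w w)) ≤
      ((cutResume C d).sem (encodePair x t) Q (start (CutReg C.tapes) Bool)).ev
        fun s => ind (s.out = w) := by
  set k := (x.length + 2) ^ d with hk
  have hn : x.length + 2 ≤ k := Nat.le_self_pow (by omega) _
  have hlen := length_encodePair x t
  set s0 : Store (CutReg C.tapes) Bool := ⟨fun _ => 0, 1, []⟩ with hs0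
  have e0 : (move Move.right : Prog (CutReg C.tapes) (Option Bool) Bool).sem (encodePair x t) Q
      (start (CutReg C.tapes) Bool) = Tree.leaf s0 := by
    rw [sem]
    congr 2
  obtain ⟨s1, e1, h1n, h1r, h1p, h1o⟩ := sem_readLength (k := C.tapes) (x := x) (t := t) (Q := Q)
    (s := s0) rfl rfl (by omega)
  have hmv : moveInput (encodePair x t).length s1.pos Move.right = x.length + 2 := by
    rw [h1p]; simp only [moveInput]; omega
  have e2 : (move Move.right : Prog (CutReg C.tapes) (Option Bool) Bool).sem (encodePair x t) Q
      s1 = Tree.leaf ⟨s1.reg, x.length + 2, s1.out⟩ := by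
    rw [sem, hmv]
  obtain ⟨s3, e3, h3z, h3r, h3p, h3o⟩ := sem_readHint (k := C.tapes) (x := x) (t := t) (Q := Q)
    (s := ((⟨s1.reg, x.length + 2, s1.out⟩ : Store (CutReg C.tapes) Bool).set CutReg.z 1).set
      CutReg.pt 1) (by simp) (by simp) rfl htQ
  have e4 : (sub (var CutReg.z) (const 1) : Expr (CutReg C.tapes)).eval s3.reg
      (encodePair x t).length Q = packNum k ((configRegs C.tapes).map (configNum S c)) := by
    simp only [eval, h3z, ht]
    omega
  have hpQ : packNum k ((configRegs C.tapes).map (configNum S c)) ≤ Q := by omega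
  obtain ⟨s5, e5, h5r, h5f, h5p, h5o⟩ := sem_unpack (I := Option Bool) (x := encodePair x t)
    (Q := Q) (k := k) (z := CutReg.z) (K := pow (add (var CutReg.nx) (const 2)) d)
    (configNum S c) (configRegs C.tapes) (nodup_configRegs _)
    (by rw [mem_configRegs]; simp) (fun v _ => configNum_lt hc hS hstates hn v) hQ
    (s := ⟨(s3.set CutReg.z (packNum k ((configRegs C.tapes).map (configNum S c)))).reg, 0,
      (s3.set CutReg.z (packNum k ((configRegs C.tapes).map (configNum S c)))).out⟩)
    (fun s' hs' => by
      rw [eval_pow]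
      simp only [eval]
      rw [hs' _ (by rw [mem_configRegs]; simp) (by simp)]
      simp [h3r, h1n, hk])
    (by simp) hpQ
  have hhp : s5.reg CutReg.hp = c.inputHead :=
    h5r _ ((mem_configRegs _).2 (Or.inl rfl))
  have hsim : ∀ r, s5.reg (CutReg.sim r) = configNum S c (CutReg.sim r) := fun r =>
    h5r _ ((mem_configRegs _).2 (Or.inr ⟨r, rfl⟩))
  have hhead := hc.head
  have e6 : (loop (var CutReg.hp) (move Move.right) :
      Prog (CutReg C.tapes) (Option Bool) Bool).sem (encodePair x t) Q s5 =
      Tree.leaf ⟨s5.reg, c.inputHead, s5.out⟩ := by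
    rw [sem]
    simp only [eval]
    rw [hhp, iterate_move_right _ _ _ _ (by rw [h5p, hlen]; simp only; omega), h5p, Nat.zero_add]
  have h1Q : 1 ≤ Q := by omega
  rw [cutResume, sem_seq_of_leaf e0, sem_seq_of_leaf e1, sem_seq_of_leaf e2,
    sem_seq_of_leaf (sem_assign_of_le (by simpa [eval] using h1Q)), eval,
    sem_seq_of_leaf (sem_assign_of_le (by simpa [eval] using h1Q)), eval,
    sem_seq_of_leaf e3, sem_seq_of_leaf (sem_assign_of_le (by rw [e4]; exact hpQ)), e4,
    sem_seq_of_leaf (sem_rewind _ _ (s3.set CutReg.z _) h3p), sem_seq_of_leaf e5,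
    sem_seq_of_leaf e6]
  refine (access_first Q (w.map some ++ [none])).ev_loop (ψ := fun v => ind (v = encodePair w w))
    (s := ⟨s5.reg, c.inputHead, s5.out⟩)
    CutReg.sim_injective (hS.trans hQ) (hstates.trans hQ) hc.safe
    ⟨hsim _, fun i => hsim _, fun i => hsim _⟩ ⟨rfl, hhead, [], by simp [hw], ?_⟩ ?_
  · change s5.out = _
    rw [h5o]
    exact h3o.trans h1o
  · rintro h v s ⟨-, -, z, rfl, hz⟩
    refine ind_mono fun hv => ?_
    have : z = w.map some := by simpa [encodePair] using hv
    rw [hz, this]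
    simp [List.reduceOption]

end Resume


/-! ### From two copies to reproducible solutions, and the remaining implication -/

theorem eq_of_prefix_encodePair {w y z : List Bool}
    (h : w.map some ++ [none] <+: encodePair y z) : w = y := by
  induction w generalizing y with
  | nil =>
    cases y with
    | nil => rfl
    | cons b y => simp [encodePair] at h
  | cons a w ih =>
    cases y with
    | nil => simp [encodePair] at h
    | cons b y =>
      simp only [encodePair, List.map_cons, List.cons_append, List.cons_prefix_cons,
        Option.some.injEq] at h
      rw [h.1, ih h.2]

theorem prob_nonneg (E : (ℕ → Bool) → Prop) : 0 ≤ prob E := measureReal_nonneg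

theorem lt_two_pow_log (n : ℕ) : n + 2 ≤ 2 ^ (Nat.log 2 n + 2) := by
  have := Nat.lt_pow_succ_log_self (b := 2) (by omega) n
  have h1 : 1 ≤ 2 ^ Nat.log 2 n := Nat.one_le_two_pow
  rw [Nat.succ_eq_add_one, pow_succ] at this
  rw [pow_add]
  omega

/-- If the rest of the computation from `c` outputs a second copy with positive probability, then
`c` is at the comma. -/
theorem Halfway.exists_copy {C : Transducer Bool (Option Bool)} {x : List Bool} {S Q : ℕ}
    {c : C.Config} (hc : Halfway C x S Q c) (hdone : none ∈ c.output ∨ C.halt c.state)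
    (valid : List Bool → Prop) {a : ℝ} (ha : 0 < a)
    (h : a ≤ (iterTree (fun c b => C.step x b c) Q c).ev fun c =>
      ind (∃ y, valid y ∧ c.output = encodePair y y)) :
    ∃ w, valid w ∧ c.output = w.map some ++ [none] ∧
      a ≤ (iterTree (fun c b => C.step x b c) Q c).ev fun c => ind (c.output = encodePair w w) := by
  by_cases hn : none ∈ c.output
  · obtain ⟨w, hw⟩ := hc.comma hn
    have hpre : ∀ c' : C.Config, c.output <+: c'.output →
        (∃ y, valid y ∧ c'.output = encodePair y y) → valid w ∧ c'.output = encodePair w w := by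
      rintro c' hp ⟨y, hy, hc'⟩
      rw [hw, hc'] at hp
      rw [eq_of_prefix_encodePair hp]
      exact ⟨hy, hc'⟩
    have h1 := h.trans (Tree.ev_mono_of_all (Transducer.prefix_output x Q c) fun c' hp =>
      ind_mono (hpre c' hp))
    refine ⟨w, ?_, hw, h1.trans (Tree.ev_mono _ fun _ => ind_mono And.right)⟩
    -- Validity of `w` does not depend on the tosses to come: if it failed, the expectation in `h1`
    -- would be zero.
    by_contra hv
    simp only [hv, false_and, ind_false not_false, Tree.ev_const] at h1
    linarith
  · have hh : C.halt c.state := hdone.resolve_left hn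
    have h0 : C.HaltsWithin x 0 c := hh
    -- A machine that has halted without a comma has not output a pair.
    rw [h0.ev_eq (Nat.zero_le Q), iterTree, Tree.ev_leaf, ind_false] at h
    · linarith
    · rintro ⟨y, -, hy⟩
      exact hn (hy ▸ by simp [encodePair])

theorem logSpaceReproducible_of_hasTwoCopies {R : SearchProblem} (h : HasTwoCopies R) :
    LogSpaceReproducible R := by
  obtain ⟨C, hC, ε, hε, h⟩ := h
  obtain ⟨d₀, hd₀⟩ := hC.exists_fits
  set D := (d₀ + 1) * (2 * C.tapes + 2) with hD
  obtain ⟨A, hA, hAprob⟩ := (cutHint C (d₀ + 1)).exists_transducer (D + 1) (by omega)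
  obtain ⟨B, hB, hBprob⟩ := (cutResume C (d₀ + 1)).exists_transducer (D + 1) (by omega)
  -- The square root is what Markov's inequality asks for (`ε n ≤ δ n ^ 2`), the maximum allows for
  -- negative `ε n`, and the second summand makes `δ n` strictly positive.
  set δ : ℕ → ℝ := fun n => Real.sqrt (max (ε n) 0) + 1 / ((n : ℝ) + 1) with hδ
  refine ⟨δ, ?_, A, B, hA, hB, 2 * D, fun x hx => ?_⟩
  · have h1 : Tendsto (fun n => Real.sqrt (max (ε n) 0)) atTop (𝓝 0) := by
      have h2 := (Real.continuous_sqrt.tendsto _).comp (hε.max (tendsto_const_nhds (x := (0 : ℝ))))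
      simp only [max_self, Real.sqrt_zero] at h2
      exact h2
    simpa [hδ] using h1.add tendsto_one_div_add_atTop_nhds_zero_nat
  · set n := x.length with hn
    have hδ0 : 0 < δ n := by
      have : (0 : ℝ) < 1 / ((n : ℝ) + 1) := by positivity
      have := Real.sqrt_nonneg (max (ε n) 0)
      simp only [hδ]
      linarith
    have hδε : ε n ≤ δ n ^ 2 := by
      have h1 : Real.sqrt (max (ε n) 0) ^ 2 ≤ δ n ^ 2 := by
        refine pow_le_pow_left₀ (Real.sqrt_nonneg _) ?_ 2
        simp only [hδ]
        have : (0 : ℝ) < 1 / ((n : ℝ) + 1) := by positivity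
        linarith
      rw [Real.sq_sqrt (le_max_right _ _)] at h1
      exact (le_max_left _ _).trans h1
    obtain ⟨S, hS⟩ := hd₀ x
    set Q := (n + 2) ^ (D + 1) with hQ
    have hkQ : ((n + 2) ^ (d₀ + 1)) ^ (2 * C.tapes + 2) ≤ Q := by
      rw [← pow_mul]
      exact pow_mono_exp _ (by omega)
    have hd₀Q : (n + 2) ^ (d₀ + 1) ≤ Q := (Nat.le_self_pow (by omega) _).trans hkQ
    have hk : (n + 2) ^ d₀ ≤ (n + 2) ^ (d₀ + 1) := pow_mono_exp _ (by omega)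
    have hfit : C.Fits x S Q := hS.mono (hk.trans hd₀Q)
    set p : C.Config → Prop := fun c => none ∈ c.output with hp
    set ψ : C.Config → ℝ := fun c => ind (∃ y, R x y ∧ c.output = encodePair y y) with hψ
    set H : C.Config → ℝ := fun c => (iterTree (fun c b => C.step x b c) Q c).ev ψ with hH
    -- `H c` is the probability of success given the configuration `c` at the comma; its mean is the
    -- success probability of `C`.
    have h1 : 1 - ε n ≤ (iterTree (C.stoppedStep x p) Q C.init).ev H := by
      have hinit : C.HaltsWithin x Q C.init := Transducer.iterTree_halt x hfit.halts
      rw [hinit.ev_stopped, ← C.prob_outputs x hfit.halts fun v => ∃ y, R x y ∧ v = encodePair y y]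
      refine (h x hx).trans (le_of_eq (congrArg prob (funext fun r => propext ⟨?_, ?_⟩)))
      · rintro ⟨y, h2, h1⟩
        exact ⟨_, h1, y, h2, rfl⟩
      · rintro ⟨_, h1, y, h2, rfl⟩
        exact ⟨y, h2, h1⟩
    have h2 := ev_ind_ge _ H (fun c => Tree.ev_le_one _ fun _ => ind_le_one _) hδ0 hδε h1
    rw [hAprob x fun t => t.length ≤ 2 * D * (Nat.log 2 n + 1) ∧ Reproduces R B (δ n) x t]
    refine h2.trans (ev_cutHint (hS.base_le.trans hk) (hS.states_le.trans hk) (by omega) hfit hkQ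
      (φ := fun t => ind (t.length ≤ 2 * D * (Nat.log 2 n + 1) ∧ Reproduces R B (δ n) x t)) ?_)
    intro c t hc hdone ht
    have hlt := packNum_configNum_lt hc (hS.base_le.trans hk) (hS.states_le.trans hk)
      (Nat.le_self_pow (by omega) _)
    have htle : wordNum t ≤ (n + 2) ^ D := by
      rw [hD, pow_mul, ht]
      exact hlt
    refine ind_mono fun hHc => ⟨?_, ?_⟩
    -- The number of `t` is at most `(n + 2) ^ D`, so `t` has at most `(log n + 2) * D` symbols,
    -- which is at most `2 * D * (log n + 1)`.
    · have h3 : 2 ^ t.length ≤ 2 ^ ((Nat.log 2 n + 2) * D) := by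
        rw [pow_mul]
        exact ((two_pow_length_le_wordNum t).trans htle).trans
          (Nat.pow_le_pow_left (lt_two_pow_log n) _)
      have h4 := (Nat.pow_le_pow_iff_right (by omega)).1 h3
      nlinarith
    -- If `δ n ≥ 1`, nothing is required of the probability and any valid output will do; otherwise
    -- success has positive probability, as `exists_copy` requires.
    · rcases le_or_gt (1 - δ n) 0 with h0 | h0
      · obtain ⟨y, hy⟩ := hx
        exact ⟨y, hy, h0.trans (prob_nonneg _)⟩
      · obtain ⟨w, hw, hcw, hprob⟩ := hc.exists_copy hdone (fun y => R x y) h0 hHc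
        refine ⟨w, hw, ?_⟩
        set Q' := ((encodePair x t).length + 2) ^ (D + 1) with hQ'
        have hQQ' : Q ≤ Q' := Nat.pow_le_pow_left (by rw [length_encodePair]; omega) _
        have h3 := hBprob (encodePair x t) fun v => v = w
        simp only [exists_eq_right] at h3
        rw [h3]
        -- `B` simulates `Q'` steps, a number computed from the length of the pair; by then `C` has
        -- halted, so the surplus over `Q` does not matter.
        rw [← hc.halts.ev_eq hQQ'] at hprob
        refine hprob.trans (ev_cutResume (hS.base_le.trans hk) (hS.states_le.trans hk) (by omega)
          (hd₀Q.trans hQQ') ?_ hc hcw ht)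
        exact htle.trans ((pow_mono_exp _ (by omega)).trans hQQ')

theorem twoThirds_of_logSpaceReproducible {R : SearchProblem} (h : LogSpaceReproducible R) :
    LogSpaceReproducibleTwoThirds R := by
  obtain ⟨ε, hε, A, B, hA, hB, c, h⟩ := h
  classical
  -- The value 1 makes the claim void where `ε n` exceeds 1/3, which happens for finitely many `n`
  -- and so does not affect the limit.
  refine ⟨fun n => if ε n ≤ 1 / 3 then ε n else 1, ?_, A, B, hA, hB, c, fun x hx => ?_⟩
  · refine hε.congr' ?_
    filter_upwards [hε.eventually_le_const (show (0 : ℝ) < 1 / 3 by norm_num)] with n hn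
    rw [if_pos hn]
  · have hx' := h x hx
    by_cases hle : ε x.length ≤ 1 / 3
    · simp only [if_pos hle]
      refine hx'.trans (measureReal_mono ?_ (measure_ne_top _ _))
      rintro r ⟨t, h1, h2, y, h3, h4⟩
      exact ⟨t, h1, h2, y, h3, by linarith⟩
    · simp only [if_neg hle, sub_self]
      exact prob_nonneg _

end RandLogSpace

theorem mainTheorem5 (R : RandLogSpace.SearchProblem) :
    (RandLogSpace.LogSpaceReproducible R ↔ RandLogSpace.HasTwoCopies R) ∧
    (RandLogSpace.LogSpaceReproducibleTwoThirds R ↔ RandLogSpace.HasTwoCopies R) := by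
  have h12 := @RandLogSpace.twoThirds_of_logSpaceReproducible R
  have h23 := @RandLogSpace.hasTwoCopies_of_twoThirds R
  have h31 := @RandLogSpace.logSpaceReproducible_of_hasTwoCopies R
  exact ⟨⟨fun h => h23 (h12 h), h31⟩, ⟨h23, fun h => h12 (h31 h)⟩⟩
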